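/- There is an absolute constant $\epsilon_0>0$ such that the following holds. Let $1<p<\infty$, and let $\psi_0:\mathbf R\to\mathbf C$ be a smooth function supported in $[-5/2,-1/2]\cup[1/2,5/2]$ with $\sum_{k\in\mathbf Z}\psi_k(t)=1$ for all $t\ne0$, where $\psi_k(t):=\psi_0(2^{-k}t)$; let $\check\psi_k$ be the inverse Fourier transform of $\psi_k$. Then there is a constant $C<\infty$, depending only on $p$ and $\psi_0$, such that for every Lipschitz function $h:\mathbf R^2\to\mathbf R$ with $\|\nabla h-(1,0)\|_\infty\le\epsilon_0$ and every measurable $u:\mathbf R\to\mathbf R$ with $\|u\|_\infty\le1$ the following is true. For $t\in\mathbf R$ put $\Gamma_t:=\{x\in\mathbf R^2:h(x)=t\}$, $v_t:=(1,u(t))$, $v_t^\perp:=(-u(t),1)$, and let $h_t:\mathbf R^2\to\mathbf R$ be the function with $h_t(z)=d$ whenever $z-y=d\,v_t$ for some $y\in\Gamma_t$. Let $\delta(h_t(y))\,dy$ denote the measure which is the vague limit of $(2\epsilon)^{-1}\mathbf 1_{\{|h_t(y)|<\epsilon\}}\,dy$ as $\epsilon\to0^+$. For $k\in\mathbf Z$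 define $$\tilde P_kf(x):=\int_{\mathbf R^2}f(y)\,\check\psi_k\big((x-y)\cdot v_t^{\perp}\big)\,\delta(h_t(y))\,dy,\qquad t=h(x).$$ (i) For every $f\in L^p(\mathbf R^2)$ and every $k$, the integral defining $\tilde P_kf(x)$ converges absolutely for almost every $x$, $\tilde P_kf\in L^p$, and $$C^{-1}\|f\|_p\le\Big\|\Big(\sum_{k\in\mathbf Z}|\tilde P_kf|^2\Big)^{1/2}\Big\|_p\le C\|f\|_p .$$ (ii) For every $f\in L^p(\mathbf R^2)$ and every $k$, the adjoint value $\tilde P_k^*f\in L^p$ exists, that is, $\int(\tilde P_kg)\,\overline f=\int g\,\overline{\tilde P_k^*f}$ for all $g\in L^{p'}$, $1/p+1/p'=1$, and $$C^{-1}\|f\|_p\le\Big\|\Big(\sum_{k\in\mathbf Z}|\tilde P_k^*f|^2\Big)^{1/2}\Big\|_p\le C\|f\|_p .$$ -/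

import Mathlib

open MeasureTheory Filter Topology
open scoped ENNReal NNReal FourierTransform ContDiff ComplexConjugate

noncomputable section

namespace AdaptedLP

/-- The Euclidean plane. -/
abbrev Plane : Type := EuclideanSpace ℝ (Fin 2)

/-- The standing assumption on the level function: `h` is Lipschitz and
`‖∇h - (1, 0)‖_∞ ≤ ε₀` (essential supremum; `∇h` exists almost everywhere). -/
def IsLevelFunction (ε₀ : ℝ) (h : Plane → ℝ) : Prop :=
  (∃ K : ℝ≥0, LipschitzWith K h) ∧
    ∀ᵐ x : Plane, ‖gradient h x - (!₂[1, 0] : Plane)‖ ≤ ε₀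

/-- The standing assumption on the slope: `u` is Lebesgue measurable and `‖u‖_∞ ≤ 1`. -/
def IsSlope (u : ℝ → ℝ) : Prop :=
  AEMeasurable u volume ∧ ∀ᵐ t : ℝ, |u t| ≤ 1

/-- The value `v_t = (1, u(t))` of the vector field `v = (1, u(h))` on the level curve
`Γ_t = {h = t}`. -/
def dir (u : ℝ → ℝ) (t : ℝ) : Plane := !₂[1, u t]

/-- `v_t^⊥ = (-u(t), 1)`, that is `v_t` rotated by a right angle. -/
def dirPerp (u : ℝ → ℝ) (t : ℝ) : Plane := !₂[-u t, 1]

/-- The level curve `Γ_t`. -/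
def levelCurve (h : Plane → ℝ) (t : ℝ) : Set Plane := {x | h x = t}

open Classical in
/-- The auxiliary function `h_t`: if `z - y = d • v_t` for some `y ∈ Γ_t`, then `h_t z = d`
(and `0` if there is no such `d`). -/
def auxFun (h : Plane → ℝ) (u : ℝ → ℝ) (t : ℝ) (z : Plane) : ℝ :=
  if H : ∃ d : ℝ, ∃ y ∈ levelCurve h t, z - y = d • dir u t then H.choose else 0

/-- `μ` is the measure `δ(G(y)) dy`, that is, the vague limit of
`(2ε)⁻¹ 1_{|G(y)| < ε} dy` as `ε → 0⁺`. Such a `μ` is unique if it exists. -/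
def IsDelta (G : Plane → ℝ) (μ : Measure Plane) : Prop :=
  IsFiniteMeasureOnCompacts μ ∧
    ∀ φ : Plane → ℝ, Continuous φ → HasCompactSupport φ →
      Tendsto (fun ε : ℝ => (2 * ε)⁻¹ * ∫ y in {y | |G y| < ε}, φ y) (𝓝[>] 0)
        (𝓝 (∫ y, φ y ∂μ))

open Classical in
/-- The measure `δ(G(y)) dy` (and `0` if the vague limit does not exist). -/
def deltaMeasure (G : Plane → ℝ) : Measure Plane :=
  if H : ∃ μ : Measure Plane, IsDelta G μ then H.choose else 0

/-- A Littlewood-Paley cut-off: a smooth function supported in `[-5/2, -1/2] ∪ [1/2, 5/2]`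
with `∑_k ψ₀(2^{-k} t) = 1` for all `t ≠ 0`. -/
structure IsCutoff (ψ₀ : ℝ → ℂ) : Prop where
  smooth : ContDiff ℝ ∞ ψ₀
  support_subset : Function.support ψ₀ ⊆ Set.Icc (-5 / 2) (-1 / 2) ∪ Set.Icc (1 / 2) (5 / 2)
  hasSum_one : ∀ t : ℝ, t ≠ 0 → HasSum (fun k : ℤ => ψ₀ ((2 : ℝ) ^ (-k) * t)) 1

/-- `ψ_k(t) = ψ₀(2^{-k} t)`. -/
def dilate (ψ₀ : ℝ → ℂ) (k : ℤ) : ℝ → ℂ := fun t => ψ₀ ((2 : ℝ) ^ (-k) * t)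

/-- The integrand `f(y) ψ̌_k((x - y) · v_t^⊥)`, where `t = h(x)`. -/
def integrand (h : Plane → ℝ) (u : ℝ → ℝ) (ψ₀ : ℝ → ℂ) (k : ℤ) (f : Plane → ℂ)
    (x y : Plane) : ℂ :=
  f y * 𝓕⁻ (dilate ψ₀ k) (inner ℝ (x - y) (dirPerp u (h x)))

/-- The adapted Littlewood-Paley operator
`P̃_k f(x) = ∫ δ(h_t(y)) f(y) ψ̌_k((x - y) · v_t^⊥) dy`, where `t = h(x)`. -/
def adaptedLP (h : Plane → ℝ) (u : ℝ → ℝ) (ψ₀ : ℝ → ℂ) (k : ℤ) (f : Plane → ℂ) :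
    Plane → ℂ :=
  fun x => ∫ y, integrand h u ψ₀ k f x y ∂(deltaMeasure (auxFun h u (h x)))

/-- `G ∈ L^p` is the value at `g ∈ L^p` of the adjoint of the operator `T` acting on `L^{p'}`,
`1/p + 1/p' = 1`: `⟨T f, g⟩ = ⟨f, G⟩` for every `f ∈ L^{p'}`. Such a `G` is unique
up to null sets if it exists. -/
def IsAdjointValue (T : (Plane → ℂ) → (Plane → ℂ)) (p : ℝ≥0∞) (g G : Plane → ℂ) : Prop :=
  MemLp G p ∧ ∀ f : Plane → ℂ, MemLp f p.conjExponent →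
    ∫ x, T f x * conj (g x) = ∫ x, f x * conj (G x)

open Classical in
/-- The adjoint `P̃_k^*` on `L^p` (and `0` where it does not exist). -/
def adaptedLPAdjoint (h : Plane → ℝ) (u : ℝ → ℝ) (ψ₀ : ℝ → ℂ) (p : ℝ≥0∞) (k : ℤ)
    (g : Plane → ℂ) : Plane → ℂ :=
  if H : ∃ G : Plane → ℂ, IsAdjointValue (adaptedLP h u ψ₀ k) p g G then H.choose else 0

/-- The square function `(∑_k |F_k|²)^{1/2}`, with values in `[0, ∞]`. -/
def squareFun (F : ℤ → Plane → ℂ) (x : Plane) : ℝ≥0∞ :=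
  (∑' k : ℤ, ‖F k x‖ₑ ^ 2) ^ (1 / 2 : ℝ)

end AdaptedLP

end

/-! ### Convolution with Schwartz kernels and the L² bound -/

noncomputable section

namespace AdaptedLP

open scoped SchwartzMap Convolution

/-! One change of variables reduces everything to the Littlewood-Paley theorem on the line. Give x
the coordinates t = h(x) and w = x · v_t^⊥. Since h differs from the first coordinate by a function
with small Lipschitz constant and |u| ≤ 1, every line of direction v_t meets Γ_t exactly once, so
(t, w) is a bijective chart (`IsTilted.bijective_levelCoord`). Let γ_t(w) be the point of Γ_t with
coordinate w. The map (w, d) ↦ γ_t(w) + d v_t preserves Lebesgue measure and turns h_t into the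
coordinate d, so δ(h_t(y)) dy is the image of dw under γ_t (`deltaMeasure_eq`). As (x - y) · v_t^⊥
is a difference of w-coordinates, P̃_k is convolution with ψ̌_k in w, for frozen t
(`IsChart.adaptedLP_eq`).

The chart distorts measure by a bounded factor although u is merely measurable. It is a composition
of two maps, each changing one coordinate by an increasing bi-Lipschitz function with the other
coordinate frozen, and u enters only as a parameter of the frozen t
(`IsTilted.isComparable_levelCoord`). Hence the one-dimensional inequalities can be integrated over
t. In the chart the adjoint is J⁻¹ ∘ (convolution with multiplier conj ψ_k) ∘ J, where J is the
bounded density of the chart (`IsChart.isAdjointValue`), so it obeys the same inequalities for the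
conjugate cut-off.

On the line, `exists_eLpNorm_convol_le` is a Calderón-Zygmund theorem for Schwartz kernels whose
constants see only the suprema of the multiplier and of x²|K'(x)|. Both are uniform over signed sums
of Littlewood-Paley pieces, and Khintchine's inequality turns this into the upper square function
bound. The lower bound follows by duality, from the reproducing formula and the upper bound for a
wider multiplier at the conjugate exponent (`enorm_integral_mul_le_square`). -/

/-- The convolution of `f` with the kernel `K` on the line. -/
def convol (K f : ℝ → ℂ) (x : ℝ) : ℂ := ∫ y, f y * K (x - y)

lemma memLp_comp_sub_left {K : ℝ → ℂ} {q : ℝ≥0∞} (hK : MemLp K q) (x : ℝ) :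
    MemLp (fun y => K (x - y)) q :=
  hK.comp_measurePreserving (Measure.measurePreserving_sub_left volume x)

lemma eLpNorm_comp_sub_left {K : ℝ → ℂ} (q : ℝ≥0∞) (hK : AEStronglyMeasurable K) (x : ℝ) :
    eLpNorm (fun y => K (x - y)) q = eLpNorm K q :=
  eLpNorm_comp_measurePreserving hK (Measure.measurePreserving_sub_left volume x)

lemma memLp_schwartz (K : 𝓢(ℝ, ℂ)) (q : ℝ≥0∞) : MemLp (fun x => K x) q volume :=
  K.memLp q volume

lemma integrable_mul_comp_sub (K : 𝓢(ℝ, ℂ)) {p : ℝ≥0∞} (hp : 1 ≤ p) {f : ℝ → ℂ}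
    (hf : MemLp f p) (x : ℝ) : Integrable (fun y => f y * K (x - y)) := by
  have := ENNReal.HolderConjugate.conjExponent hp
  exact hf.integrable_mul (memLp_comp_sub_left (K.memLp p.conjExponent) x)

lemma aestronglyMeasurable_convol_integrand {α : Type*} [MeasurableSpace α] {μ : Measure α}
    [SFinite μ] {K : ℝ → ℂ} (hK : Continuous K) {f : ℝ → ℂ} (hf : AEStronglyMeasurable f)
    {w : α → ℝ} (hw : Measurable w) :
    AEStronglyMeasurable (fun q : α × ℝ => f q.2 * K (w q.1 - q.2)) (μ.prod volume) :=
  hf.comp_snd.mul (hK.measurable.comp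
    ((hw.comp measurable_fst).sub measurable_snd)).aestronglyMeasurable

lemma aestronglyMeasurable_convol {K : ℝ → ℂ} (hK : Continuous K) {f : ℝ → ℂ}
    (hf : AEStronglyMeasurable f) : AEStronglyMeasurable (convol K f) :=
  (aestronglyMeasurable_convol_integrand hK hf measurable_id).integral_prod_right'

lemma convol_sub (K : 𝓢(ℝ, ℂ)) {p : ℝ≥0∞} (hp : 1 ≤ p) {f g : ℝ → ℂ}
    (hf : MemLp f p) (hg : MemLp g p) (x : ℝ) :
    convol K (f - g) x = convol K f x - convol K g x := by
  unfold convol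
  rw [← integral_sub (integrable_mul_comp_sub K hp hf x) (integrable_mul_comp_sub K hp hg x)]
  simp only [Pi.sub_apply, sub_mul]

lemma convol_add (K : 𝓢(ℝ, ℂ)) {p q : ℝ≥0∞} (hp : 1 ≤ p) (hq : 1 ≤ q) {f g : ℝ → ℂ}
    (hf : MemLp f p) (hg : MemLp g q) (x : ℝ) :
    convol K (f + g) x = convol K f x + convol K g x := by
  unfold convol
  rw [← integral_add (integrable_mul_comp_sub K hp hf x) (integrable_mul_comp_sub K hq hg x)]
  simp only [Pi.add_apply, add_mul]

/-- Hölder, as a Schwartz kernel lies in every conjugate space. Approximation in L^p therefore gives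
pointwise convergence of the convolutions. -/
lemma enorm_convol_le (K : 𝓢(ℝ, ℂ)) {p : ℝ≥0∞} (hp : 1 ≤ p) {f : ℝ → ℂ}
    (hf : AEStronglyMeasurable f) (x : ℝ) :
    ‖convol K f x‖ₑ ≤ eLpNorm f p * eLpNorm (K : ℝ → ℂ) p.conjExponent := by
  have := ENNReal.HolderConjugate.conjExponent hp
  have h1 := eLpNorm_smul_le_mul_eLpNorm (μ := volume) (p := p) (q := p.conjExponent) (r := 1)
    (memLp_comp_sub_left (K.memLp p.conjExponent) x).1 hf
  rw [eLpNorm_comp_sub_left _ K.continuous.aestronglyMeasurable x] at h1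
  refine le_trans ?_ h1
  rw [eLpNorm_one_eq_lintegral_enorm]
  exact enorm_integral_le_lintegral_enorm _

lemma exists_seq_smooth_tendsto {p : ℝ≥0∞} (hp : 1 ≤ p) (hp' : p ≠ ⊤) {f : ℝ → ℂ}
    (hf : MemLp f p) : ∃ F : ℕ → ℝ → ℂ, (∀ n, HasCompactSupport (F n) ∧ ContDiff ℝ ∞ (F n)) ∧
      Tendsto (fun n => eLpNorm (f - F n) p) atTop (𝓝 0) := by
  have key : ∀ n : ℕ, ∃ g : ℝ → ℂ, HasCompactSupport g ∧ ContDiff ℝ ∞ g ∧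
      eLpNorm (f - g) p ≤ ENNReal.ofReal (1 / ((n : ℝ) + 1)) := fun n =>
    MemLp.exist_eLpNorm_sub_le hp' hp hf (by positivity)
  choose F h1 h2 h3 using key
  refine ⟨F, fun n => ⟨h1 n, h2 n⟩, ?_⟩
  refine tendsto_of_tendsto_of_tendsto_of_le_of_le tendsto_const_nhds ?_ (fun n => zero_le) h3
  have := ENNReal.tendsto_ofReal (tendsto_one_div_add_atTop_nhds_zero_nat (𝕜 := ℝ))
  simpa using this

lemma memLp_of_smooth {f : ℝ → ℂ} (h1 : HasCompactSupport f) (h2 : ContDiff ℝ ∞ f) (p : ℝ≥0∞) :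
    MemLp f p :=
  h2.continuous.memLp_of_hasCompactSupport h1

/-- An `L^p` bound for convolution with a Schwartz kernel extends from test functions. -/
lemma eLpNorm_convol_le_of_smooth (K : 𝓢(ℝ, ℂ)) {p r : ℝ≥0∞} (hp : 1 ≤ p) (hp' : p ≠ ⊤)
    {A : ℝ≥0∞} (hA : A ≠ ⊤)
    (H : ∀ f : ℝ → ℂ, HasCompactSupport f → ContDiff ℝ ∞ f →
      eLpNorm (convol K f) r ≤ A * eLpNorm f p) {f : ℝ → ℂ} (hf : MemLp f p) :
    eLpNorm (convol K f) r ≤ A * eLpNorm f p := by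
  obtain ⟨F, hF, hlim⟩ := exists_seq_smooth_tendsto hp hp' hf
  have hFm : ∀ n, MemLp (F n) p := fun n => memLp_of_smooth (hF n).1 (hF n).2 p
  -- Pointwise convergence is enough for Fatou, so no prior continuity of the operator on L^p is
  -- needed.
  have hpt : ∀ x, Tendsto (fun n => convol K (F n) x) atTop (𝓝 (convol K f x)) := by
    intro x
    rw [tendsto_iff_edist_tendsto_0]
    have hK : eLpNorm (K : ℝ → ℂ) p.conjExponent volume ≠ ⊤ := (memLp_schwartz K p.conjExponent).2.ne
    have h0 : Tendsto (fun n => eLpNorm (f - F n) p * eLpNorm (K : ℝ → ℂ) p.conjExponent) atTop (𝓝 0) := by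
      simpa using ENNReal.Tendsto.mul_const hlim (Or.inr hK)
    refine tendsto_of_tendsto_of_tendsto_of_le_of_le tendsto_const_nhds h0 (fun n => zero_le) ?_
    intro n
    beta_reduce
    rw [edist_comm, edist_eq_enorm_sub, ← convol_sub K hp hf (hFm n)]
    exact enorm_convol_le K hp (hf.sub (hFm n)).1 x
  refine (Lp.eLpNorm_lim_le_liminf_eLpNorm
    (fun n => aestronglyMeasurable_convol K.continuous (hFm n).1) _
    (Eventually.of_forall hpt)).trans ?_
  have hle : ∀ n, eLpNorm (convol K (F n)) r ≤ A * (eLpNorm f p + eLpNorm (f - F n) p) := by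
    intro n
    refine (H _ (hF n).1 (hF n).2).trans ?_
    gcongr
    have e := eLpNorm_sub_le (μ := volume) (p := p) hf.1 (hf.1.sub (hFm n).1) hp
    have e2 : f - (f - F n) = F n := sub_sub_cancel _ _
    rw [e2] at e
    exact e
  have hl : Tendsto (fun n => A * (eLpNorm f p + eLpNorm (f - F n) p)) atTop
      (𝓝 (A * eLpNorm f p)) := by
    refine ENNReal.Tendsto.const_mul ?_ (Or.inr hA)
    have := hlim.const_add (eLpNorm f p)
    rwa [add_zero] at this
  exact (liminf_le_liminf (Eventually.of_forall hle)).trans hl.liminf_eq.le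

lemma convol_schwartz (K f : 𝓢(ℝ, ℂ)) (x : ℝ) :
    convol K f x = SchwartzMap.convolution (ContinuousLinearMap.mul ℂ ℂ) f K x := by
  rw [SchwartzMap.convolution_apply, convolution_def]
  rfl

lemma fourier_convol (K f : 𝓢(ℝ, ℂ)) (ξ : ℝ) :
    𝓕 (SchwartzMap.convolution (ContinuousLinearMap.mul ℂ ℂ) f K) ξ = 𝓕 f ξ * 𝓕 K ξ := by
  rw [SchwartzMap.fourier_convolution, SchwartzMap.pairing_apply_apply]
  rfl

lemma eLpNorm_two_fourier (f : 𝓢(ℝ, ℂ)) :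
    eLpNorm ((𝓕 f : 𝓢(ℝ, ℂ)) : ℝ → ℂ) 2 (volume : Measure ℝ) = eLpNorm (f : ℝ → ℂ) 2 volume := by
  have := SchwartzMap.norm_fourier_toL2_eq f
  rw [SchwartzMap.norm_toLp, SchwartzMap.norm_toLp] at this
  have h1 : eLpNorm ((𝓕 f : 𝓢(ℝ, ℂ)) : ℝ → ℂ) 2 (volume : Measure ℝ) ≠ ⊤ :=
    (memLp_schwartz (𝓕 f) 2).2.ne
  have h2 : eLpNorm (f : ℝ → ℂ) 2 (volume : Measure ℝ) ≠ ⊤ := (memLp_schwartz f 2).2.ne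
  exact (ENNReal.toReal_eq_toReal_iff' h1 h2).1 this

/-- The `L²` bound for a convolution operator in terms of its multiplier. -/
lemma eLpNorm_two_convol_le (K : 𝓢(ℝ, ℂ)) {B : ℝ≥0} (hB : ∀ ξ, ‖𝓕 K ξ‖ ≤ B) {f : ℝ → ℂ}
    (hf : MemLp f 2) : eLpNorm (convol K f) 2 ≤ B * eLpNorm f 2 := by
  refine eLpNorm_convol_le_of_smooth K (by norm_num) (by norm_num) (by simp) ?_ hf
  intro f h1 h2
  set g : 𝓢(ℝ, ℂ) := h1.toSchwartzMap h2
  have hg : f = g := rfl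
  have : convol K f = SchwartzMap.convolution (ContinuousLinearMap.mul ℂ ℂ) g K := by
    ext x; rw [hg, convol_schwartz]
  rw [this, ← eLpNorm_two_fourier, hg, ← eLpNorm_two_fourier g]
  have hpt : ∀ᵐ ξ : ℝ, ‖𝓕 (SchwartzMap.convolution (ContinuousLinearMap.mul ℂ ℂ) g K) ξ‖₊
      ≤ B * ‖𝓕 g ξ‖₊ := by
    refine Eventually.of_forall fun ξ => ?_
    rw [fourier_convol, ← NNReal.coe_le_coe, NNReal.coe_mul, coe_nnnorm, coe_nnnorm, norm_mul,
      mul_comm]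
    gcongr
    exact hB ξ
  exact eLpNorm_le_nnreal_smul_eLpNorm_of_ae_le_mul hpt 2

end AdaptedLP

end

/-! ### Stopping intervals and kernel cancellation -/

noncomputable section

namespace AdaptedLP

open scoped SchwartzMap

/-- The half-open interval with left end point `I.1` and length `I.2`. -/
def ivl (I : ℝ × ℝ) : Set ℝ := Set.Ioc I.1 (I.1 + I.2)

lemma measurableSet_ivl (I : ℝ × ℝ) : MeasurableSet (ivl I) := measurableSet_Ioc

/-- Calderón-Zygmund stopping intervals, selected by repeated bisection. -/
lemma exists_stopping_intervals_of_le {φ : ℝ → ℝ} (hφ : Continuous φ) (h0 : ∀ x, 0 ≤ φ x)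
    {α δ : ℝ} (hδ : ∀ x y, |x - y| ≤ δ → |φ x - φ y| ≤ α) (m : ℕ) :
    ∀ a l : ℝ, 0 < l → l ≤ 2 ^ m * δ → ∫ y in ivl (a, l), φ y ≤ α * l →
    ∃ S : Finset (ℝ × ℝ), (∀ I ∈ S, 0 < I.2 ∧ ivl I ⊆ ivl (a, l) ∧
        α * I.2 < ∫ y in ivl I, φ y ∧ ∫ y in ivl I, φ y ≤ 2 * α * I.2) ∧
      (S : Set (ℝ × ℝ)).PairwiseDisjoint ivl ∧
      ∀ x ∈ ivl (a, l), (∀ I ∈ S, x ∉ ivl I) → φ x ≤ 2 * α := by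
  have hint : ∀ I : ℝ × ℝ, IntegrableOn φ (ivl I) := fun I =>
    (hφ.integrableOn_Icc).mono_set Set.Ioc_subset_Icc_self
  induction m with
  | zero =>
    intro a l hl hlδ hI
    refine ⟨∅, by simp, by simp, fun x hx _ => ?_⟩
    -- At this scale φ varies by at most α, so a value above 2α would keep φ above α on the whole
    -- interval and contradict the bound on the mean.
    by_contra! hcon
    have hlow : ∀ y ∈ ivl (a, l), φ x - α ≤ φ y := by
      intro y hy
      have h1 : |x - y| ≤ δ := by
        simp only [ivl, Set.mem_Ioc] at hx hy
        simp only [pow_zero, one_mul] at hlδ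
        rw [abs_le]; constructor <;> linarith
      have := (abs_le.1 (hδ x y h1)).2
      linarith
    have h2 : ∫ _y in ivl (a, l), (φ x - α) ≤ ∫ y in ivl (a, l), φ y :=
      setIntegral_mono_on (integrableOn_const (by simp [ivl])) (hint _) (measurableSet_ivl _) hlow
    have h3 : ∫ _y in ivl (a, l), (φ x - α) = l * (φ x - α) := by
      rw [setIntegral_const, smul_eq_mul]
      simp [ivl, Measure.real, hl.le]
    nlinarith
  | succ m ih =>
    intro a l hl hlδ hI
    have hl2 : 0 < l / 2 := by positivity
    have hsub1 : ivl (a, l / 2) ⊆ ivl (a, l) := by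
      intro y; simp only [ivl, Set.mem_Ioc]; rintro ⟨h1, h2⟩; constructor <;> linarith
    have hsub2 : ivl (a + l / 2, l / 2) ⊆ ivl (a, l) := by
      intro y; simp only [ivl, Set.mem_Ioc]; rintro ⟨h1, h2⟩; constructor <;> linarith
    have hdisj : Disjoint (ivl (a, l / 2)) (ivl (a + l / 2, l / 2)) := by
      rw [Set.disjoint_left]; intro y; simp only [ivl, Set.mem_Ioc]
      rintro ⟨h1, h2⟩ ⟨h3, h4⟩; linarith
    have hlδ' : l / 2 ≤ 2 ^ m * δ := by rw [pow_succ] at hlδ; linarith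
    have key : ∀ c : ℝ, ivl (c, l / 2) ⊆ ivl (a, l) →
        ∃ S : Finset (ℝ × ℝ), (∀ I ∈ S, 0 < I.2 ∧ ivl I ⊆ ivl (c, l / 2) ∧
          α * I.2 < ∫ y in ivl I, φ y ∧ ∫ y in ivl I, φ y ≤ 2 * α * I.2) ∧
        (S : Set (ℝ × ℝ)).PairwiseDisjoint ivl ∧
        ∀ x ∈ ivl (c, l / 2), (∀ I ∈ S, x ∉ ivl I) → φ x ≤ 2 * α := by
      intro c hc
      by_cases hcI : ∫ y in ivl (c, l / 2), φ y ≤ α * (l / 2)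
      · exact ih c (l / 2) hl2 hlδ' hcI
      -- A half whose mean exceeds α is selected. The parent has mean at most α and twice the
      -- length, hence the upper bound 2α.
      · push Not at hcI
        refine ⟨{(c, l / 2)}, ?_, by simp, ?_⟩
        · intro I hIm
          rw [Finset.mem_singleton] at hIm
          subst hIm
          refine ⟨hl2, subset_rfl, hcI, ?_⟩
          have : ∫ y in ivl (c, l / 2), φ y ≤ ∫ y in ivl (a, l), φ y :=
            setIntegral_mono_set (hint _) (Eventually.of_forall h0) hc.eventuallyLE
          simp only at this ⊢
          linarith
        · intro x hx hx2
          exact absurd hx (hx2 _ (Finset.mem_singleton_self _))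
    obtain ⟨S₁, h11, h12, h13⟩ := key a hsub1
    obtain ⟨S₂, h21, h22, h23⟩ := key (a + l / 2) hsub2
    classical
    refine ⟨S₁ ∪ S₂, ?_, ?_, ?_⟩
    · intro I hIm
      rcases Finset.mem_union.1 hIm with h | h
      · exact ⟨(h11 I h).1, (h11 I h).2.1.trans hsub1, (h11 I h).2.2⟩
      · exact ⟨(h21 I h).1, (h21 I h).2.1.trans hsub2, (h21 I h).2.2⟩
    · rw [Finset.coe_union, Set.pairwiseDisjoint_union]
      refine ⟨h12, h22, fun I hI1 J hJ _ => ?_⟩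
      exact hdisj.mono (h11 I hI1).2.1 (h21 J hJ).2.1
    · intro x hx hx2
      by_cases hxa : x ≤ a + l / 2
      · refine h13 x ?_ fun I hI1 => hx2 I (Finset.mem_union_left _ hI1)
        simp only [ivl, Set.mem_Ioc] at hx ⊢
        exact ⟨hx.1, hxa⟩
      · refine h23 x ?_ fun I hI1 => hx2 I (Finset.mem_union_right _ hI1)
        simp only [ivl, Set.mem_Ioc] at hx ⊢
        constructor <;> linarith

/-- Uniform continuity stops the bisection after finitely many rounds. The family is therefore
finite, and the bound off it holds at every point without Lebesgue differentiation. -/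
lemma exists_stopping_intervals {φ : ℝ → ℝ} (hφ : Continuous φ) (h0 : ∀ x, 0 ≤ φ x)
    (hc : HasCompactSupport φ) {α : ℝ} (hα : 0 < α) :
    ∃ S : Finset (ℝ × ℝ), (∀ I ∈ S, 0 < I.2 ∧
        α * I.2 < ∫ y in ivl I, φ y ∧ ∫ y in ivl I, φ y ≤ 2 * α * I.2) ∧
      (S : Set (ℝ × ℝ)).PairwiseDisjoint ivl ∧
      ∀ x, (∀ I ∈ S, x ∉ ivl I) → φ x ≤ 2 * α := by
  have huc := hc.uniformContinuous_of_continuous hφ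
  obtain ⟨δ, hδ, hδ'⟩ := Metric.uniformContinuous_iff.1 huc α hα
  have hδ2 : ∀ x y, |x - y| ≤ δ / 2 → |φ x - φ y| ≤ α := by
    intro x y hxy
    have := hδ' (a := x) (b := y) (by rw [Real.dist_eq]; linarith)
    rw [Real.dist_eq] at this
    exact this.le
  obtain ⟨R, hR⟩ := (hc.isCompact.isBounded).subset_closedBall (0 : ℝ)
  have hφi : Integrable φ := hφ.integrable_of_hasCompactSupport hc
  set M := ∫ y, φ y
  have hM : 0 ≤ M := integral_nonneg h0
  -- The first term makes the starting interval contain the support, the second brings its mean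
  -- below α, and the last handles its open left end.
  set R' := max R 0 + M / α + 1
  have hR' : 0 < R' := by positivity
  obtain ⟨m, hm⟩ := pow_unbounded_of_one_lt (2 * R' / (δ / 2)) (one_lt_two (α := ℝ))
  obtain ⟨S, h1, h2, h3⟩ := exists_stopping_intervals_of_le hφ h0 hδ2 m (-R') (2 * R')
    (by positivity) (by rw [div_lt_iff₀ (by positivity)] at hm; exact hm.le) (by
      have e1 : ∫ y in ivl (-R', 2 * R'), φ y ≤ M :=
        setIntegral_le_integral hφi (Eventually.of_forall h0)
      have e2 : M ≤ α * R' := by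
        have : M / α ≤ R' := by
          have := le_max_right R 0
          simp only [R']; linarith
        rw [div_le_iff₀ hα] at this
        linarith
      nlinarith)
  refine ⟨S, fun I hI => ⟨(h1 I hI).1, (h1 I hI).2.2⟩, h2, fun x hx => ?_⟩
  by_cases hxm : x ∈ ivl (-R', 2 * R')
  · exact h3 x hxm hx
  · have : φ x = 0 := by
      by_contra hne
      have hxR := hR (subset_tsupport φ hne)
      rw [mem_closedBall_zero_iff, Real.norm_eq_abs, abs_le] at hxR
      apply hxm
      have e1 := le_max_left R 0
      have e2 : 0 ≤ M / α := by positivity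
      simp only [ivl, Set.mem_Ioc, R']
      constructor <;> linarith
    rw [this]; positivity

lemma lintegral_inv_sq_le {l : ℝ} (hl : 0 < l) :
    ∫⁻ x in {x : ℝ | l < |x|}, ENNReal.ofReal ((x ^ 2)⁻¹) ≤ ENNReal.ofReal (2 / l) := by
  have h1 : ∫⁻ x in Set.Ioi l, ENNReal.ofReal ((x ^ 2)⁻¹) = ENNReal.ofReal (1 / l) := by
    have e1 : ∀ x ∈ Set.Ioi l, (x ^ 2)⁻¹ = x ^ (-2 : ℝ) := by
      intro x hx
      have hx0 : 0 < x := hl.trans hx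
      rw [Real.rpow_neg hx0.le, Real.rpow_two]
    rw [setLIntegral_congr_fun measurableSet_Ioi (fun x hx => by rw [e1 x hx]),
      ← ofReal_integral_eq_lintegral_ofReal (integrableOn_Ioi_rpow_of_lt (by norm_num) hl)
      ((ae_restrict_iff' measurableSet_Ioi).2 (Eventually.of_forall fun x hx =>
        Real.rpow_nonneg (hl.trans hx).le _)), integral_Ioi_rpow_of_lt (by norm_num) hl]
    congr 1
    norm_num [Real.rpow_neg_one]
  have h2 : ∫⁻ x in Set.Iio (-l), ENNReal.ofReal ((x ^ 2)⁻¹) = ENNReal.ofReal (1 / l) := by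
    rw [← h1, ← (Measure.measurePreserving_neg (volume : Measure ℝ)).setLIntegral_comp_preimage_emb
      (Homeomorph.neg ℝ).measurableEmbedding]
    simp
  have hset : {x : ℝ | l < |x|} = Set.Ioi l ∪ Set.Iio (-l) := by
    ext x
    simp only [Set.mem_ofPred_eq, Set.mem_union, Set.mem_Ioi, Set.mem_Iio, lt_abs]
    constructor <;> (rintro (h | h) <;> [left; right] <;> linarith)
  rw [hset]
  refine (lintegral_union_le _ _ _).trans ?_
  rw [h1, h2, ← ENNReal.ofReal_add (by positivity) (by positivity)]
  apply le_of_eq; congr 1; ring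

/-- Smoothness estimate for the kernel, away from the singularity. -/
lemma norm_kernel_sub_le (K : 𝓢(ℝ, ℂ)) {D : ℝ} (hD : ∀ x, x ^ 2 * ‖deriv K x‖ ≤ D)
    {x y c l : ℝ} (hl : 0 < l) (hy : |y - c| ≤ l / 2) (hx : l < |x - c|) :
    ‖K (x - y) - K (x - c)‖ ≤ 2 * D * l * ((x - c) ^ 2)⁻¹ := by
  have hxc : 0 < |x - c| := hl.trans hx
  have hsq : 0 < (x - c) ^ 2 := by rw [← sq_abs]; positivity
  have hD0 : 0 ≤ D := le_trans (by positivity) (hD 0)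
  -- Points of this ball have modulus at least |x - c| / 2; squaring gives the factor 4.
  have hb : ∀ z ∈ Metric.closedBall (x - c) (l / 2), ‖deriv K z‖ ≤ 4 * D * ((x - c) ^ 2)⁻¹ := by
    intro z hz
    rw [Metric.mem_closedBall, Real.dist_eq] at hz
    have h1 : |x - c| / 2 ≤ |z| := by
      have := abs_sub_abs_le_abs_sub (x - c) z
      rw [abs_sub_comm] at hz
      linarith
    have h2 : (x - c) ^ 2 ≤ 4 * z ^ 2 := by
      rw [← sq_abs (x - c), ← sq_abs z]; nlinarith [abs_nonneg z]
    rw [← div_eq_mul_inv, le_div_iff₀ hsq]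
    have := hD z
    nlinarith [norm_nonneg (deriv K z)]
  have := (convex_closedBall (x - c) (l / 2)).norm_image_sub_le_of_norm_deriv_le
    (f := K) (x := x - c) (y := x - y) (fun z _ => K.differentiableAt) hb
    (Metric.mem_closedBall_self (by positivity)) (by
      rw [Metric.mem_closedBall, Real.dist_eq]
      rwa [show x - y - (x - c) = -(y - c) by ring, abs_neg])
  refine this.trans ?_
  rw [show x - y - (x - c) = -(y - c) by ring, norm_neg, Real.norm_eq_abs]
  have h3 : 0 ≤ 4 * D * ((x - c) ^ 2)⁻¹ := by positivity
  calc 4 * D * ((x - c) ^ 2)⁻¹ * |y - c| ≤ 4 * D * ((x - c) ^ 2)⁻¹ * (l / 2) := by gcongr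
    _ = _ := by ring

/-- Cancellation: the convolution with an atom is integrable away from it. -/
lemma lintegral_convol_atom_le (K : 𝓢(ℝ, ℂ)) {D : ℝ} (hD : ∀ x, x ^ 2 * ‖deriv K x‖ ≤ D)
    {c l : ℝ} (hl : 0 < l) {b : ℝ → ℂ} (hb : Integrable b) (hb0 : ∫ y, b y = 0)
    (hsupp : ∀ y, b y ≠ 0 → |y - c| ≤ l / 2) :
    ∫⁻ x in {x | l < |x - c|}, ‖convol K b x‖ₑ ≤ ENNReal.ofReal (4 * D) * ∫⁻ y, ‖b y‖ₑ := by
  have hD0 : 0 ≤ D := le_trans (by positivity) (hD 0)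
  have hms : MeasurableSet {x : ℝ | l < |x - c|} := by measurability
  have hpt : ∀ x ∈ {x | l < |x - c|}, ‖convol K b x‖ₑ ≤
      ENNReal.ofReal (2 * D * l) * ENNReal.ofReal (((x - c) ^ 2)⁻¹) * ∫⁻ y, ‖b y‖ₑ := by
    intro x hx
    -- The mean of `b` vanishes, so the kernel value at the centre may be subtracted for free.
    have e : convol K b x = ∫ y, b y * (K (x - y) - K (x - c)) := by
      simp only [mul_sub]
      rw [integral_sub (integrable_mul_comp_sub K le_rfl (memLp_one_iff_integrable.2 hb) x)
        (hb.mul_const _), integral_mul_const, hb0, zero_mul, sub_zero]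
      rfl
    rw [e]
    refine (enorm_integral_le_lintegral_enorm _).trans ?_
    rw [← lintegral_const_mul'' _ hb.1.enorm]
    refine lintegral_mono fun y => ?_
    rw [enorm_mul, mul_comm]
    by_cases hby : b y = 0
    · simp [hby]
    gcongr
    rw [← ENNReal.ofReal_mul (by positivity), ← ofReal_norm]
    exact ENNReal.ofReal_le_ofReal (norm_kernel_sub_le K hD hl (hsupp y hby) hx)
  refine (setLIntegral_mono' hms hpt).trans ?_
  have hmeas : Measurable fun x : ℝ => ENNReal.ofReal (((x - c) ^ 2)⁻¹) := by fun_prop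
  rw [lintegral_mul_const _ (hmeas.const_mul _), lintegral_const_mul _ hmeas]
  gcongr
  have htr : ∫⁻ x in {x | l < |x - c|}, ENNReal.ofReal (((x - c) ^ 2)⁻¹) =
      ∫⁻ x in {x | l < |x|}, ENNReal.ofReal ((x ^ 2)⁻¹) := by
    exact (measurePreserving_sub_right (volume : Measure ℝ) c).setLIntegral_comp_preimage_emb
      (MeasurableEquiv.subRight c).measurableEmbedding
      (fun x => ENNReal.ofReal ((x ^ 2)⁻¹)) {x | l < |x|}
  rw [htr]
  calc ENNReal.ofReal (2 * D * l) * _ ≤ ENNReal.ofReal (2 * D * l) * ENNReal.ofReal (2 / l) := by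
        gcongr; exact lintegral_inv_sq_le hl
    _ = ENNReal.ofReal (4 * D) := by
        rw [← ENNReal.ofReal_mul (by positivity)]; congr 1; field_simp; ring

end AdaptedLP

end

/-! ### Calderón-Zygmund decomposition and the distributional estimate -/

noncomputable section

namespace AdaptedLP

open scoped SchwartzMap

lemma lintegral_enorm_sq_eq {f : ℝ → ℂ} : ∫⁻ x, ‖f x‖ₑ ^ 2 = eLpNorm f 2 ^ 2 := by
  have := eLpNorm_nnreal_pow_eq_lintegral (f := f) (μ := (volume : Measure ℝ)) (p := 2) two_ne_zero
  simp only [NNReal.coe_ofNat, ENNReal.rpow_ofNat, ENNReal.coe_ofNat] at this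
  exact this.symm

lemma lintegral_enorm_sq_convol_le (K : 𝓢(ℝ, ℂ)) {B : ℝ≥0} (hB : ∀ ξ, ‖𝓕 K ξ‖ ≤ B) {f : ℝ → ℂ}
    (hf : MemLp f 2) : ∫⁻ x, ‖convol K f x‖ₑ ^ 2 ≤ (B : ℝ≥0∞) ^ 2 * ∫⁻ x, ‖f x‖ₑ ^ 2 := by
  rw [lintegral_enorm_sq_eq, lintegral_enorm_sq_eq, ← mul_pow]
  exact pow_le_pow_left' (eLpNorm_two_convol_le K hB hf) 2

lemma ENNReal.le_two_mul_of_le_add_half {X Y : ℝ≥0∞} (hX : X ≠ ⊤) (h : X ≤ Y + X / 2) :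
    X ≤ 2 * Y := by
  have h1 : X / 2 + X / 2 ≤ Y + X / 2 := by rwa [ENNReal.add_halves]
  have h2 : X / 2 ≤ Y := (ENNReal.add_le_add_iff_right (ENNReal.div_ne_top hX (by simp))).1 h1
  calc X = X / 2 + X / 2 := (ENNReal.add_halves X).symm
    _ ≤ Y + Y := by gcongr
    _ = 2 * Y := (two_mul Y).symm

/-- The distributional estimate behind the `L^p` theory of Calderón-Zygmund operators. -/
lemma measure_lt_norm_convol_le (K : 𝓢(ℝ, ℂ)) {B D : ℝ≥0} (hB : ∀ ξ, ‖𝓕 K ξ‖ ≤ B)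
    (hD : ∀ x, x ^ 2 * ‖deriv K x‖ ≤ D) {f : ℝ → ℂ} (hf : Continuous f)
    (hc : HasCompactSupport f) {α : ℝ} (hα : 0 < α) :
    volume {x | α < ‖convol K f x‖} ≤ ((16 * B ^ 2 + 32 * D + 4 : ℝ≥0) : ℝ≥0∞) *
      ((ENNReal.ofReal α)⁻¹ ^ 2 * (∫⁻ x in {x | ‖f x‖ ≤ 2 * α}, ‖f x‖ₑ ^ 2) +
        (ENNReal.ofReal α)⁻¹ * ∫⁻ x in {x | α / 2 < ‖f x‖}, ‖f x‖ₑ) := by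
  obtain ⟨S, hS, hdisj, hoff⟩ := exists_stopping_intervals (φ := fun x => ‖f x‖) hf.norm
    (fun x => norm_nonneg _) hc.norm hα
  set G := ∫⁻ x in {x | ‖f x‖ ≤ 2 * α}, ‖f x‖ₑ ^ 2
  set H := ∫⁻ x in {x | α / 2 < ‖f x‖}, ‖f x‖ₑ
  set a := ENNReal.ofReal α with ha
  have ha0 : a ≠ 0 := by simpa [ha] using hα
  have hat : a ≠ ⊤ := ENNReal.ofReal_ne_top
  have hfi : Integrable f := hf.integrable_of_hasCompactSupport hc
  have hf2 : MemLp f 2 := hf.memLp_of_hasCompactSupport hc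
  have hE : MeasurableSet {x | α / 2 < ‖f x‖} := measurableSet_lt measurable_const hf.norm.measurable
  set F : ℝ × ℝ → ℝ≥0∞ := fun I => ∫⁻ x in ivl I, ‖f x‖ₑ with hF
  have hFe : ∀ I, F I = ENNReal.ofReal (∫ x in ivl I, ‖f x‖) := fun I =>
    (ofReal_integral_norm_eq_lintegral_enorm hfi.integrableOn).symm
  have hFt : ∀ I, F I ≠ ⊤ := fun I => by rw [hFe]; exact ENNReal.ofReal_ne_top
  have hvol : ∀ I, volume (ivl I) = ENNReal.ofReal I.2 := fun I => by simp [ivl]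
  have hF1 : ∀ I ∈ S, a * ENNReal.ofReal I.2 ≤ F I := fun I hI => by
    rw [hFe, ha, ← ENNReal.ofReal_mul hα.le]
    exact ENNReal.ofReal_le_ofReal (hS I hI).2.1.le
  have hF2 : ∀ I ∈ S, F I ≤ 2 * a * ENNReal.ofReal I.2 := fun I hI => by
    rw [hFe, ha, show (2 : ℝ≥0∞) = ENNReal.ofReal 2 by simp, ← ENNReal.ofReal_mul (by norm_num),
      ← ENNReal.ofReal_mul (by positivity)]
    exact ENNReal.ofReal_le_ofReal (hS I hI).2.2
  -- On a selected interval the values below α / 2 carry at most half of the mass and are absorbed.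
  -- The mass is thus controlled by large values of `f` alone, which is what makes the estimate
  -- integrable in α.
  have hsumF : ∑ I ∈ S, F I ≤ 2 * H := by
    have h1 : ∀ I ∈ S, F I ≤ 2 * ∫⁻ x in ivl I ∩ {x | α / 2 < ‖f x‖}, ‖f x‖ₑ := by
      intro I hI
      refine ENNReal.le_two_mul_of_le_add_half (hFt I) ?_
      have hsplit := lintegral_inter_add_sdiff (μ := volume) (fun x => ‖f x‖ₑ) (ivl I) hE
      have h2 : ∫⁻ x in ivl I \ {x | α / 2 < ‖f x‖}, ‖f x‖ₑ ≤ F I / 2 := by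
        calc ∫⁻ x in ivl I \ {x | α / 2 < ‖f x‖}, ‖f x‖ₑ
            ≤ ∫⁻ x in ivl I \ {x | α / 2 < ‖f x‖}, a / 2 := by
              refine setLIntegral_mono' ((measurableSet_ivl I).diff hE) fun x hx => ?_
              have hx2 : ‖f x‖ ≤ α / 2 := not_lt.1 hx.2
              rw [← ofReal_norm, ha, show (2 : ℝ≥0∞) = ENNReal.ofReal 2 by simp,
                ← ENNReal.ofReal_div_of_pos (by norm_num)]
              exact ENNReal.ofReal_le_ofReal hx2
          _ ≤ ∫⁻ x in ivl I, a / 2 := lintegral_mono_set Set.sdiff_subset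
          _ = a * ENNReal.ofReal I.2 / 2 := by
              rw [setLIntegral_const, hvol, div_eq_mul_inv, div_eq_mul_inv]; ring
          _ ≤ F I / 2 := by gcongr; exact hF1 I hI
      calc F I = _ := hsplit.symm
        _ ≤ _ := by gcongr
    calc ∑ I ∈ S, F I ≤ ∑ I ∈ S, 2 * ∫⁻ x in ivl I ∩ {x | α / 2 < ‖f x‖}, ‖f x‖ₑ :=
          Finset.sum_le_sum h1
      _ = 2 * ∫⁻ x in ⋃ I ∈ S, (ivl I ∩ {x | α / 2 < ‖f x‖}), ‖f x‖ₑ := by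
          rw [← Finset.mul_sum, lintegral_biUnion_finset
            (fun I hI J hJ hIJ => (hdisj hI hJ hIJ).mono Set.inter_subset_left
              Set.inter_subset_left) (fun I _ => (measurableSet_ivl I).inter hE)]
      _ ≤ 2 * H := by
          gcongr
          exact lintegral_mono_set (Set.iUnion₂_subset fun I _ => Set.inter_subset_right)
  set avg : ℝ × ℝ → ℂ := fun I => (I.2 : ℂ)⁻¹ * ∫ x in ivl I, f x with havg
  have havg1 : ∀ I ∈ S, ‖avg I‖ₑ * ENNReal.ofReal I.2 ≤ F I := by
    intro I hI
    have hl := (hS I hI).1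
    rw [hFe, ← ofReal_norm, ← ENNReal.ofReal_mul (norm_nonneg _)]
    refine ENNReal.ofReal_le_ofReal ?_
    rw [havg, norm_mul, norm_inv, Complex.norm_real, Real.norm_of_nonneg hl.le]
    calc _ = ‖∫ x in ivl I, f x‖ := by field_simp
      _ ≤ _ := norm_integral_le_integral_norm _
  have havg2 : ∀ I ∈ S, ‖avg I‖ₑ ≤ 2 * a := by
    intro I hI
    have hl : ENNReal.ofReal I.2 ≠ 0 := by simpa using (hS I hI).1
    exact (ENNReal.mul_le_mul_iff_left hl ENNReal.ofReal_ne_top).1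
      ((havg1 I hI).trans (hF2 I hI))
  set b : ℝ × ℝ → ℝ → ℂ := fun I => (ivl I).indicator (fun y => f y - avg I) with hb
  have hbmem : ∀ I (q : ℝ≥0∞), MemLp (b I) q := fun I q => by
    have e : b I = (ivl I).indicator f - (ivl I).indicator (fun _ => avg I) :=
      Set.indicator_sub' _ _ _
    rw [e]
    exact ((hf.memLp_of_hasCompactSupport hc).indicator (measurableSet_ivl I)).sub
      (memLp_indicator_const _ (measurableSet_ivl I) _ (Or.inr (by rw [hvol]; simp)))
  have hbi : ∀ I, Integrable (b I) := fun I => memLp_one_iff_integrable.1 (hbmem I 1)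
  have hb0 : ∀ I ∈ S, ∫ y, b I y = 0 := by
    intro I hI
    have hl := (hS I hI).1
    rw [integral_indicator (measurableSet_ivl I), integral_sub hfi.integrableOn
      (integrableOn_const (by rw [hvol]; simp)), setIntegral_const, Measure.real, hvol,
      ENNReal.toReal_ofReal hl.le, havg, Complex.real_smul]
    have : (I.2 : ℂ) ≠ 0 := by exact_mod_cast hl.ne'
    field_simp
    ring
  have hb1 : ∀ I ∈ S, ∫⁻ y, ‖b I y‖ₑ ≤ 2 * F I := by
    intro I hI
    calc ∫⁻ y, ‖b I y‖ₑ = ∫⁻ y in ivl I, ‖f y - avg I‖ₑ := by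
          simp only [hb, enorm_indicator_eq_indicator_enorm]
          exact lintegral_indicator (measurableSet_ivl I) _
      _ ≤ ∫⁻ y in ivl I, (‖f y‖ₑ + ‖avg I‖ₑ) := lintegral_mono fun y => enorm_sub_le
      _ = F I + ‖avg I‖ₑ * ENNReal.ofReal I.2 := by
          rw [lintegral_add_right _ measurable_const, setLIntegral_const, hvol]
      _ ≤ F I + F I := by gcongr; exact havg1 I hI
      _ = 2 * F I := (two_mul _).symm
  set g : ℝ → ℂ := fun x => f x - ∑ I ∈ S, b I x with hg
  have hsb : MemLp (fun x => ∑ I ∈ S, b I x) 2 := memLp_finsetSum S fun I _ => hbmem I 2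
  have hgm : MemLp g 2 := hf2.sub hsb
  have hgI : ∀ I ∈ S, ∀ x ∈ ivl I, g x = avg I := by
    intro I hI x hx
    have : ∑ J ∈ S, b J x = b I x := by
      refine Finset.sum_eq_single_of_mem I hI fun J hJ hJI => ?_
      exact Set.indicator_of_notMem (fun hxJ => Set.disjoint_left.1 (hdisj hJ hI hJI) hxJ hx) _
    change f x - ∑ J ∈ S, b J x = avg I
    rw [this]
    simp only [hb, Set.indicator_of_mem hx, sub_sub_cancel]
  have hgoff : ∀ x, (∀ I ∈ S, x ∉ ivl I) → g x = f x := by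
    intro x hx
    have : ∑ J ∈ S, b J x = 0 :=
      Finset.sum_eq_zero fun J hJ => Set.indicator_of_notMem (hx J hJ) _
    simp only [hg, this, sub_zero]
  set Ω : Set ℝ := ⋃ I ∈ S, ivl I with hΩ
  have hΩm : MeasurableSet Ω := Finset.measurableSet_biUnion S fun I _ => measurableSet_ivl I
  -- The good part is `f` off the intervals, where |f| ≤ 2α, and the mean of `f` on each interval,
  -- of size at most 2α.
  have hg2 : ∫⁻ x, ‖g x‖ₑ ^ 2 ≤ G + 2 * a * ∑ I ∈ S, F I := by
    rw [← lintegral_add_compl _ hΩm, add_comm]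
    gcongr
    · calc ∫⁻ x in Ωᶜ, ‖g x‖ₑ ^ 2 = ∫⁻ x in Ωᶜ, ‖f x‖ₑ ^ 2 := by
            refine setLIntegral_congr_fun hΩm.compl fun x hx => ?_
            rw [hgoff x fun I hI hxI => hx (Set.mem_biUnion hI hxI)]
        _ ≤ G := lintegral_mono_set fun x hx =>
            hoff x fun I hI hxI => hx (Set.mem_biUnion hI hxI)
    · rw [hΩ, lintegral_biUnion_finset hdisj (fun I _ => measurableSet_ivl I), Finset.mul_sum]
      refine Finset.sum_le_sum fun I hI => ?_
      calc ∫⁻ x in ivl I, ‖g x‖ₑ ^ 2 = ∫⁻ x in ivl I, ‖avg I‖ₑ ^ 2 :=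
            setLIntegral_congr_fun (measurableSet_ivl I) fun x hx => by
              rw [hgI I hI x hx]
        _ = ‖avg I‖ₑ * (‖avg I‖ₑ * ENNReal.ofReal I.2) := by
            rw [setLIntegral_const, hvol]; ring
        _ ≤ 2 * a * F I := mul_le_mul' (havg2 I hI) (havg1 I hI)
  have hT : ∀ x, convol K f x = convol K g x + ∑ I ∈ S, convol K (b I) x := by
    intro x
    simp only [convol]
    rw [← integral_finsetSum _ fun I _ => integrable_mul_comp_sub K le_rfl (hbmem I 1) x,
      ← integral_add (integrable_mul_comp_sub K (by norm_num) hgm x)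
        (integrable_finsetSum _ fun I _ => integrable_mul_comp_sub K le_rfl (hbmem I 1) x)]
    refine integral_congr_ae (Eventually.of_forall fun y => ?_)
    simp only [hg, ← Finset.sum_mul, ← add_mul, sub_add_cancel]
  set ctr : ℝ × ℝ → ℝ := fun I => I.1 + I.2 / 2
  -- Each interval is doubled about its centre; outside, `lintegral_convol_atom_le` applies.
  set Es : Set ℝ := ⋃ I ∈ S, Metric.closedBall (ctr I) I.2 with hEs
  have hEsm : MeasurableSet Es := Finset.measurableSet_biUnion S fun I _ => measurableSet_closedBall
  have hEsv : volume Es ≤ 2 * a⁻¹ * ∑ I ∈ S, F I := by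
    refine (measure_biUnion_finset_le S _).trans ?_
    rw [Finset.mul_sum]
    refine Finset.sum_le_sum fun I hI => ?_
    rw [Real.volume_closedBall, ENNReal.ofReal_mul (by norm_num)]
    calc ENNReal.ofReal 2 * ENNReal.ofReal I.2
        = 2 * a⁻¹ * (a * ENNReal.ofReal I.2) := by
          rw [mul_assoc, ← mul_assoc a⁻¹, ENNReal.inv_mul_cancel ha0 hat]; simp
      _ ≤ _ := by gcongr; exact hF1 I hI
  have hTm : ∀ {φ : ℝ → ℂ}, AEStronglyMeasurable φ → AEMeasurable (fun x => ‖convol K φ x‖ₑ) :=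
    fun h => (aestronglyMeasurable_convol K.continuous h).enorm
  have hgood : volume {x | a / 2 ≤ ‖convol K g x‖ₑ} ≤
      4 * a⁻¹ ^ 2 * (B ^ 2 * (G + 2 * a * ∑ I ∈ S, F I)) := by
    have h1 : (a / 2) ^ 2 * volume {x | (a / 2) ^ 2 ≤ ‖convol K g x‖ₑ ^ 2} ≤
        B ^ 2 * (G + 2 * a * ∑ I ∈ S, F I) :=
      (mul_meas_ge_le_lintegral₀ ((hTm hgm.1).pow_const 2) _).trans
        ((lintegral_enorm_sq_convol_le K hB hgm).trans (by gcongr))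
    have h2 : {x | a / 2 ≤ ‖convol K g x‖ₑ} ⊆ {x | (a / 2) ^ 2 ≤ ‖convol K g x‖ₑ ^ 2} :=
      fun x hx => pow_le_pow_left' (show a / 2 ≤ ‖convol K g x‖ₑ from hx) 2
    refine (measure_mono h2).trans ?_
    have h3 : 4 * a⁻¹ ^ 2 * (a / 2) ^ 2 = 1 := by
      have : (a / 2) ^ 2 = a ^ 2 / 4 := by
        rw [div_eq_mul_inv, mul_pow, div_eq_mul_inv, ← ENNReal.inv_pow]; norm_num
      rw [this, mul_assoc, div_eq_mul_inv, ← mul_assoc (a⁻¹ ^ 2), ← mul_pow,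
        ENNReal.inv_mul_cancel ha0 hat, one_pow, one_mul,
        ENNReal.mul_inv_cancel (by norm_num) (by norm_num)]
    calc _ = 4 * a⁻¹ ^ 2 * ((a / 2) ^ 2 * volume {x | (a / 2) ^ 2 ≤ ‖convol K g x‖ₑ ^ 2}) := by
          rw [← mul_assoc, h3, one_mul]
      _ ≤ _ := by gcongr
  have hbad : volume ({x | a / 2 ≤ ∑ I ∈ S, ‖convol K (b I) x‖ₑ} ∩ Esᶜ) ≤
      16 * D * a⁻¹ * ∑ I ∈ S, F I := by
    have h1 : a / 2 * (volume.restrict Esᶜ) {x | a / 2 ≤ ∑ I ∈ S, ‖convol K (b I) x‖ₑ} ≤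
        8 * D * ∑ I ∈ S, F I := by
      refine (mul_meas_ge_le_lintegral₀ (Finset.aemeasurable_fun_sum S fun I _ =>
        (hTm (hbmem I 1).1).restrict) _).trans ?_
      rw [lintegral_finsetSum' _ fun I _ => (hTm (hbmem I 1).1).restrict, Finset.mul_sum]
      refine Finset.sum_le_sum fun I hI => ?_
      have hl := (hS I hI).1
      calc ∫⁻ x in Esᶜ, ‖convol K (b I) x‖ₑ
          ≤ ∫⁻ x in {x | I.2 < |x - ctr I|}, ‖convol K (b I) x‖ₑ := by
            refine lintegral_mono_set fun x hx => ?_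
            by_contra hcon
            refine hx (Set.mem_biUnion hI ?_)
            rw [Metric.mem_closedBall, Real.dist_eq]
            exact not_lt.1 hcon
        _ ≤ ENNReal.ofReal (4 * D) * ∫⁻ y, ‖b I y‖ₑ := by
            refine lintegral_convol_atom_le K hD hl (hbi I) (hb0 I hI) fun y hy => ?_
            have hy' : y ∈ ivl I := by
              by_contra h
              exact hy (Set.indicator_of_notMem h _)
            simp only [ivl, Set.mem_Ioc] at hy'
            simp only [ctr, abs_le]
            constructor <;> linarith
        _ ≤ ENNReal.ofReal (4 * D) * (2 * F I) := by gcongr; exact hb1 I hI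
        _ = 8 * D * F I := by
            rw [ENNReal.ofReal_mul (by norm_num), ENNReal.ofReal_coe_nnreal,
              ENNReal.ofReal_ofNat]; ring
    rw [Measure.restrict_apply' hEsm.compl] at h1
    have h3 : 2 * a⁻¹ * (a / 2) = 1 := by
      rw [div_eq_mul_inv, mul_assoc, ← mul_assoc a⁻¹, ENNReal.inv_mul_cancel ha0 hat, one_mul,
        ENNReal.mul_inv_cancel (by norm_num) (by norm_num)]
    calc _ = 2 * a⁻¹ * (a / 2 * volume ({x | a / 2 ≤ ∑ I ∈ S, ‖convol K (b I) x‖ₑ} ∩ Esᶜ)) := by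
          rw [← mul_assoc, h3, one_mul]
      _ ≤ 2 * a⁻¹ * (8 * D * ∑ I ∈ S, F I) := by gcongr
      _ = _ := by ring
  have hcover : {x | α < ‖convol K f x‖} ⊆ {x | a / 2 ≤ ‖convol K g x‖ₑ} ∪
      (Es ∪ ({x | a / 2 ≤ ∑ I ∈ S, ‖convol K (b I) x‖ₑ} ∩ Esᶜ)) := by
    intro x hx
    by_contra hcon
    simp only [Set.mem_union, Set.mem_inter_iff, Set.mem_ofPred_eq, Set.mem_compl_iff, not_or,
      not_and, not_not, not_le] at hcon
    obtain ⟨h1, h2, h3⟩ := hcon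
    have h4 : ∑ I ∈ S, ‖convol K (b I) x‖ₑ < a / 2 := by
      by_contra h
      exact h2 (h3 (not_lt.1 h))
    have h5 : ‖convol K f x‖ₑ < a := by
      rw [hT]
      calc _ ≤ ‖convol K g x‖ₑ + ∑ I ∈ S, ‖convol K (b I) x‖ₑ :=
            (enorm_add_le _ _).trans (by gcongr; exact enorm_sum_le _ _)
        _ < a / 2 + a / 2 := ENNReal.add_lt_add h1 h4
        _ = a := ENNReal.add_halves a
    rw [← ofReal_norm, ha, ENNReal.ofReal_lt_ofReal_iff hα] at h5
    exact lt_asymm hx h5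
  -- The mass of the intervals enters with 8B² from the good part, 2 from the doubled intervals and
  -- 16D from the atoms; `hsumF` doubles all three.
  calc volume {x | α < ‖convol K f x‖}
      ≤ 4 * a⁻¹ ^ 2 * (B ^ 2 * (G + 2 * a * ∑ I ∈ S, F I)) + (2 * a⁻¹ * ∑ I ∈ S, F I +
          16 * D * a⁻¹ * ∑ I ∈ S, F I) :=
        (measure_mono hcover).trans ((measure_union_le _ _).trans
          (add_le_add hgood ((measure_union_le _ _).trans (add_le_add hEsv hbad))))
    _ = 4 * B ^ 2 * (a⁻¹ ^ 2 * G) + (8 * B ^ 2 * (a⁻¹ * a) + 2 + 16 * D) *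
          (a⁻¹ * ∑ I ∈ S, F I) := by ring
    _ ≤ 16 * B ^ 2 * (a⁻¹ ^ 2 * G) + (8 * B ^ 2 * 1 + 2 + 16 * D) * (a⁻¹ * (2 * H)) := by
        rw [ENNReal.inv_mul_cancel ha0 hat]
        gcongr
        norm_num
    _ = 16 * B ^ 2 * (a⁻¹ ^ 2 * G) + (16 * B ^ 2 + 32 * D + 4) * (a⁻¹ * H) := by ring
    _ ≤ (16 * B ^ 2 + 32 * D + 4) * (a⁻¹ ^ 2 * G) + (16 * B ^ 2 + 32 * D + 4) * (a⁻¹ * H) := by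
        gcongr
        rw [add_assoc]
        exact le_self_add
    _ = _ := by push_cast; ring

end AdaptedLP

end

/-! ### Integration over levels for 1 < p < 2, and the converse of Hölder's inequality -/

noncomputable section

namespace AdaptedLP

open scoped SchwartzMap

/-- By Tonelli, a fixed x contributes |f x|² times the integral of t^(p-3) over t ≥ |f x| / 2, which
converges at infinity because p < 2. -/
lemma lintegral_layer_low {f : ℝ → ℂ} (hf : Continuous f) {p : ℝ} (hp2 : p < 2) :
    ∫⁻ t in Set.Ioi (0 : ℝ), (ENNReal.ofReal t)⁻¹ ^ 2 *
        (∫⁻ x in {x | ‖f x‖ ≤ 2 * t}, ‖f x‖ₑ ^ 2) * ENNReal.ofReal (t ^ (p - 1)) ≤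
      ENNReal.ofReal (2 ^ (2 - p) / (2 - p)) * ∫⁻ x, ‖f x‖ₑ ^ p := by
  set Φ : ℝ → ℝ → ℝ≥0∞ := fun t x =>
    {z : ℝ × ℝ | ‖f z.2‖ ≤ 2 * z.1}.indicator (fun z => ‖f z.2‖ₑ ^ 2 *
      ENNReal.ofReal (z.1 ^ (p - 3))) (t, x) with hΦ
  have hset : MeasurableSet {z : ℝ × ℝ | ‖f z.2‖ ≤ 2 * z.1} :=
    measurableSet_le (hf.measurable.comp measurable_snd).norm (measurable_fst.const_mul 2)
  have hΦm : Measurable (Function.uncurry Φ) :=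
    (((hf.measurable.comp measurable_snd).enorm.pow_const 2).mul
      (measurable_fst.pow_const (p - 3)).ennreal_ofReal).indicator hset
  have h1 : ∀ t ∈ Set.Ioi (0 : ℝ), (ENNReal.ofReal t)⁻¹ ^ 2 *
      (∫⁻ x in {x | ‖f x‖ ≤ 2 * t}, ‖f x‖ₑ ^ 2) * ENNReal.ofReal (t ^ (p - 1)) =
      ∫⁻ x, Φ t x := by
    intro t ht
    have ht0 : 0 < t := ht
    have e1 : ∀ x, Φ t x = {x | ‖f x‖ ≤ 2 * t}.indicator (fun x => ‖f x‖ₑ ^ 2 *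
        ENNReal.ofReal (t ^ (p - 3))) x := fun x => rfl
    simp only [e1]
    rw [lintegral_indicator (measurableSet_le hf.norm.measurable measurable_const),
      lintegral_mul_const _ (hf.measurable.enorm.pow_const 2), mul_comm ((ENNReal.ofReal t)⁻¹ ^ 2),
      mul_assoc]
    congr 1
    rw [← ENNReal.ofReal_inv_of_pos ht0, ← ENNReal.ofReal_pow (by positivity),
      ← ENNReal.ofReal_mul (by positivity)]
    congr 1
    rw [show p - 1 = p - 3 + 2 by ring, Real.rpow_add ht0, Real.rpow_two]
    field_simp
  rw [setLIntegral_congr_fun measurableSet_Ioi h1, lintegral_lintegral_swap hΦm.aemeasurable,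
    ← lintegral_const_mul' _ _ ENNReal.ofReal_ne_top]
  refine lintegral_mono fun x => ?_
  by_cases hx : f x = 0
  · have : ∀ t, Φ t x = 0 := fun t => by
      simp only [hΦ]
      by_cases h : (t, x) ∈ {z : ℝ × ℝ | ‖f z.2‖ ≤ 2 * z.1}
      · rw [Set.indicator_of_mem h]; simp [hx]
      · rw [Set.indicator_of_notMem h]
    simp [this]
  have hc : 0 < ‖f x‖ / 2 := by positivity
  have e2 : ∀ t, Φ t x ≤ (Set.Ici (‖f x‖ / 2)).indicator (fun t => ‖f x‖ₑ ^ 2 *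
      ENNReal.ofReal (t ^ (p - 3))) t := by
    intro t
    simp only [hΦ]
    by_cases h : (t, x) ∈ {z : ℝ × ℝ | ‖f z.2‖ ≤ 2 * z.1}
    · rw [Set.indicator_of_mem h, Set.indicator_of_mem]
      have : ‖f x‖ ≤ 2 * t := h
      rw [Set.mem_Ici]; linarith
    · rw [Set.indicator_of_notMem h]; simp
  calc ∫⁻ t in Set.Ioi 0, Φ t x
      ≤ ∫⁻ t, (Set.Ici (‖f x‖ / 2)).indicator (fun t => ‖f x‖ₑ ^ 2 *
          ENNReal.ofReal (t ^ (p - 3))) t :=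
        (setLIntegral_le_lintegral _ _).trans (lintegral_mono e2)
    _ = ‖f x‖ₑ ^ 2 * ∫⁻ t in Set.Ioi (‖f x‖ / 2), ENNReal.ofReal (t ^ (p - 3)) := by
        rw [lintegral_indicator measurableSet_Ici, setLIntegral_congr Ioi_ae_eq_Ici.symm,
          lintegral_const_mul' _ _ (by simp)]
    _ = ‖f x‖ₑ ^ 2 * ENNReal.ofReal (-(‖f x‖ / 2) ^ (p - 3 + 1) / (p - 3 + 1)) := by
        rw [← integral_Ioi_rpow_of_lt (by linarith) hc, ofReal_integral_eq_lintegral_ofReal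
          (integrableOn_Ioi_rpow_of_lt (by linarith) hc)
          ((ae_restrict_iff' measurableSet_Ioi).2 (Eventually.of_forall fun t ht =>
          Real.rpow_nonneg (hc.trans ht).le _))]
    _ = ENNReal.ofReal (2 ^ (2 - p) / (2 - p)) * ‖f x‖ₑ ^ p := by
        rw [← ofReal_norm, ENNReal.ofReal_rpow_of_pos (by positivity),
          ← ENNReal.ofReal_pow (by positivity), ← ENNReal.ofReal_mul (by positivity),
          ← ENNReal.ofReal_mul (by have : 0 < 2 - p := by linarith
                                   positivity)]
        congr 1
        have hf0 : 0 < ‖f x‖ := by positivity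
        rw [Real.div_rpow hf0.le (by norm_num), show p - 3 + 1 = p - 2 by ring,
          Real.rpow_sub hf0, Real.rpow_two, Real.rpow_sub two_pos, Real.rpow_sub two_pos,
          Real.rpow_two]
        have h5 : (2 : ℝ) - p ≠ 0 := by linarith
        have h6 : p - 2 ≠ 0 := by linarith
        have h7 : (0 : ℝ) < 2 ^ p := by positivity
        rw [show p - 2 = -(2 - p) by ring]
        field_simp

/-- Here a fixed x contributes |f x| times the integral of t^(p-2) over 0 < t ≤ 2|f x|, which
converges at zero because p > 1. -/
lemma lintegral_layer_high {f : ℝ → ℂ} (hf : Continuous f) {p : ℝ} (hp1 : 1 < p) :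
    ∫⁻ t in Set.Ioi (0 : ℝ), (ENNReal.ofReal t)⁻¹ *
        (∫⁻ x in {x | t / 2 < ‖f x‖}, ‖f x‖ₑ) * ENNReal.ofReal (t ^ (p - 1)) ≤
      ENNReal.ofReal (2 ^ (p - 1) / (p - 1)) * ∫⁻ x, ‖f x‖ₑ ^ p := by
  set Φ : ℝ → ℝ → ℝ≥0∞ := fun t x =>
    {z : ℝ × ℝ | z.1 / 2 < ‖f z.2‖}.indicator (fun z => ‖f z.2‖ₑ *
      ENNReal.ofReal (z.1 ^ (p - 2))) (t, x) with hΦ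
  have hset : MeasurableSet {z : ℝ × ℝ | z.1 / 2 < ‖f z.2‖} :=
    measurableSet_lt (measurable_fst.div_const 2) (hf.measurable.comp measurable_snd).norm
  have hΦm : Measurable (Function.uncurry Φ) :=
    (((hf.measurable.comp measurable_snd).enorm).mul
      (measurable_fst.pow_const (p - 2)).ennreal_ofReal).indicator hset
  have h1 : ∀ t ∈ Set.Ioi (0 : ℝ), (ENNReal.ofReal t)⁻¹ *
      (∫⁻ x in {x | t / 2 < ‖f x‖}, ‖f x‖ₑ) * ENNReal.ofReal (t ^ (p - 1)) =
      ∫⁻ x, Φ t x := by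
    intro t ht
    have ht0 : 0 < t := ht
    have e1 : ∀ x, Φ t x = {x | t / 2 < ‖f x‖}.indicator (fun x => ‖f x‖ₑ *
        ENNReal.ofReal (t ^ (p - 2))) x := fun x => rfl
    simp only [e1]
    rw [lintegral_indicator (measurableSet_lt measurable_const hf.norm.measurable),
      lintegral_mul_const _ hf.measurable.enorm, mul_comm ((ENNReal.ofReal t)⁻¹),
      mul_assoc]
    congr 1
    rw [← ENNReal.ofReal_inv_of_pos ht0, ← ENNReal.ofReal_mul (by positivity)]
    congr 1
    rw [show p - 1 = p - 2 + 1 by ring, Real.rpow_add ht0, Real.rpow_one]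
    field_simp
  rw [setLIntegral_congr_fun measurableSet_Ioi h1, lintegral_lintegral_swap hΦm.aemeasurable,
    ← lintegral_const_mul' _ _ ENNReal.ofReal_ne_top]
  refine lintegral_mono fun x => ?_
  have hc : 0 ≤ 2 * ‖f x‖ := by positivity
  have hint : IntervalIntegrable (fun t : ℝ => t ^ (p - 2)) volume 0 (2 * ‖f x‖) :=
    intervalIntegral.intervalIntegrable_rpow' (by linarith)
  have e2 : ∀ t ∈ Set.Ioi (0 : ℝ), Φ t x ≤ (Set.Ioc 0 (2 * ‖f x‖)).indicator (fun t => ‖f x‖ₑ *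
      ENNReal.ofReal (t ^ (p - 2))) t := by
    intro t ht
    simp only [hΦ]
    by_cases h : (t, x) ∈ {z : ℝ × ℝ | z.1 / 2 < ‖f z.2‖}
    · rw [Set.indicator_of_mem h, Set.indicator_of_mem]
      have : t / 2 < ‖f x‖ := h
      exact ⟨ht, by linarith⟩
    · rw [Set.indicator_of_notMem h]; simp
  calc ∫⁻ t in Set.Ioi 0, Φ t x
      ≤ ∫⁻ t, (Set.Ioc 0 (2 * ‖f x‖)).indicator (fun t => ‖f x‖ₑ *
          ENNReal.ofReal (t ^ (p - 2))) t :=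
        (setLIntegral_mono' measurableSet_Ioi e2).trans (setLIntegral_le_lintegral _ _)
    _ = ‖f x‖ₑ * ∫⁻ t in Set.Ioc 0 (2 * ‖f x‖), ENNReal.ofReal (t ^ (p - 2)) := by
        rw [lintegral_indicator measurableSet_Ioc, lintegral_const_mul' _ _ (by simp)]
    _ = ‖f x‖ₑ * ENNReal.ofReal ((2 * ‖f x‖) ^ (p - 1) / (p - 1)) := by
        congr 1
        rw [← ofReal_integral_eq_lintegral_ofReal
          ((intervalIntegrable_iff_integrableOn_Ioc_of_le hc).1 hint)
          ((ae_restrict_iff' measurableSet_Ioc).2 (Eventually.of_forall fun t ht =>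
          Real.rpow_nonneg ht.1.le _)), ← intervalIntegral.integral_of_le hc,
          integral_rpow (Or.inl (by linarith)), show p - 2 + 1 = p - 1 by ring,
          Real.zero_rpow (by linarith), sub_zero]
    _ = ENNReal.ofReal (2 ^ (p - 1) / (p - 1)) * ‖f x‖ₑ ^ p := by
        have hp0 : 0 < p - 1 := by linarith
        rw [← ofReal_norm, ENNReal.ofReal_rpow_of_nonneg (by positivity) (by linarith),
          ← ENNReal.ofReal_mul (by positivity), ← ENNReal.ofReal_mul (by positivity)]
        congr 1
        rw [Real.mul_rpow (by norm_num) (by positivity)]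
        by_cases hx : ‖f x‖ = 0
        · rw [hx, Real.zero_rpow (by linarith : p ≠ 0)]; simp
        have hf0 : 0 < ‖f x‖ := lt_of_le_of_ne (norm_nonneg _) (Ne.symm hx)
        rw [Real.rpow_sub hf0, Real.rpow_one]
        field_simp

/-- Layer cake applied to `measure_lt_norm_convol_le`. That estimate already splits `f` at height
comparable to α, so interpolation amounts to the two preceding integrals. -/
lemma lintegral_rpow_convol_le (K : 𝓢(ℝ, ℂ)) {B D : ℝ≥0} (hB : ∀ ξ, ‖𝓕 K ξ‖ ≤ B)
    (hD : ∀ x, x ^ 2 * ‖deriv K x‖ ≤ D) {p : ℝ} (hp1 : 1 < p) (hp2 : p < 2) {f : ℝ → ℂ}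
    (hf : Continuous f) (hc : HasCompactSupport f) :
    ∫⁻ x, ‖convol K f x‖ₑ ^ p ≤ ENNReal.ofReal p * ((16 * B ^ 2 + 32 * D + 4 : ℝ≥0) : ℝ≥0∞) *
      (ENNReal.ofReal (2 ^ (2 - p) / (2 - p)) + ENNReal.ofReal (2 ^ (p - 1) / (p - 1))) *
      ∫⁻ x, ‖f x‖ₑ ^ p := by
  have hp0 : 0 < p := by linarith
  set M : ℝ≥0∞ := ((16 * B ^ 2 + 32 * D + 4 : ℝ≥0) : ℝ≥0∞)
  have hTm : AEMeasurable (fun x => ‖convol K f x‖) :=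
    (aestronglyMeasurable_convol K.continuous hf.aestronglyMeasurable).norm.aemeasurable
  have e : ∫⁻ x, ‖convol K f x‖ₑ ^ p = ∫⁻ x, ENNReal.ofReal (‖convol K f x‖ ^ p) := by
    refine lintegral_congr fun x => ?_
    rw [← ofReal_norm, ENNReal.ofReal_rpow_of_nonneg (norm_nonneg _) hp0.le]
  rw [e, lintegral_rpow_eq_lintegral_meas_lt_mul volume
    (Eventually.of_forall fun x => norm_nonneg _) hTm hp0, mul_assoc, mul_assoc]
  gcongr
  have hm1 : Measurable fun t : ℝ => (ENNReal.ofReal t)⁻¹ ^ 2 *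
        (∫⁻ x in {x | ‖f x‖ ≤ 2 * t}, ‖f x‖ₑ ^ 2) * ENNReal.ofReal (t ^ (p - 1)) := by
    -- The inner integral increases with t, which gives measurability at once.
    refine Measurable.mul (Measurable.mul (by fun_prop) (Monotone.measurable ?_)) (by fun_prop)
    intro s t hst
    refine lintegral_mono_set fun x (hx : ‖f x‖ ≤ 2 * s) => ?_
    exact hx.trans (by gcongr)
  calc ∫⁻ t in Set.Ioi (0 : ℝ), volume {x | t < ‖convol K f x‖} * ENNReal.ofReal (t ^ (p - 1))
      ≤ ∫⁻ t in Set.Ioi (0 : ℝ), M * ((ENNReal.ofReal t)⁻¹ ^ 2 *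
          (∫⁻ x in {x | ‖f x‖ ≤ 2 * t}, ‖f x‖ₑ ^ 2) * ENNReal.ofReal (t ^ (p - 1)) +
          (ENNReal.ofReal t)⁻¹ * (∫⁻ x in {x | t / 2 < ‖f x‖}, ‖f x‖ₑ) *
            ENNReal.ofReal (t ^ (p - 1))) := by
        refine setLIntegral_mono' measurableSet_Ioi fun t ht => ?_
        rw [← add_mul, ← mul_assoc]
        gcongr
        exact measure_lt_norm_convol_le K hB hD hf hc ht
    _ = M * ((∫⁻ t in Set.Ioi (0 : ℝ), (ENNReal.ofReal t)⁻¹ ^ 2 *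
          (∫⁻ x in {x | ‖f x‖ ≤ 2 * t}, ‖f x‖ₑ ^ 2) * ENNReal.ofReal (t ^ (p - 1))) +
          ∫⁻ t in Set.Ioi (0 : ℝ), (ENNReal.ofReal t)⁻¹ * (∫⁻ x in {x | t / 2 < ‖f x‖}, ‖f x‖ₑ) *
            ENNReal.ofReal (t ^ (p - 1))) := by
        rw [lintegral_const_mul' _ _ ENNReal.coe_ne_top, lintegral_add_left hm1]
    _ ≤ _ := by
        rw [add_mul]
        gcongr
        · exact lintegral_layer_low hf hp2
        · exact lintegral_layer_high hf hp1

/-- An `L^p` function is bounded by its pairings with `L^q`. -/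
lemma eLpNorm_le_of_forall_integral {α : Type*} [MeasurableSpace α] {μ : Measure α} {p q : ℝ≥0∞}
    (hp : 1 < p) (hp' : p < ⊤) [hpq : p.HolderConjugate q] {F : α → ℂ} (hF : MemLp F p μ)
    {A : ℝ≥0∞} (H : ∀ g : α → ℂ, MemLp g q μ → ‖∫ x, F x * g x ∂μ‖ₑ ≤ A * eLpNorm g q μ) :
    eLpNorm F p μ ≤ A := by
  set r := p.toReal with hr
  have hr1 : 1 < r := by
    rw [hr, ← ENNReal.toReal_one]
    exact (ENNReal.toReal_lt_toReal (by simp) hp'.ne).2 hp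
  have hr0 : 0 < r := by linarith
  set s := q.toReal with hs
  have hq' : q ≠ ⊤ := ((ENNReal.HolderConjugate.lt_top_iff_one_lt q p).2 hp).ne
  have hrs : r.HolderConjugate s := ENNReal.HolderConjugate.toReal_of_ne_top hp'.ne hq'
  have hq0 : q ≠ 0 := ENNReal.HolderConjugate.ne_zero q p
  have hp0 : p ≠ 0 := ENNReal.HolderConjugate.ne_zero p q
  have hNt : eLpNorm F p μ ≠ ⊤ := hF.2.ne
  by_cases hN0 : eLpNorm F p μ = 0
  · rw [hN0]; exact zero_le
  set N := eLpNorm F p μ with hN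
  have hNr : N ^ r = ∫⁻ x, ‖F x‖ₑ ^ r ∂μ := by
    rw [hN, eLpNorm_eq_lintegral_rpow_enorm_toReal hp0 hp'.ne, ← hr, ← ENNReal.rpow_mul,
      one_div_mul_cancel hr0.ne', ENNReal.rpow_one]
  -- The extremiser of Hölder's inequality. Where `F` vanishes the value of the power is irrelevant,
  -- since the other factor is zero.
  set g : α → ℂ := fun x => ((‖F x‖ ^ (r - 2) : ℝ) : ℂ) * conj (F x) with hg
  have hgm : AEStronglyMeasurable g μ :=
    (Complex.continuous_ofReal.comp_aestronglyMeasurable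
      (hF.1.norm.aemeasurable.pow_const (r - 2)).aestronglyMeasurable).mul
      (Complex.continuous_conj.comp_aestronglyMeasurable hF.1)
  have hgn : ∀ x, ‖g x‖ = ‖F x‖ ^ (r - 1) := by
    intro x
    simp only [hg, norm_mul, Complex.norm_real, RCLike.norm_conj,
      Real.norm_of_nonneg (Real.rpow_nonneg (norm_nonneg (F x)) _)]
    by_cases h0 : ‖F x‖ = 0
    · rw [h0, mul_zero, Real.zero_rpow (by linarith)]
    have hpos : 0 < ‖F x‖ := lt_of_le_of_ne (norm_nonneg _) (Ne.symm h0)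
    rw [show r - 1 = r - 2 + 1 by ring, Real.rpow_add_one hpos.ne']
  have hFg : ∀ x, F x * g x = ((‖F x‖ ^ r : ℝ) : ℂ) := by
    intro x
    simp only [hg]
    rw [mul_comm, mul_assoc, mul_comm (conj (F x)), Complex.mul_conj, Complex.normSq_eq_norm_sq,
      ← Complex.ofReal_mul]
    congr 1
    by_cases h0 : ‖F x‖ = 0
    · rw [h0, Real.zero_rpow hr0.ne']; simp
    have hpos : 0 < ‖F x‖ := lt_of_le_of_ne (norm_nonneg _) (Ne.symm h0)
    rw [← Real.rpow_two, ← Real.rpow_add hpos, sub_add_cancel]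
  have hgs : ∫⁻ x, ‖g x‖ₑ ^ s ∂μ = N ^ r := by
    rw [hNr]
    refine lintegral_congr fun x => ?_
    rw [← ofReal_norm, hgn, ← ENNReal.ofReal_rpow_of_nonneg (norm_nonneg _) (by linarith),
      ofReal_norm, ← ENNReal.rpow_mul, hrs.sub_one_mul_conj]
  have hgN : eLpNorm g q μ = N ^ (r / s) := by
    rw [eLpNorm_eq_lintegral_rpow_enorm_toReal hq0 hq', ← hs, hgs, ← ENNReal.rpow_mul]
    congr 1; ring
  have hgL : MemLp g q μ := ⟨hgm, by
    rw [hgN]; exact ENNReal.rpow_lt_top_of_nonneg (div_nonneg hr0.le hrs.symm.nonneg) hNt⟩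
  have hmain := H g hgL
  have hint : ‖∫ x, F x * g x ∂μ‖ₑ = N ^ r := by
    simp only [hFg]
    rw [integral_complex_ofReal, hNr, ← ofReal_norm, Complex.norm_real, Real.norm_of_nonneg
      (integral_nonneg fun x => Real.rpow_nonneg (norm_nonneg _) _),
      ofReal_integral_eq_lintegral_ofReal _
        (Eventually.of_forall fun x => Real.rpow_nonneg (norm_nonneg _) _)]
    · refine lintegral_congr fun x => ?_
      rw [← ofReal_norm, ENNReal.ofReal_rpow_of_nonneg (norm_nonneg _) hr0.le]
    · exact hF.integrable_norm_rpow hp0 hp'.ne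
  rw [hint, hgN] at hmain
  have hNs : N ^ r = N * N ^ (r / s) := by
    conv_rhs => rw [← ENNReal.rpow_one N, ← ENNReal.rpow_mul, one_mul,
      ← ENNReal.rpow_add _ _ hN0 hNt]
    congr 1
    have := hrs.div_conj_eq_sub_one
    linarith
  rw [hNs] at hmain
  -- Cancelling the power of `N` requires it to be finite; hence `F` is assumed in L^p beforehand.
  exact (ENNReal.mul_le_mul_iff_left (by simp [hN0, hNt]) (by simp [hN0, hNt])).1 hmain

end AdaptedLP

end

/-! ### Transposition and the full range of exponents -/

noncomputable section

namespace AdaptedLP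

open scoped SchwartzMap

/-- The reflection `x ↦ K (-x)` of a Schwartz function. -/
def reflect (K : 𝓢(ℝ, ℂ)) : 𝓢(ℝ, ℂ) :=
  SchwartzMap.compCLMOfContinuousLinearEquiv ℂ (ContinuousLinearEquiv.neg ℝ) K

@[simp] lemma reflect_apply (K : 𝓢(ℝ, ℂ)) (x : ℝ) : reflect K x = K (-x) := rfl

lemma fourier_reflect (K : 𝓢(ℝ, ℂ)) (ξ : ℝ) : 𝓕 (reflect K) ξ = 𝓕 K (-ξ) := by
  rw [SchwartzMap.fourier_coe, SchwartzMap.fourier_coe, Real.fourier_eq, Real.fourier_eq,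
    ← integral_neg_eq_self]
  simp

lemma deriv_reflect (K : 𝓢(ℝ, ℂ)) (x : ℝ) : deriv (reflect K) x = -deriv K (-x) :=
  deriv_comp_neg (f := fun x => K x) x

lemma norm_mul_le_rpow_add_rpow {p q : ℝ} (hpq : p.HolderConjugate q) (a b : ℂ) :
    ‖a‖ * ‖b‖ ≤ ‖a‖ ^ p + ‖b‖ ^ q := by
  refine (Real.young_inequality_of_nonneg (norm_nonneg a) (norm_nonneg b) hpq).trans ?_
  gcongr
  · exact div_le_self (by positivity) hpq.lt.le
  · exact div_le_self (by positivity) hpq.symm.lt.le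

/-- Young's inequality bounds |f||g| by |f|^p + |g|^q, which leaves two integrands of L¹
convolutions. -/
lemma integrable_mul_mul_comp_sub (K : 𝓢(ℝ, ℂ)) {p q : ℝ≥0∞} (hp : 1 < p) (hp' : p < ⊤)
    [p.HolderConjugate q] {f g : ℝ → ℂ} (hf : MemLp f p) (hg : MemLp g q) :
    Integrable (fun z : ℝ × ℝ => f z.2 * K (z.1 - z.2) * g z.1) := by
  have hq' : q ≠ ⊤ := ((ENNReal.HolderConjugate.lt_top_iff_one_lt q p).2 hp).ne
  have hrs := ENNReal.HolderConjugate.toReal_of_ne_top (p := p) (q := q) hp'.ne hq'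
  have hK : Integrable (fun x => ‖K x‖) := K.integrable.norm
  have hK' : Integrable (fun x => ‖reflect K x‖) := (reflect K).integrable.norm
  have hfp := hf.integrable_norm_rpow (ENNReal.HolderConjugate.ne_zero p q) hp'.ne
  have hgq := hg.integrable_norm_rpow (ENNReal.HolderConjugate.ne_zero q p) hq'
  have h1 : Integrable (fun z : ℝ × ℝ => ‖f z.2‖ ^ p.toReal * ‖K (z.1 - z.2)‖) :=
    hfp.convolution_integrand (ContinuousLinearMap.mul ℝ ℝ) hK
  have h2 : Integrable (fun z : ℝ × ℝ => ‖g z.1‖ ^ q.toReal * ‖K (z.1 - z.2)‖) := by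
    have := (hgq.convolution_integrand (ContinuousLinearMap.mul ℝ ℝ) hK').swap
    refine this.congr (Eventually.of_forall fun z => ?_)
    simp
  refine (h1.add h2).mono ?_ (Eventually.of_forall fun z => ?_)
  · exact (aestronglyMeasurable_convol_integrand K.continuous hf.1 measurable_id).mul hg.1.comp_fst
  · rw [norm_mul, norm_mul, Pi.add_apply, ← add_mul, Real.norm_of_nonneg (by positivity),
      mul_right_comm]
    gcongr
    exact norm_mul_le_rpow_add_rpow hrs _ _

/-- The transpose of the convolution with `K` is the convolution with the reflected kernel. -/
lemma integral_convol_mul (K : 𝓢(ℝ, ℂ)) {p q : ℝ≥0∞} (hp : 1 < p) (hp' : p < ⊤)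
    [p.HolderConjugate q] {f g : ℝ → ℂ} (hf : MemLp f p) (hg : MemLp g q) :
    ∫ x, convol K f x * g x = ∫ x, f x * convol (reflect K) g x := by
  have hI := integrable_mul_mul_comp_sub K hp hp' hf hg
  simp only [convol, ← integral_mul_const, ← integral_const_mul]
  rw [integral_integral_swap hI]
  refine integral_congr_ae (Eventually.of_forall fun y => integral_congr_ae
    (Eventually.of_forall fun x => ?_))
  simp only [reflect_apply, neg_sub]
  ring

lemma holder_integral_mul {α : Type*} [MeasurableSpace α] {μ : Measure α} {p q : ℝ≥0∞}
    [p.HolderConjugate q] {f g : α → ℂ} (hf : AEStronglyMeasurable f μ)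
    (hg : AEStronglyMeasurable g μ) :
    ‖∫ x, f x * g x ∂μ‖ₑ ≤ eLpNorm f p μ * eLpNorm g q μ := by
  have h1 := eLpNorm_smul_le_mul_eLpNorm (μ := μ) (p := p) (q := q) (r := 1) hg hf
  refine le_trans ?_ h1
  rw [eLpNorm_one_eq_lintegral_enorm]
  exact enorm_integral_le_lintegral_enorm _

lemma exists_eLpNorm_convol_le_of_lt_two {p : ℝ≥0∞} (hp : 1 < p) (hp2 : p < 2) (B D : ℝ≥0) :
    ∃ C : ℝ≥0, ∀ K : 𝓢(ℝ, ℂ), (∀ ξ, ‖𝓕 K ξ‖ ≤ B) → (∀ x, x ^ 2 * ‖deriv K x‖ ≤ D) →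
      ∀ f : ℝ → ℂ, MemLp f p → eLpNorm (convol K f) p ≤ C * eLpNorm f p := by
  have hp' : p < ⊤ := hp2.trans (by simp)
  have hp0 : p ≠ 0 := (zero_lt_one.trans hp).ne'
  set r := p.toReal with hr
  have hr1 : 1 < r := by
    rw [hr, ← ENNReal.toReal_one]
    exact (ENNReal.toReal_lt_toReal (by simp) hp'.ne).2 hp
  have hr2 : r < 2 := by
    rw [hr, ← ENNReal.toReal_ofNat 2]
    exact (ENNReal.toReal_lt_toReal hp'.ne (by simp)).2 hp2
  set A : ℝ≥0∞ := ENNReal.ofReal r * ((16 * B ^ 2 + 32 * D + 4 : ℝ≥0) : ℝ≥0∞) *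
    (ENNReal.ofReal (2 ^ (2 - r) / (2 - r)) + ENNReal.ofReal (2 ^ (r - 1) / (r - 1))) with hA
  have hAt : A ^ (1 / r) ≠ ⊤ := by
    refine (ENNReal.rpow_lt_top_of_nonneg (by positivity) ?_).ne
    exact ENNReal.mul_ne_top (ENNReal.mul_ne_top ENNReal.ofReal_ne_top ENNReal.coe_ne_top)
      (ENNReal.add_ne_top.2 ⟨ENNReal.ofReal_ne_top, ENNReal.ofReal_ne_top⟩)
  refine ⟨(A ^ (1 / r)).toNNReal, fun K hB hD f hf => ?_⟩
  rw [ENNReal.coe_toNNReal hAt]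
  refine eLpNorm_convol_le_of_smooth K hp.le hp'.ne hAt (fun φ h1 h2 => ?_) hf
  rw [eLpNorm_eq_lintegral_rpow_enorm_toReal hp0 hp'.ne,
    eLpNorm_eq_lintegral_rpow_enorm_toReal hp0 hp'.ne, ← hr,
    ← ENNReal.mul_rpow_of_nonneg _ _ (by positivity)]
  gcongr
  exact lintegral_rpow_convol_le K hB hD hr1 hr2 h2.continuous h1

/-- `L^p` bounds for Calderón-Zygmund convolution operators with Schwartz kernels. The constant
depends only on `p`, the bound `B` of the multiplier, and the bound `D` of the kernel. -/
theorem exists_eLpNorm_convol_le {p : ℝ≥0∞} (hp : 1 < p) (hp' : p < ⊤) (B D : ℝ≥0) :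
    ∃ C : ℝ≥0, ∀ K : 𝓢(ℝ, ℂ), (∀ ξ, ‖𝓕 K ξ‖ ≤ B) → (∀ x, x ^ 2 * ‖deriv K x‖ ≤ D) →
      ∀ f : ℝ → ℂ, MemLp f p → eLpNorm (convol K f) p ≤ C * eLpNorm f p := by
  rcases lt_trichotomy p 2 with h2 | rfl | h2
  · exact exists_eLpNorm_convol_le_of_lt_two hp h2 B D
  · exact ⟨B, fun K hB _ f hf => eLpNorm_two_convol_le K hB hf⟩
  -- For p > 2 the conjugate exponent is below 2, and the transposed kernel satisfies the same two
  -- bounds.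
  · set q := p.conjExponent
    have hpq : p.HolderConjugate q := ENNReal.HolderConjugate.conjExponent hp.le
    have hq1 : 1 < q := (ENNReal.HolderConjugate.lt_top_iff_one_lt p q).1 hp'
    have hq2 : q < 2 := by
      by_contra! hcon
      have h3 := hpq.inv_add_inv_eq_one
      have h4 : p⁻¹ < 2⁻¹ := ENNReal.inv_lt_inv.2 h2
      have h5 : q⁻¹ ≤ 2⁻¹ := ENNReal.inv_le_inv.2 hcon
      have h6 : p⁻¹ + q⁻¹ < 2⁻¹ + 2⁻¹ :=
        ENNReal.add_lt_add_of_lt_of_le (h5.trans_lt (by simp)).ne h4 h5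
      rw [h3, ENNReal.inv_two_add_inv_two] at h6
      exact lt_irrefl _ h6
    obtain ⟨C, hC⟩ := exists_eLpNorm_convol_le_of_lt_two hq1 hq2 B D
    refine ⟨C, fun K hB hD f hf => ?_⟩
    refine eLpNorm_convol_le_of_smooth K hp.le hp'.ne ENNReal.coe_ne_top (fun φ h1 h2 => ?_) hf
    have hφ : MemLp φ p := memLp_of_smooth h1 h2 p
    -- The duality lemma needs this qualitative fact; on test functions the convolution is Schwartz.
    have hT : MemLp (convol K φ) p := by
      have e : convol K φ =
          SchwartzMap.convolution (ContinuousLinearMap.mul ℂ ℂ) (h1.toSchwartzMap h2) K :=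
        funext fun x => convol_schwartz K (h1.toSchwartzMap h2) x
      rw [e]
      exact memLp_schwartz _ p
    refine eLpNorm_le_of_forall_integral (q := q) hp hp' hT fun g hg => ?_
    rw [integral_convol_mul K hp hp' hφ hg]
    have hB' : ∀ ξ, ‖𝓕 (reflect K) ξ‖ ≤ B := fun ξ => by rw [fourier_reflect]; exact hB _
    have hD' : ∀ x, x ^ 2 * ‖deriv (reflect K) x‖ ≤ D := fun x => by
      rw [deriv_reflect, norm_neg, ← neg_sq]; exact hD _
    have hm : AEStronglyMeasurable (convol (reflect K) g) :=
      aestronglyMeasurable_convol (reflect K).continuous hg.1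
    refine (holder_integral_mul (p := p) (q := q) hφ.1 hm).trans ?_
    have := hC (reflect K) hB' hD' g hg
    exact (mul_le_mul' le_rfl this).trans (le_of_eq (by ring))

end AdaptedLP

end

/-! ### Random signs, Khintchine's inequality and lacunary sums -/

noncomputable section

namespace AdaptedLP

open scoped SchwartzMap

/-- The sign of `k` attached to a set of positive indices. -/
def sgn (S : Finset ℤ) (k : ℤ) : ℂ := if k ∈ S then 1 else -1

lemma norm_sgn (S : Finset ℤ) (k : ℤ) : ‖sgn S k‖ = 1 := by
  unfold sgn; split_ifs <;> simp

/-- Conditioning on the sign of `j`, the inductive step for both moments. Averages over the power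
set replace random signs. -/
lemma sum_powerset_sgn_insert {F : Finset ℤ} {j : ℤ} (hj : j ∉ F) (a : ℤ → ℂ) (Φ : ℂ → ℝ) :
    ∑ S ∈ (insert j F).powerset, Φ (∑ k ∈ insert j F, sgn S k * a k) =
      ∑ S ∈ F.powerset, (Φ (∑ k ∈ F, sgn S k * a k - a j) +
        Φ (∑ k ∈ F, sgn S k * a k + a j)) := by
  rw [Finset.sum_powerset_insert hj, Finset.sum_add_distrib]
  congr 1
  · refine Finset.sum_congr rfl fun S hS => ?_
    have : j ∉ S := fun h => hj (Finset.mem_powerset.1 hS h)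
    rw [Finset.sum_insert hj, show sgn S j = -1 by simp [sgn, this]]
    congr 1; ring
  · refine Finset.sum_congr rfl fun S hS => ?_
    rw [Finset.sum_insert hj, show sgn (insert j S) j = 1 by simp [sgn]]
    have : ∑ k ∈ F, sgn (insert j S) k * a k = ∑ k ∈ F, sgn S k * a k := by
      refine Finset.sum_congr rfl fun k hk => ?_
      have : k ≠ j := fun h => hj (h ▸ hk)
      simp [sgn, this]
    rw [this]
    congr 1; ring

lemma sum_powerset_norm_sq (F : Finset ℤ) (a : ℤ → ℂ) :
    ∑ S ∈ F.powerset, ‖∑ k ∈ F, sgn S k * a k‖ ^ 2 = 2 ^ F.card * ∑ k ∈ F, ‖a k‖ ^ 2 := by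
  induction F using Finset.induction_on with
  | empty => simp
  | insert j F hj ih =>
    rw [sum_powerset_sgn_insert hj a (fun z => ‖z‖ ^ 2), Finset.card_insert_of_notMem hj,
      Finset.sum_insert hj]
    have : ∀ z : ℂ, ‖z - a j‖ ^ 2 + ‖z + a j‖ ^ 2 = 2 * ‖z‖ ^ 2 + 2 * ‖a j‖ ^ 2 := by
      intro z
      have := parallelogram_law_with_norm ℝ z (a j)
      nlinarith
    simp only [this, Finset.sum_add_distrib, ← Finset.mul_sum, ih, Finset.sum_const,
      Finset.card_powerset, nsmul_eq_mul]
    push_cast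
    ring

/-- The parallelogram law and Cauchy-Schwarz bound the two fourth powers with cross term
12|a_j|²|z|². Its average is known from the second moment and exactly fits the expansion of 6(s +
|a_j|²)², so the constant 3 survives the induction. -/
lemma sum_powerset_norm_pow_four_le (F : Finset ℤ) (a : ℤ → ℂ) :
    ∑ S ∈ F.powerset, ‖∑ k ∈ F, sgn S k * a k‖ ^ 4 ≤
      3 * 2 ^ F.card * (∑ k ∈ F, ‖a k‖ ^ 2) ^ 2 := by
  induction F using Finset.induction_on with
  | empty => simp
  | insert j F hj ih =>
    rw [sum_powerset_sgn_insert hj a (fun z => ‖z‖ ^ 4), Finset.card_insert_of_notMem hj,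
      Finset.sum_insert hj]
    have h4 : ∀ z : ℂ, ‖z - a j‖ ^ 4 + ‖z + a j‖ ^ 4 ≤
        2 * ‖z‖ ^ 4 + 12 * ‖a j‖ ^ 2 * ‖z‖ ^ 2 + 2 * ‖a j‖ ^ 4 := by
      intro z
      have h1 := parallelogram_law_with_norm ℝ z (a j)
      have h2 : |‖z + a j‖ ^ 2 - ‖z - a j‖ ^ 2| ≤ 4 * (‖z‖ * ‖a j‖) := by
        have e : ‖z + a j‖ ^ 2 - ‖z - a j‖ ^ 2 = 4 * inner ℝ z (a j) := by
          have := norm_add_sq_real z (a j)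
          have := norm_sub_sq_real z (a j)
          linarith
        rw [e, abs_mul, abs_of_pos (by norm_num : (0 : ℝ) < 4)]
        gcongr
        exact abs_real_inner_le_norm z (a j)
      have h3 : (‖z + a j‖ ^ 2 - ‖z - a j‖ ^ 2) ^ 2 ≤ (4 * (‖z‖ * ‖a j‖)) ^ 2 := by
        rw [← sq_abs]; gcongr
      have h5 : ‖z + a j‖ ^ 2 + ‖z - a j‖ ^ 2 = 2 * (‖z‖ ^ 2 + ‖a j‖ ^ 2) := by linarith
      have h6 : (‖z + a j‖ ^ 2 + ‖z - a j‖ ^ 2) ^ 2 = (2 * (‖z‖ ^ 2 + ‖a j‖ ^ 2)) ^ 2 := by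
        rw [h5]
      nlinarith
    calc _ ≤ ∑ S ∈ F.powerset, (2 * ‖∑ k ∈ F, sgn S k * a k‖ ^ 4 +
          12 * ‖a j‖ ^ 2 * ‖∑ k ∈ F, sgn S k * a k‖ ^ 2 + 2 * ‖a j‖ ^ 4) :=
          Finset.sum_le_sum fun S _ => h4 _
      _ = 2 * ∑ S ∈ F.powerset, ‖∑ k ∈ F, sgn S k * a k‖ ^ 4 +
          12 * ‖a j‖ ^ 2 * (2 ^ F.card * ∑ k ∈ F, ‖a k‖ ^ 2) + 2 ^ F.card * (2 * ‖a j‖ ^ 4) := by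
          simp only [Finset.sum_add_distrib, ← Finset.mul_sum, sum_powerset_norm_sq,
            Finset.sum_const, Finset.card_powerset, nsmul_eq_mul]
          push_cast
          ring
      _ ≤ _ := by
          have h7 : (0 : ℝ) ≤ 2 ^ F.card * ‖a j‖ ^ 4 := by positivity
          rw [pow_succ (2 : ℝ) F.card]
          nlinarith

/-- Khintchine's inequality. -/
lemma exists_khintchine {r : ℝ} (hr : 0 < r) : ∃ C : ℝ, 0 ≤ C ∧ ∀ (F : Finset ℤ) (a : ℤ → ℂ),
    (∑ k ∈ F, ‖a k‖ ^ 2) ^ (r / 2) ≤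
      C * ((2 ^ F.card)⁻¹ * ∑ S ∈ F.powerset, ‖∑ k ∈ F, sgn S k * a k‖ ^ r) := by
  refine ⟨2 * 6 ^ (1 - r / 2) + 2 * (1 / 2) ^ (1 - r / 2), by positivity, fun F a => ?_⟩
  set s := ∑ k ∈ F, ‖a k‖ ^ 2 with hs
  set E := (2 ^ F.card)⁻¹ * ∑ S ∈ F.powerset, ‖∑ k ∈ F, sgn S k * a k‖ ^ r with hE
  have hE0 : 0 ≤ E := by positivity
  have hs0 : 0 ≤ s := by positivity
  rcases hs0.eq_or_lt with h | hpos
  · rw [← h, Real.zero_rpow (by positivity)]; positivity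
  have h2 : (2 ^ F.card : ℝ)⁻¹ * ∑ S ∈ F.powerset, ‖∑ k ∈ F, sgn S k * a k‖ ^ 2 = s := by
    rw [sum_powerset_norm_sq]; field_simp; rfl
  have h4 : (2 ^ F.card : ℝ)⁻¹ * ∑ S ∈ F.powerset, ‖∑ k ∈ F, sgn S k * a k‖ ^ 4 ≤ 3 * s ^ 2 := by
    have := sum_powerset_norm_pow_four_le F a
    rw [inv_mul_le_iff₀ (by positivity)]
    linarith
  have hcard : (2 ^ F.card : ℝ)⁻¹ * ∑ S ∈ F.powerset, s / 2 = s / 2 := by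
    rw [Finset.sum_const, Finset.card_powerset, nsmul_eq_mul]; push_cast; field_simp
  -- Both ranges of r end here: absorb s / 2 and divide by s^(1 - r/2).
  have fin : ∀ c : ℝ, 0 < c → s ≤ (c * s) ^ (1 - r / 2) * E + s / 2 →
      s ^ (r / 2) ≤ 2 * c ^ (1 - r / 2) * E := by
    intro c hc h
    rw [Real.mul_rpow hc.le hs0] at h
    have hsp : 0 < s ^ (1 - r / 2) := by positivity
    have e : s ^ (1 - r / 2) * s ^ (r / 2) = s := by
      rw [← Real.rpow_add hpos, sub_add_cancel, Real.rpow_one]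
    have : s ^ (1 - r / 2) * s ^ (r / 2) ≤ s ^ (1 - r / 2) * (2 * c ^ (1 - r / 2) * E) := by
      rw [e]; nlinarith
    exact le_of_mul_le_mul_left this hsp
  rcases lt_or_ge r 2 with hr2 | hr2
  -- The threshold 6s is chosen so that the fourth moment, at most 3s², contributes only s / 2.
  · have hx : ∀ x : ℝ, 0 ≤ x → x ^ 2 ≤ (6 * s) ^ (1 - r / 2) * x ^ r + (6 * s)⁻¹ * x ^ 4 := by
      intro x hx
      have h6 : 0 < 6 * s := by positivity
      rcases le_total (x ^ 2) (6 * s) with hle | hle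
      · have : x ^ 2 ≤ (6 * s) ^ (1 - r / 2) * x ^ r := by
          rcases hx.eq_or_lt with h0 | h0
          · rw [← h0]; simp only [ne_eq, OfNat.ofNat_ne_zero, not_false_eq_true, zero_pow]
            positivity
          calc x ^ 2 = (x ^ 2) ^ (1 - r / 2) * x ^ r := by
                rw [← Real.rpow_two, ← Real.rpow_mul h0.le, ← Real.rpow_add h0]
                congr 1; ring
            _ ≤ _ := by
                gcongr
                linarith
        have h0 : 0 ≤ (6 * s)⁻¹ * x ^ 4 := by positivity
        linarith
      · have : x ^ 2 ≤ (6 * s)⁻¹ * x ^ 4 := by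
          rw [← div_eq_inv_mul, le_div_iff₀ h6]; nlinarith [sq_nonneg x]
        have h0 : 0 ≤ (6 * s) ^ (1 - r / 2) * x ^ r := by positivity
        linarith
    have hsum : s ≤ (6 * s) ^ (1 - r / 2) * E + s / 2 := by
      calc s = (2 ^ F.card : ℝ)⁻¹ * ∑ S ∈ F.powerset, ‖∑ k ∈ F, sgn S k * a k‖ ^ 2 := h2.symm
        _ ≤ (2 ^ F.card : ℝ)⁻¹ * ∑ S ∈ F.powerset, ((6 * s) ^ (1 - r / 2) *
            ‖∑ k ∈ F, sgn S k * a k‖ ^ r + (6 * s)⁻¹ * ‖∑ k ∈ F, sgn S k * a k‖ ^ 4) := by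
            gcongr with S hS
            exact hx _ (norm_nonneg _)
        _ = (6 * s) ^ (1 - r / 2) * E + (6 * s)⁻¹ * ((2 ^ F.card : ℝ)⁻¹ *
            ∑ S ∈ F.powerset, ‖∑ k ∈ F, sgn S k * a k‖ ^ 4) := by
            rw [Finset.sum_add_distrib, ← Finset.mul_sum, ← Finset.mul_sum, hE]; ring
        _ ≤ (6 * s) ^ (1 - r / 2) * E + (6 * s)⁻¹ * (3 * s ^ 2) := by gcongr
        _ = _ := by field_simp; ring
    refine (fin 6 (by norm_num) hsum).trans ?_
    rw [add_mul]
    have : 0 ≤ 2 * (1 / 2 : ℝ) ^ (1 - r / 2) * E := by positivity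
    linarith
  -- For r ≥ 2 the small values, x² ≤ s / 2, are absorbed and no fourth moment is needed.
  · have hx : ∀ x : ℝ, 0 ≤ x → x ^ 2 ≤ (1 / 2 * s) ^ (1 - r / 2) * x ^ r + s / 2 := by
      intro x hx
      rcases le_total (x ^ 2) (s / 2) with hle | hle
      · have h0 : 0 ≤ (1 / 2 * s) ^ (1 - r / 2) * x ^ r := by positivity
        linarith
      · have h0 : 0 < x := by
          rcases hx.eq_or_lt with h0 | h0
          · rw [← h0] at hle; norm_num at hle; linarith
          · exact h0
        have : x ^ 2 ≤ (1 / 2 * s) ^ (1 - r / 2) * x ^ r := by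
          calc x ^ 2 = (x ^ 2) ^ (1 - r / 2) * x ^ r := by
                rw [← Real.rpow_two, ← Real.rpow_mul h0.le, ← Real.rpow_add h0]
                congr 1; ring
            _ ≤ _ := by
                gcongr ?_ * _
                exact Real.rpow_le_rpow_of_nonpos (by positivity) (by linarith) (by linarith)
        linarith
    have hsum : s ≤ (1 / 2 * s) ^ (1 - r / 2) * E + s / 2 := by
      calc s = (2 ^ F.card : ℝ)⁻¹ * ∑ S ∈ F.powerset, ‖∑ k ∈ F, sgn S k * a k‖ ^ 2 := h2.symm
        _ ≤ (2 ^ F.card : ℝ)⁻¹ * ∑ S ∈ F.powerset, ((1 / 2 * s) ^ (1 - r / 2) *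
            ‖∑ k ∈ F, sgn S k * a k‖ ^ r + s / 2) := by
            gcongr with S hS
            exact hx _ (norm_nonneg _)
        _ = (1 / 2 * s) ^ (1 - r / 2) * E + (2 ^ F.card : ℝ)⁻¹ * ∑ S ∈ F.powerset, s / 2 := by
            rw [Finset.sum_add_distrib, ← Finset.mul_sum, hE]; ring
        _ = _ := by rw [hcard]
    refine (fin (1 / 2) (by norm_num) hsum).trans ?_
    rw [add_mul]
    have : 0 ≤ 2 * (6 : ℝ) ^ (1 - r / 2) * E := by positivity
    linarith

/-- Uniform bound for lacunary sums. -/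
lemma exists_sum_min_le : ∃ C : ℝ, 0 ≤ C ∧ ∀ (F : Finset ℤ) (x : ℝ), 0 < x →
    ∑ k ∈ F, min ((2 : ℝ) ^ k * x) ((2 : ℝ) ^ k * x)⁻¹ ≤ C := by
  have hsum : Summable fun j : ℤ => (1 / 2 : ℝ) ^ j.natAbs := by
    refine Summable.of_nat_of_neg ?_ ?_ <;>
    simpa using summable_geometric_of_lt_one (r := (1 / 2 : ℝ)) (by norm_num) (by norm_num)
  refine ⟨2 * ∑' j : ℤ, (1 / 2 : ℝ) ^ j.natAbs, by positivity, fun F x hx => ?_⟩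
  -- Rounding x down to a power of two costs the factor 2 and centres the geometric series at k =
  -- -n.
  obtain ⟨n, hn1, hn2⟩ := exists_mem_Ico_zpow hx (one_lt_two (α := ℝ))
  have hterm : ∀ k : ℤ, min ((2 : ℝ) ^ k * x) ((2 : ℝ) ^ k * x)⁻¹ ≤
      2 * (1 / 2 : ℝ) ^ (k + n).natAbs := by
    intro k
    have h2k : (0 : ℝ) < 2 ^ k := by positivity
    rcases le_total 0 (k + n) with h | h
    · refine (min_le_right _ _).trans ?_
      have e : (1 / 2 : ℝ) ^ (k + n).natAbs = ((2 : ℝ) ^ k * 2 ^ n)⁻¹ := by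
        rw [← zpow_add₀ two_ne_zero, ← zpow_natCast, Int.natAbs_of_nonneg h, one_div, inv_zpow]
      rw [e]
      have : ((2 : ℝ) ^ k * x)⁻¹ ≤ ((2 : ℝ) ^ k * 2 ^ n)⁻¹ := by gcongr
      have h0 : 0 < ((2 : ℝ) ^ k * 2 ^ n)⁻¹ := by positivity
      linarith
    · refine (min_le_left _ _).trans ?_
      have e : (1 / 2 : ℝ) ^ (k + n).natAbs = (2 : ℝ) ^ k * 2 ^ n := by
        rw [← zpow_add₀ two_ne_zero, ← zpow_natCast, Int.ofNat_natAbs_of_nonpos h, one_div,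
          inv_zpow', neg_neg]
      rw [e]
      rw [zpow_add₀ two_ne_zero, zpow_one] at hn2
      nlinarith
  calc _ ≤ ∑ k ∈ F, 2 * (1 / 2 : ℝ) ^ (k + n).natAbs := Finset.sum_le_sum fun k _ => hterm k
    _ = 2 * ∑ k ∈ F, (1 / 2 : ℝ) ^ (k + n).natAbs := by rw [Finset.mul_sum]
    _ ≤ 2 * ∑' k : ℤ, (1 / 2 : ℝ) ^ (k + n).natAbs := by
        gcongr
        exact ((Equiv.addRight n).summable_iff.2 hsum).sum_le_tsum F fun k _ => by positivity
    _ = _ := congrArg (2 * ·)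
        ((Equiv.addRight n).tsum_eq fun j : ℤ => (1 / 2 : ℝ) ^ j.natAbs)

end AdaptedLP

end

/-! ### Littlewood-Paley kernels and the upper square function bound -/

noncomputable section

namespace AdaptedLP

open scoped SchwartzMap

/-- The dilate `ξ ↦ m (2^{-k} ξ)` of a Schwartz function. -/
def dil (m : 𝓢(ℝ, ℂ)) (k : ℤ) : 𝓢(ℝ, ℂ) :=
  SchwartzMap.compCLMOfContinuousLinearEquiv ℂ
    (ContinuousLinearEquiv.unitsEquivAut ℝ (Units.mk0 ((2 : ℝ) ^ (-k)) (by positivity))) m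

lemma dil_apply (m : 𝓢(ℝ, ℂ)) (k : ℤ) (x : ℝ) : dil m k x = m ((2 : ℝ) ^ (-k) * x) := by
  rw [mul_comm]; rfl

/-- The kernel of the frequency localization with multiplier `m (2^{-k} ξ)`. -/
def lpKer (m : 𝓢(ℝ, ℂ)) (k : ℤ) : 𝓢(ℝ, ℂ) := 𝓕⁻ (dil m k)

lemma lpKer_apply (m : 𝓢(ℝ, ℂ)) (k : ℤ) (x : ℝ) :
    lpKer m k x = (2 : ℂ) ^ k * (𝓕⁻ m : 𝓢(ℝ, ℂ)) ((2 : ℝ) ^ k * x) := by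
  have h2 : (2 : ℝ) ^ k ≠ 0 := by positivity
  rw [lpKer, SchwartzMap.fourierInv_coe, SchwartzMap.fourierInv_coe, Real.fourierInv_eq,
    Real.fourierInv_eq]
  have := Measure.integral_comp_mul_left
    (fun u : ℝ => Real.fourierChar (inner ℝ u ((2 : ℝ) ^ k * x)) • m u) ((2 : ℝ) ^ (-k))
  rw [zpow_neg, inv_inv, abs_of_pos (by positivity), Complex.real_smul] at this
  push_cast at this
  rw [← this]
  refine integral_congr_ae (Eventually.of_forall fun v => ?_)
  simp only [dil_apply, zpow_neg]
  have e : inner ℝ (((2 : ℝ) ^ k)⁻¹ * v) ((2 : ℝ) ^ k * x) = inner ℝ v x := by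
    simp only [RCLike.inner_apply, conj_trivial]
    field_simp
  rw [e]

lemma deriv_lpKer (m : 𝓢(ℝ, ℂ)) (k : ℤ) (x : ℝ) :
    deriv (lpKer m k) x = (2 : ℂ) ^ k * ((2 : ℂ) ^ k * deriv (𝓕⁻ m : 𝓢(ℝ, ℂ)) ((2 : ℝ) ^ k * x)) := by
  have e : (lpKer m k : ℝ → ℂ) =
      fun x => (2 : ℂ) ^ k * (fun y => (𝓕⁻ m : 𝓢(ℝ, ℂ)) ((2 : ℝ) ^ k * y)) x :=
    funext fun x => lpKer_apply m k x
  rw [e, deriv_const_mul_field, deriv_comp_mul_left, Complex.real_smul]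
  push_cast
  rfl

lemma exists_abs_pow_mul_norm_le (η : 𝓢(ℝ, ℂ)) (n : ℕ) :
    ∃ C : ℝ, 0 ≤ C ∧ ∀ x, |x| ^ n * ‖η x‖ ≤ C :=
  ⟨SchwartzMap.seminorm ℝ n 0 η, apply_nonneg _ _, fun x =>
    SchwartzMap.norm_pow_mul_le_seminorm ℝ η n x⟩

lemma le_mul_min_of_le {A a C C' : ℝ} (ha : 0 < a) (hC : 0 ≤ C) (hC' : 0 ≤ C') (h1 : A ≤ C * a)
    (h2 : a * A ≤ C') : A ≤ (C + C') * min a a⁻¹ := by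
  rcases le_total a a⁻¹ with h | h
  · rw [min_eq_left h]; nlinarith
  · rw [min_eq_right h, ← div_eq_mul_inv, le_div_iff₀ ha]; linarith

/-- Since m vanishes at 0 it is O(|ξ|), and it is O(1/|ξ|) by Schwartz decay, so the dilates sum
like a two-sided geometric series. -/
lemma exists_multiplier_bound (m : 𝓢(ℝ, ℂ)) (hm : m 0 = 0) : ∃ B : ℝ≥0, ∀ (F : Finset ℤ) (ξ : ℝ),
    ∑ k ∈ F, ‖dil m k ξ‖ ≤ B := by
  obtain ⟨C₀, hC₀, hsum⟩ := exists_sum_min_le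
  obtain ⟨C₁, hC₁, h1⟩ := exists_abs_pow_mul_norm_le (SchwartzMap.derivCLM ℝ ℂ m) 0
  obtain ⟨C₂, hC₂, h2⟩ := exists_abs_pow_mul_norm_le m 1
  have hlip : ∀ x, ‖m x‖ ≤ C₁ * |x| := by
    intro x
    have := (convex_univ (𝕜 := ℝ) (E := ℝ)).norm_image_sub_le_of_norm_deriv_le
      (f := m) (C := C₁) (x := 0) (y := x) (fun z _ => m.differentiableAt) (fun z _ => by
        have := h1 z
        rwa [pow_zero, one_mul, SchwartzMap.derivCLM_apply] at this) trivial trivial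
    rwa [hm, sub_zero, sub_zero] at this
  refine ⟨((C₁ + C₂) * C₀).toNNReal, fun F ξ => ?_⟩
  rw [Real.coe_toNNReal _ (by positivity)]
  by_cases hξ : ξ = 0
  · simp only [hξ, dil_apply, mul_zero, hm, norm_zero, Finset.sum_const_zero]
    positivity
  have hξ' : 0 < |ξ| := abs_pos.2 hξ
  have hterm : ∀ k, ‖dil m k ξ‖ ≤ (C₁ + C₂) *
      min ((2 : ℝ) ^ k * |ξ|⁻¹) ((2 : ℝ) ^ k * |ξ|⁻¹)⁻¹ := by
    intro k
    have h2k : (0 : ℝ) < 2 ^ k := by positivity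
    have habs : |(2 : ℝ) ^ (-k) * ξ| = ((2 : ℝ) ^ k * |ξ|⁻¹)⁻¹ := by
      rw [abs_mul, abs_of_pos (by positivity), zpow_neg, mul_inv, inv_inv]
    rw [dil_apply, min_comm]
    have h4 := hlip ((2 : ℝ) ^ (-k) * ξ)
    have h5 := h2 ((2 : ℝ) ^ (-k) * ξ)
    rw [pow_one] at h5
    rw [habs] at h4 h5
    have := le_mul_min_of_le (a := ((2 : ℝ) ^ k * |ξ|⁻¹)⁻¹) (by positivity) hC₁ hC₂ h4 h5
    rwa [inv_inv] at this
  calc _ ≤ ∑ k ∈ F, (C₁ + C₂) * min ((2 : ℝ) ^ k * |ξ|⁻¹) ((2 : ℝ) ^ k * |ξ|⁻¹)⁻¹ :=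
        Finset.sum_le_sum fun k _ => hterm k
    _ ≤ _ := by
        rw [← Finset.mul_sum]
        gcongr
        exact hsum F _ (by positivity)

/-- By scaling, each term is y²|η(±y)| with y = 2^k |x| and η Schwartz; the first and third weighted
bounds on η make it O(min(y, 1/y)). -/
lemma exists_kernel_bound (m : 𝓢(ℝ, ℂ)) : ∃ D : ℝ≥0, ∀ (F : Finset ℤ) (x : ℝ),
    ∑ k ∈ F, x ^ 2 * ‖deriv (lpKer m k) x‖ ≤ D := by
  obtain ⟨C₀, hC₀, hsum⟩ := exists_sum_min_le
  set η := SchwartzMap.derivCLM ℝ ℂ (𝓕⁻ m : 𝓢(ℝ, ℂ)) with hη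
  obtain ⟨C₁, hC₁, h1⟩ := exists_abs_pow_mul_norm_le η 1
  obtain ⟨C₂, hC₂, h2⟩ := exists_abs_pow_mul_norm_le η 3
  refine ⟨((C₁ + C₂) * C₀).toNNReal, fun F x => ?_⟩
  rw [Real.coe_toNNReal _ (by positivity)]
  by_cases hx : x = 0
  · simp only [hx, ne_eq, OfNat.ofNat_ne_zero, not_false_eq_true, zero_pow, zero_mul,
      Finset.sum_const_zero]
    positivity
  have hx' : 0 < |x| := abs_pos.2 hx
  have hterm : ∀ k, x ^ 2 * ‖deriv (lpKer m k) x‖ ≤ (C₁ + C₂) *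
      min ((2 : ℝ) ^ k * |x|) ((2 : ℝ) ^ k * |x|)⁻¹ := by
    intro k
    have h2k : (0 : ℝ) < 2 ^ k := by positivity
    have habs : |(2 : ℝ) ^ k * x| = (2 : ℝ) ^ k * |x| := by
      rw [abs_mul, abs_of_pos h2k]
    have e : x ^ 2 * ‖deriv (lpKer m k) x‖ = ((2 : ℝ) ^ k * |x|) ^ 2 * ‖η ((2 : ℝ) ^ k * x)‖ := by
      rw [deriv_lpKer, hη, SchwartzMap.derivCLM_apply, norm_mul, norm_mul, norm_zpow,
        Complex.norm_ofNat, ← sq_abs]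
      ring
    rw [e]
    have h4 := h1 ((2 : ℝ) ^ k * x)
    have h5 := h2 ((2 : ℝ) ^ k * x)
    rw [habs] at h4 h5
    have ht : 0 < (2 : ℝ) ^ k * |x| := by positivity
    refine le_mul_min_of_le ht hC₁ hC₂ ?_ ?_
    · rw [pow_one] at h4
      nlinarith
    · rw [← mul_assoc, ← pow_succ']; exact h5
  calc _ ≤ ∑ k ∈ F, (C₁ + C₂) * min ((2 : ℝ) ^ k * |x|) ((2 : ℝ) ^ k * |x|)⁻¹ :=
        Finset.sum_le_sum fun k _ => hterm k
    _ ≤ _ := by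
        rw [← Finset.mul_sum]
        gcongr
        exact hsum F _ hx'

/-- The kernel of a signed sum of frequency localizations. -/
def signedKer (m : 𝓢(ℝ, ℂ)) (F S : Finset ℤ) : 𝓢(ℝ, ℂ) := ∑ k ∈ F, sgn S k • lpKer m k

lemma signedKer_apply (m : 𝓢(ℝ, ℂ)) (F S : Finset ℤ) (x : ℝ) :
    signedKer m F S x = ∑ k ∈ F, sgn S k * lpKer m k x := by
  simp [signedKer, sum_apply]

lemma fourier_signedKer (m : 𝓢(ℝ, ℂ)) (F S : Finset ℤ) (ξ : ℝ) :
    𝓕 (signedKer m F S) ξ = ∑ k ∈ F, sgn S k * dil m k ξ := by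
  have : 𝓕 (signedKer m F S) = ∑ k ∈ F, sgn S k • dil m k := by
    rw [signedKer, ← FourierTransform.fourierCLM_apply (R := ℂ), map_sum]
    simp [lpKer]
  rw [this]
  simp [sum_apply]

lemma convol_signedKer (m : 𝓢(ℝ, ℂ)) (F S : Finset ℤ) {p : ℝ≥0∞} (hp : 1 ≤ p) {f : ℝ → ℂ}
    (hf : MemLp f p) (x : ℝ) :
    convol (signedKer m F S) f x = ∑ k ∈ F, sgn S k * convol (lpKer m k) f x := by
  simp only [convol, signedKer_apply, Finset.mul_sum]
  rw [integral_finsetSum]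
  · refine Finset.sum_congr rfl fun k _ => ?_
    rw [← integral_const_mul]
    refine integral_congr_ae (Eventually.of_forall fun y => ?_)
    simp only; ring
  · intro k _
    refine ((integrable_mul_comp_sub (lpKer m k) hp hf x).const_mul (sgn S k)).congr
      (Eventually.of_forall fun y => ?_)
    simp only; ring

/-- The two preceding bounds hold for sums of absolute values, so signs do not matter and a single
Calderón-Zygmund constant serves all signed sums. -/
lemma exists_signedKer_bounds (m : 𝓢(ℝ, ℂ)) (hm : m 0 = 0) : ∃ B D : ℝ≥0, ∀ F S : Finset ℤ,
    (∀ ξ, ‖𝓕 (signedKer m F S) ξ‖ ≤ B) ∧ ∀ x, x ^ 2 * ‖deriv (signedKer m F S) x‖ ≤ D := by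
  obtain ⟨B, hB⟩ := exists_multiplier_bound m hm
  obtain ⟨D, hD⟩ := exists_kernel_bound m
  refine ⟨B, D, fun F S => ⟨fun ξ => ?_, fun x => ?_⟩⟩
  · rw [fourier_signedKer]
    refine (norm_sum_le _ _).trans (le_trans (le_of_eq ?_) (hB F ξ))
    refine Finset.sum_congr rfl fun k _ => ?_
    rw [norm_mul, norm_sgn, one_mul]
  · have e : (signedKer m F S : ℝ → ℂ) = fun x => ∑ k ∈ F, sgn S k * lpKer m k x :=
      funext (signedKer_apply m F S)
    rw [e, deriv_fun_sum fun k _ => ((lpKer m k).differentiableAt).const_mul _]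
    refine le_trans ?_ (hD F x)
    rw [← Finset.mul_sum]
    gcongr
    refine (norm_sum_le _ _).trans (le_of_eq (Finset.sum_congr rfl fun k _ => ?_))
    rw [deriv_const_mul_field, norm_mul, norm_sgn, one_mul]

/-- Khintchine at each point replaces the square function by an average over signs of signed
convolutions, each bounded on L^p with one constant. Independence of `F` permits the passage to all
k. -/
lemma exists_lintegral_finset_square_le (m : 𝓢(ℝ, ℂ)) (hm : m 0 = 0) {p : ℝ≥0∞} (hp : 1 < p)
    (hp' : p < ⊤) : ∃ C : ℝ≥0, ∀ (F : Finset ℤ) (f : ℝ → ℂ), MemLp f p →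
      ∫⁻ x, (∑ k ∈ F, ‖convol (lpKer m k) f x‖ₑ ^ 2) ^ (p.toReal / 2) ≤
        C * ∫⁻ x, ‖f x‖ₑ ^ p.toReal := by
  have hp0 : p ≠ 0 := (zero_lt_one.trans hp).ne'
  have hr : 0 < p.toReal := ENNReal.toReal_pos hp0 hp'.ne
  obtain ⟨B, D, hBD⟩ := exists_signedKer_bounds m hm
  obtain ⟨A, hA⟩ := exists_eLpNorm_convol_le hp hp' B D
  obtain ⟨C, hC0, hC⟩ := exists_khintchine hr
  set r := p.toReal with hrdef
  refine ⟨(ENNReal.ofReal C * (A : ℝ≥0∞) ^ r).toNNReal, fun F f hf => ?_⟩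
  rw [ENNReal.coe_toNNReal (ENNReal.mul_ne_top ENNReal.ofReal_ne_top
    (ENNReal.rpow_lt_top_of_nonneg hr.le ENNReal.coe_ne_top).ne)]
  have hpt : ∀ x, (∑ k ∈ F, ‖convol (lpKer m k) f x‖ₑ ^ 2) ^ (r / 2) ≤
      ENNReal.ofReal C * ((2 ^ F.card)⁻¹ *
        ∑ S ∈ F.powerset, ‖convol (signedKer m F S) f x‖ₑ ^ r) := by
    intro x
    have h := ENNReal.ofReal_le_ofReal (hC F fun k => convol (lpKer m k) f x)
    rw [ENNReal.ofReal_mul hC0, ENNReal.ofReal_mul (by positivity),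
      ENNReal.ofReal_inv_of_pos (by positivity), ENNReal.ofReal_pow (by norm_num),
      ENNReal.ofReal_sum_of_nonneg (fun S _ => by positivity),
      ← ENNReal.ofReal_rpow_of_nonneg (by positivity) (by positivity),
      ENNReal.ofReal_sum_of_nonneg (fun S _ => by positivity), ENNReal.ofReal_ofNat] at h
    simp only [convol_signedKer m F _ hp.le hf x]
    refine le_trans (le_of_eq ?_) (h.trans (le_of_eq ?_))
    · congr 1
      refine Finset.sum_congr rfl fun k _ => ?_
      rw [ENNReal.ofReal_pow (norm_nonneg _), ofReal_norm]
    · congr 2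
      refine Finset.sum_congr rfl fun S _ => ?_
      rw [← ENNReal.ofReal_rpow_of_nonneg (norm_nonneg _) hr.le, ofReal_norm]
  have hS : ∀ S, ∫⁻ x, ‖convol (signedKer m F S) f x‖ₑ ^ r ≤ (A : ℝ≥0∞) ^ r *
      ∫⁻ x, ‖f x‖ₑ ^ r := by
    intro S
    have h := hA (signedKer m F S) (hBD F S).1 (hBD F S).2 f hf
    rw [eLpNorm_eq_lintegral_rpow_enorm_toReal hp0 hp'.ne,
      eLpNorm_eq_lintegral_rpow_enorm_toReal hp0 hp'.ne, ← hrdef] at h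
    have h2 := ENNReal.rpow_le_rpow h hr.le
    rwa [ENNReal.mul_rpow_of_nonneg _ _ hr.le, ← ENNReal.rpow_mul, ← ENNReal.rpow_mul,
      one_div_mul_cancel hr.ne', ENNReal.rpow_one, ENNReal.rpow_one] at h2
  have hmeas : ∀ S, AEMeasurable fun x => ‖convol (signedKer m F S) f x‖ₑ ^ r := fun S =>
    (aestronglyMeasurable_convol (signedKer m F S).continuous hf.1).enorm.pow_const r
  calc _ ≤ ∫⁻ x, ENNReal.ofReal C * ((2 ^ F.card)⁻¹ *
        ∑ S ∈ F.powerset, ‖convol (signedKer m F S) f x‖ₑ ^ r) := lintegral_mono hpt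
    _ = ENNReal.ofReal C * ((2 ^ F.card)⁻¹ *
        ∑ S ∈ F.powerset, ∫⁻ x, ‖convol (signedKer m F S) f x‖ₑ ^ r) := by
        rw [lintegral_const_mul' _ _ ENNReal.ofReal_ne_top, lintegral_const_mul' _ _ (by simp),
          lintegral_finsetSum' _ fun S _ => hmeas S]
    _ ≤ ENNReal.ofReal C * ((2 ^ F.card)⁻¹ *
        ∑ S ∈ F.powerset, (A : ℝ≥0∞) ^ r * ∫⁻ x, ‖f x‖ₑ ^ r) := by
        gcongr with S _
        exact hS S
    _ = _ := by
        rw [Finset.sum_const, Finset.card_powerset, nsmul_eq_mul, ← mul_assoc ((2 ^ F.card)⁻¹)]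
        push_cast
        rw [ENNReal.inv_mul_cancel (by simp) (by simp), one_mul, mul_assoc]

/-- The upper Littlewood-Paley inequality on the line. -/
theorem exists_lintegral_square_le (m : 𝓢(ℝ, ℂ)) (hm : m 0 = 0) {p : ℝ≥0∞} (hp : 1 < p)
    (hp' : p < ⊤) : ∃ C : ℝ≥0, ∀ f : ℝ → ℂ, MemLp f p →
      ∫⁻ x, (∑' k : ℤ, ‖convol (lpKer m k) f x‖ₑ ^ 2) ^ (p.toReal / 2) ≤
        C * ∫⁻ x, ‖f x‖ₑ ^ p.toReal := by
  obtain ⟨C, hC⟩ := exists_lintegral_finset_square_le m hm hp hp'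
  refine ⟨C, fun f hf => ?_⟩
  have hlim : ∀ x, Tendsto (fun n : ℕ => (∑ k ∈ Finset.Icc (-n : ℤ) n,
      ‖convol (lpKer m k) f x‖ₑ ^ 2) ^ (p.toReal / 2)) atTop
      (𝓝 ((∑' k : ℤ, ‖convol (lpKer m k) f x‖ₑ ^ 2) ^ (p.toReal / 2))) := fun x =>
    (ENNReal.continuous_rpow_const.tendsto _).comp
      ((ENNReal.summable.hasSum (f := fun k : ℤ => ‖convol (lpKer m k) f x‖ₑ ^ 2)).comp
        Finset.tendsto_Icc_neg)
  have hmeas : ∀ n : ℕ, AEMeasurable fun x => (∑ k ∈ Finset.Icc (-n : ℤ) n,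
      ‖convol (lpKer m k) f x‖ₑ ^ 2) ^ (p.toReal / 2) := fun n =>
    (Finset.aemeasurable_fun_sum _ fun k _ =>
      (aestronglyMeasurable_convol (lpKer m k).continuous hf.1).enorm.pow_const 2).pow_const _
  calc _ = ∫⁻ x, liminf (fun n : ℕ => (∑ k ∈ Finset.Icc (-n : ℤ) n,
        ‖convol (lpKer m k) f x‖ₑ ^ 2) ^ (p.toReal / 2)) atTop :=
        lintegral_congr fun x => (hlim x).liminf_eq.symm
    _ ≤ liminf (fun n : ℕ => ∫⁻ x, (∑ k ∈ Finset.Icc (-n : ℤ) n,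
        ‖convol (lpKer m k) f x‖ₑ ^ 2) ^ (p.toReal / 2)) atTop := lintegral_liminf_le' hmeas
    _ ≤ liminf (fun _ : ℕ => C * ∫⁻ x, ‖f x‖ₑ ^ p.toReal) atTop :=
        liminf_le_liminf (Eventually.of_forall fun n => hC _ f hf)
    _ = _ := by simp

end AdaptedLP

end

/-! ### The lower square function bound and cut-offs -/

noncomputable section

namespace AdaptedLP

open scoped SchwartzMap

/-- The square function on the line with multiplier `m`. -/
def lineSquare (m : 𝓢(ℝ, ℂ)) (f : ℝ → ℂ) (x : ℝ) : ℝ≥0∞ :=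
  (∑' k : ℤ, ‖convol (lpKer m k) f x‖ₑ ^ 2) ^ (1 / 2 : ℝ)

lemma aemeasurable_lineSquare (m : 𝓢(ℝ, ℂ)) {f : ℝ → ℂ} (hf : AEStronglyMeasurable f) :
    AEMeasurable (lineSquare m f) :=
  (AEMeasurable.tsum fun k =>
    (aestronglyMeasurable_convol (lpKer m k).continuous hf).enorm.pow_const 2).pow_const _

lemma exists_eLpNorm_lineSquare_le (m : 𝓢(ℝ, ℂ)) (hm : m 0 = 0) {p : ℝ≥0∞} (hp : 1 < p)
    (hp' : p < ⊤) : ∃ C : ℝ≥0, ∀ f : ℝ → ℂ, MemLp f p →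
      eLpNorm (lineSquare m f) p ≤ C * eLpNorm f p := by
  have hp0 : p ≠ 0 := (zero_lt_one.trans hp).ne'
  have hr : 0 < p.toReal := ENNReal.toReal_pos hp0 hp'.ne
  obtain ⟨C, hC⟩ := exists_lintegral_square_le m hm hp hp'
  have hCt : (C : ℝ≥0∞) ^ (1 / p.toReal) ≠ ⊤ :=
    (ENNReal.rpow_lt_top_of_nonneg (by positivity) ENNReal.coe_ne_top).ne
  refine ⟨((C : ℝ≥0∞) ^ (1 / p.toReal)).toNNReal, fun f hf => ?_⟩
  rw [ENNReal.coe_toNNReal hCt, eLpNorm_eq_lintegral_rpow_enorm_toReal hp0 hp'.ne,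
    eLpNorm_eq_lintegral_rpow_enorm_toReal hp0 hp'.ne,
    ← ENNReal.mul_rpow_of_nonneg _ _ (by positivity)]
  refine ENNReal.rpow_le_rpow ((le_of_eq (lintegral_congr fun x => ?_)).trans (hC f hf))
    (by positivity)
  rw [enorm_eq_self, lineSquare, ← ENNReal.rpow_mul]
  congr 1; ring

lemma sum_mul_le_sqrt_mul_sqrt (F : Finset ℤ) (a b : ℤ → ℝ≥0∞) :
    ∑ k ∈ F, a k * b k ≤
      (∑' k, a k ^ 2) ^ (1 / 2 : ℝ) * (∑' k, b k ^ 2) ^ (1 / 2 : ℝ) := by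
  have h := ENNReal.inner_le_Lp_mul_Lq F a b Real.HolderConjugate.two_two
  simp only [ENNReal.rpow_ofNat] at h
  refine h.trans ?_
  gcongr <;> exact ENNReal.sum_le_tsum F

/-- A crude constant suffices: this serves only to pass from test functions to L^p in the lower
bound. -/
lemma lineSquare_add_le (m : 𝓢(ℝ, ℂ)) {p : ℝ≥0∞} (hp : 1 ≤ p) {f g : ℝ → ℂ} (hf : MemLp f p)
    (hg : MemLp g p) (x : ℝ) :
    lineSquare m (f + g) x ≤ 2 * (lineSquare m f x + lineSquare m g x) := by
  unfold lineSquare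
  set X := ∑' k : ℤ, ‖convol (lpKer m k) f x‖ₑ ^ 2
  set Y := ∑' k : ℤ, ‖convol (lpKer m k) g x‖ₑ ^ 2
  have h1 : ∑' k : ℤ, ‖convol (lpKer m k) (f + g) x‖ₑ ^ 2 ≤ 4 * (X + Y) := by
    rw [← ENNReal.tsum_add, ← ENNReal.tsum_mul_left]
    refine ENNReal.tsum_le_tsum fun k => ?_
    rw [convol_add _ hp hp hf hg]
    set a := ‖convol (lpKer m k) f x‖ₑ
    set b := ‖convol (lpKer m k) g x‖ₑ
    calc _ ≤ (a + b) ^ 2 := pow_le_pow_left' (enorm_add_le _ _) 2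
      _ ≤ (2 * max a b) ^ 2 := by
          refine pow_le_pow_left' ?_ 2
          rw [two_mul]
          exact add_le_add (le_max_left _ _) (le_max_right _ _)
      _ = 4 * max a b ^ 2 := by rw [mul_pow]; norm_num
      _ ≤ 4 * (a ^ 2 + b ^ 2) := by
          gcongr
          rcases le_total a b with h | h
          · rw [max_eq_right h]; exact le_add_self
          · rw [max_eq_left h]; exact le_self_add
  refine (ENNReal.rpow_le_rpow h1 (by norm_num)).trans ?_
  rw [ENNReal.mul_rpow_of_nonneg _ _ (by norm_num)]
  have h4 : (4 : ℝ≥0∞) ^ (1 / 2 : ℝ) = 2 := by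
    rw [show (4 : ℝ≥0∞) = 2 ^ (2 : ℝ) by norm_num, ← ENNReal.rpow_mul]; norm_num
  rw [h4]
  gcongr
  exact ENNReal.rpow_add_le_add_rpow _ _ (by norm_num) (by norm_num)

/-- The product of two Schwartz functions. -/
def smul' (m f : 𝓢(ℝ, ℂ)) : 𝓢(ℝ, ℂ) := SchwartzMap.pairing (ContinuousLinearMap.mul ℂ ℂ) m f

lemma smul'_apply (m f : 𝓢(ℝ, ℂ)) (x : ℝ) : smul' m f x = m x * f x :=
  SchwartzMap.pairing_apply_apply _ _ _ _

lemma convol_lpKer_eq (m f : 𝓢(ℝ, ℂ)) (k : ℤ) (x : ℝ) :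
    convol (lpKer m k) f x = (𝓕⁻ (smul' (dil m k) (𝓕 f)) : 𝓢(ℝ, ℂ)) x := by
  rw [convol_schwartz]
  congr 1
  have h : 𝓕 (SchwartzMap.convolution (ContinuousLinearMap.mul ℂ ℂ) f (lpKer m k)) =
      smul' (dil m k) (𝓕 f) := by
    ext ξ
    rw [fourier_convol, smul'_apply, mul_comm, lpKer, FourierTransform.fourier_fourierInv_eq]
  rw [← h, FourierTransform.fourierInv_fourier_eq]

lemma fourierInv_apply_eq_fourier_neg (f : 𝓢(ℝ, ℂ)) (x : ℝ) :
    (𝓕⁻ f : 𝓢(ℝ, ℂ)) x = (𝓕 f : 𝓢(ℝ, ℂ)) (-x) := by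
  rw [SchwartzMap.fourierInv_coe, SchwartzMap.fourier_coe]
  exact Real.fourierInv_eq_fourier_neg _ _

lemma dil_reflect (m : 𝓢(ℝ, ℂ)) (k : ℤ) (x : ℝ) : dil (reflect m) k x = dil m k (-x) := by
  rw [dil_apply, dil_apply, reflect_apply, mul_neg]

/-- Parseval's identity for a pair of frequency localizations. -/
lemma integral_lp_mul_lp (ψ Ψ f g : 𝓢(ℝ, ℂ)) (hΨ : ∀ ξ, Ψ ξ * ψ ξ = ψ ξ) (k : ℤ) :
    ∫ x, convol (lpKer ψ k) f x * convol (lpKer (reflect Ψ) k) g x =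
      ∫ ξ, dil ψ k ξ * ((𝓕 f : 𝓢(ℝ, ℂ)) ξ * (𝓕⁻ g : 𝓢(ℝ, ℂ)) ξ) := by
  simp only [convol_lpKer_eq]
  -- The pairing is bilinear, so frequency ξ of one factor meets -ξ of the other. Reflecting Ψ
  -- evaluates both multipliers at the same point, where Ψψ = ψ.
  rw [SchwartzMap.integral_fourierInv_mul_eq]
  refine integral_congr_ae (Eventually.of_forall fun ξ => ?_)
  simp only
  rw [fourierInv_apply_eq_fourier_neg (𝓕⁻ (smul' (dil (reflect Ψ) k) (𝓕 g))),
    FourierTransform.fourier_fourierInv_eq, smul'_apply, smul'_apply, dil_reflect, neg_neg,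
    fourierInv_apply_eq_fourier_neg g, dil_apply, dil_apply]
  have := hΨ ((2 : ℝ) ^ (-k) * ξ)
  linear_combination (𝓕 f : 𝓢(ℝ, ℂ)) ξ * (𝓕 g : 𝓢(ℝ, ℂ)) (-ξ) * this

/-- The Calderón reproducing formula, in weak form. -/
lemma tendsto_sum_integral_lp_mul_lp (ψ Ψ f g : 𝓢(ℝ, ℂ)) (hψ0 : ψ 0 = 0)
    (hψ : ∀ ξ : ℝ, ξ ≠ 0 → HasSum (fun k : ℤ => ψ ((2 : ℝ) ^ (-k) * ξ)) 1)
    (hΨ : ∀ ξ, Ψ ξ * ψ ξ = ψ ξ) :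
    Tendsto (fun n : ℕ => ∑ k ∈ Finset.Icc (-n : ℤ) n,
      ∫ x, convol (lpKer ψ k) f x * convol (lpKer (reflect Ψ) k) g x) atTop
      (𝓝 (∫ x, f x * g x)) := by
  obtain ⟨B, hB⟩ := exists_multiplier_bound ψ hψ0
  set w : ℝ → ℂ := fun ξ => (𝓕 f : 𝓢(ℝ, ℂ)) ξ * (𝓕⁻ g : 𝓢(ℝ, ℂ)) ξ with hw
  have hwi : Integrable w := by
    have := (smul' (𝓕 f) (𝓕⁻ g)).integrable (μ := volume)
    refine this.congr (Eventually.of_forall fun ξ => ?_)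
    rw [smul'_apply]
  have hlim : ∫ x, f x * g x = ∫ ξ, w ξ := by
    rw [hw, SchwartzMap.integral_fourier_mul_eq, FourierTransform.fourier_fourierInv_eq]
  have hm : ∀ k, AEStronglyMeasurable (fun ξ => dil ψ k ξ) (volume : Measure ℝ) := fun k =>
    (dil ψ k).continuous.aestronglyMeasurable
  have hint : ∀ k, Integrable (fun ξ => dil ψ k ξ * w ξ) := fun k => by
    refine hwi.bdd_mul (c := B) (hm k) (Eventually.of_forall fun ξ => ?_)
    simpa using hB {k} ξ
  simp only [integral_lp_mul_lp ψ Ψ f g hΨ]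
  rw [hlim]
  have e : ∀ n : ℕ, ∑ k ∈ Finset.Icc (-n : ℤ) n, ∫ ξ, dil ψ k ξ * w ξ =
      ∫ ξ, (∑ k ∈ Finset.Icc (-n : ℤ) n, dil ψ k ξ) * w ξ := by
    intro n
    simp only [Finset.sum_mul]
    rw [integral_finsetSum _ fun k _ => hint k]
  simp only [hw] at e ⊢
  simp only [e]
  refine tendsto_integral_of_dominated_convergence (fun ξ => B * ‖w ξ‖) (fun n => ?_)
    (hwi.norm.const_mul _) (fun n => Eventually.of_forall fun ξ => ?_) ?_
  · refine AEStronglyMeasurable.mul ?_ hwi.1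
    exact Finset.aestronglyMeasurable_fun_sum _ fun k _ => hm k
  · rw [norm_mul]
    exact mul_le_mul_of_nonneg_right ((norm_sum_le _ _).trans (hB _ ξ)) (norm_nonneg _)
  · have h0 : ∀ᵐ ξ : ℝ, ξ ≠ 0 := by simp [ae_iff]
    filter_upwards [h0] with ξ hξ
    have h1 : Tendsto (fun n : ℕ => ∑ k ∈ Finset.Icc (-n : ℤ) n, dil ψ k ξ) atTop (𝓝 1) := by
      simp only [dil_apply]
      exact (hψ ξ hξ).comp Finset.tendsto_Icc_neg
    simpa using h1.mul_const (w ξ)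

/-- The reproducing formula, followed by Cauchy-Schwarz in k and Hölder in x. -/
lemma enorm_integral_mul_le_square (ψ Ψ f g : 𝓢(ℝ, ℂ)) (hψ0 : ψ 0 = 0)
    (hψ : ∀ ξ : ℝ, ξ ≠ 0 → HasSum (fun k : ℤ => ψ ((2 : ℝ) ^ (-k) * ξ)) 1)
    (hΨ : ∀ ξ, Ψ ξ * ψ ξ = ψ ξ) {p q : ℝ≥0∞} (hp : 1 < p) (hp' : p < ⊤)
    [p.HolderConjugate q] :
    ‖∫ x, f x * g x‖ₑ ≤
      eLpNorm (lineSquare ψ f) p * eLpNorm (lineSquare (reflect Ψ) g) q := by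
  refine le_of_tendsto (tendsto_sum_integral_lp_mul_lp ψ Ψ f g hψ0 hψ hΨ).enorm
    (Eventually.of_forall fun n => ?_)
  have hm1 : ∀ (m f : 𝓢(ℝ, ℂ)) k, AEMeasurable fun x => ‖convol (lpKer m k) f x‖ₑ :=
    fun m f k => (aestronglyMeasurable_convol (lpKer m k).continuous
      f.continuous.aestronglyMeasurable).enorm
  have hsq : ∀ (m f : 𝓢(ℝ, ℂ)), AEStronglyMeasurable (lineSquare m f) := fun m f =>
    (aemeasurable_lineSquare m f.continuous.aestronglyMeasurable).aestronglyMeasurable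
  calc ‖∑ k ∈ Finset.Icc (-n : ℤ) n,
        ∫ x, convol (lpKer ψ k) f x * convol (lpKer (reflect Ψ) k) g x‖ₑ
      ≤ ∑ k ∈ Finset.Icc (-n : ℤ) n,
        ∫⁻ x, ‖convol (lpKer ψ k) f x‖ₑ * ‖convol (lpKer (reflect Ψ) k) g x‖ₑ := by
        refine (enorm_sum_le _ _).trans (Finset.sum_le_sum fun k _ => ?_)
        refine (enorm_integral_le_lintegral_enorm _).trans (le_of_eq ?_)
        simp only [enorm_mul]
    _ = ∫⁻ x, ∑ k ∈ Finset.Icc (-n : ℤ) n,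
        ‖convol (lpKer ψ k) f x‖ₑ * ‖convol (lpKer (reflect Ψ) k) g x‖ₑ := by
        exact (lintegral_finsetSum' _ fun k _ => (hm1 ψ f k).mul (hm1 (reflect Ψ) g k)).symm
    _ ≤ ∫⁻ x, lineSquare ψ f x * lineSquare (reflect Ψ) g x :=
        lintegral_mono fun x => sum_mul_le_sqrt_mul_sqrt _ _ _
    _ ≤ _ := by
        have hq' : q ≠ ⊤ := ((ENNReal.HolderConjugate.lt_top_iff_one_lt q p).2 hp).ne
        have := ENNReal.lintegral_mul_le_Lp_mul_Lq (volume : Measure ℝ)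
          (ENNReal.HolderConjugate.toReal_of_ne_top hp'.ne hq')
          (hsq ψ f).aemeasurable (hsq (reflect Ψ) g).aemeasurable
        rw [eLpNorm_eq_lintegral_rpow_enorm_toReal (ENNReal.HolderConjugate.ne_zero p q) hp'.ne,
          eLpNorm_eq_lintegral_rpow_enorm_toReal (ENNReal.HolderConjugate.ne_zero q p) hq']
        exact this

lemma eLpNorm_lineSquare_add_le (m : 𝓢(ℝ, ℂ)) {p : ℝ≥0∞} (hp : 1 ≤ p) {f g : ℝ → ℂ}
    (hf : MemLp f p) (hg : MemLp g p) :
    eLpNorm (lineSquare m (f + g)) p volume ≤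
      2 * (eLpNorm (lineSquare m f) p volume + eLpNorm (lineSquare m g) p volume) := by
  have hm1 := (aemeasurable_lineSquare m hf.1).aestronglyMeasurable
  have hm2 := (aemeasurable_lineSquare m hg.1).aestronglyMeasurable
  have h1 : eLpNorm (lineSquare m (f + g)) p volume ≤
      2 * eLpNorm (lineSquare m f + lineSquare m g) p volume :=
    eLpNorm_le_mul_eLpNorm_of_ae_le_mul'' p (c := 2) (hm1.add hm2)
      (Eventually.of_forall fun x => lineSquare_add_le m hp hf hg x)
  exact h1.trans (mul_le_mul' le_rfl (eLpNorm_add_le hm1 hm2 hp))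

/-- Duality: the second square function in `enorm_integral_mul_le_square` is bounded on L^q by the
upper inequality. Since that pairing requires Schwartz functions, a general `g` in L^q is
approximated by test functions. -/
lemma exists_le_eLpNorm_lineSquare_of_smooth (ψ Ψ : 𝓢(ℝ, ℂ)) (hψ0 : ψ 0 = 0) (hΨ0 : Ψ 0 = 0)
    (hψ : ∀ ξ : ℝ, ξ ≠ 0 → HasSum (fun k : ℤ => ψ ((2 : ℝ) ^ (-k) * ξ)) 1)
    (hΨ : ∀ ξ, Ψ ξ * ψ ξ = ψ ξ) {p : ℝ≥0∞} (hp : 1 < p) (hp' : p < ⊤) :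
    ∃ C : ℝ≥0, ∀ f : ℝ → ℂ, HasCompactSupport f → ContDiff ℝ ∞ f →
      eLpNorm f p ≤ C * eLpNorm (lineSquare ψ f) p := by
  set q := p.conjExponent
  have hpq : p.HolderConjugate q := ENNReal.HolderConjugate.conjExponent hp.le
  have hq : 1 < q := (ENNReal.HolderConjugate.lt_top_iff_one_lt p q).1 hp'
  have hq' : q < ⊤ := (ENNReal.HolderConjugate.lt_top_iff_one_lt q p).2 hp
  obtain ⟨C, hC⟩ := exists_eLpNorm_lineSquare_le (reflect Ψ) (by simpa using hΨ0) hq hq'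
  obtain ⟨C', hC'⟩ := exists_eLpNorm_lineSquare_le ψ hψ0 hp hp'
  refine ⟨C, fun f hf1 hf2 => ?_⟩
  have hf : MemLp f p := memLp_of_smooth hf1 hf2 p
  have hSt : eLpNorm (lineSquare ψ f) p ≠ ⊤ :=
    ((hC' f hf).trans_lt (ENNReal.mul_lt_top ENNReal.coe_lt_top hf.2)).ne
  refine eLpNorm_le_of_forall_integral (q := q) hp hp' hf fun g hg => ?_
  obtain ⟨G, hG, hlim⟩ := exists_seq_smooth_tendsto hq.le hq'.ne hg
  have hGm : ∀ n, MemLp (G n) q := fun n => memLp_of_smooth (hG n).1 (hG n).2 q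
  set A := C * eLpNorm (lineSquare ψ f) p with hA
  have hAt : A ≠ ⊤ := ENNReal.mul_ne_top ENNReal.coe_ne_top hSt
  have hn : ∀ n, ‖∫ x, f x * g x‖ₑ ≤ A * (eLpNorm g q + eLpNorm (g - G n) q) +
      eLpNorm f p * eLpNorm (g - G n) q := by
    intro n
    have e : ∫ x, f x * g x = (∫ x, f x * G n x) + ∫ x, f x * (g - G n) x := by
      have i1 : Integrable fun x => f x * G n x := hf.integrable_mul (hGm n)
      have i2 : Integrable fun x => f x * (g - G n) x := hf.integrable_mul (hg.sub (hGm n))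
      rw [← integral_add i1 i2]
      refine integral_congr_ae (Eventually.of_forall fun x => ?_)
      simp only [Pi.sub_apply]; ring
    have h1 : ‖∫ x, f x * G n x‖ₑ ≤ A * eLpNorm (G n) q := by
      have h2 := enorm_integral_mul_le_square ψ Ψ (hf1.toSchwartzMap hf2)
        ((hG n).1.toSchwartzMap (hG n).2) hψ0 hψ hΨ (p := p) (q := q) hp hp'
      have h3 := hC (G n) (hGm n)
      refine h2.trans ((mul_le_mul' le_rfl h3).trans (le_of_eq ?_))
      rw [hA, ← mul_assoc, mul_comm _ (C : ℝ≥0∞)]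
      rfl
    have h4 : eLpNorm (G n) q ≤ eLpNorm g q + eLpNorm (g - G n) q := by
      have e := eLpNorm_sub_le (μ := volume) (p := q) hg.1 (hg.1.sub (hGm n).1) hq.le
      have e2 : g - (g - G n) = G n := sub_sub_cancel _ _
      rw [e2] at e
      exact e
    rw [e]
    refine (enorm_add_le _ _).trans (add_le_add (h1.trans (mul_le_mul' le_rfl h4)) ?_)
    exact holder_integral_mul hf.1 (hg.1.sub (hGm n).1)
  have hl : Tendsto (fun n => A * (eLpNorm g q + eLpNorm (g - G n) q) +
      eLpNorm f p * eLpNorm (g - G n) q) atTop (𝓝 (A * (eLpNorm g q + 0) + eLpNorm f p * 0)) :=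
    (ENNReal.Tendsto.const_mul (hlim.const_add _) (Or.inr hAt)).add
      (ENNReal.Tendsto.const_mul hlim (Or.inr hf.2.ne))
  rw [add_zero, mul_zero, add_zero] at hl
  exact ge_of_tendsto hl (Eventually.of_forall hn)

/-- The lower Littlewood-Paley inequality on the line. -/
theorem exists_le_eLpNorm_lineSquare (ψ Ψ : 𝓢(ℝ, ℂ)) (hψ0 : ψ 0 = 0) (hΨ0 : Ψ 0 = 0)
    (hψ : ∀ ξ : ℝ, ξ ≠ 0 → HasSum (fun k : ℤ => ψ ((2 : ℝ) ^ (-k) * ξ)) 1)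
    (hΨ : ∀ ξ, Ψ ξ * ψ ξ = ψ ξ) {p : ℝ≥0∞} (hp : 1 < p) (hp' : p < ⊤) :
    ∃ C : ℝ≥0, ∀ f : ℝ → ℂ, MemLp f p → eLpNorm f p ≤ C * eLpNorm (lineSquare ψ f) p := by
  obtain ⟨C', hC'⟩ := exists_eLpNorm_lineSquare_le ψ hψ0 hp hp'
  obtain ⟨C, hsmooth⟩ := exists_le_eLpNorm_lineSquare_of_smooth ψ Ψ hψ0 hΨ0 hψ hΨ hp hp'
  refine ⟨2 * C, fun f hf => ?_⟩
  obtain ⟨F, hF, hlim⟩ := exists_seq_smooth_tendsto hp.le hp'.ne hf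
  have hFm : ∀ n, MemLp (F n) p := fun n => memLp_of_smooth (hF n).1 (hF n).2 p
  have hn : ∀ n, eLpNorm f p ≤ (C * (2 * (eLpNorm (lineSquare ψ f) p +
      C' * eLpNorm (f - F n) p))) + eLpNorm (f - F n) p := by
    intro n
    have h1 : eLpNorm f p ≤ eLpNorm (F n) p + eLpNorm (f - F n) p := by
      have e := eLpNorm_add_le (μ := volume) (p := p) (hFm n).1 (hf.1.sub (hFm n).1) hp.le
      have e2 : F n + (f - F n) = f := add_sub_cancel _ _
      rwa [e2] at e
    have hd : MemLp (F n - f) p := (hFm n).sub hf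
    have h2 : eLpNorm (lineSquare ψ (F n)) p ≤
        2 * (eLpNorm (lineSquare ψ f) p + C' * eLpNorm (f - F n) p) := by
      have e2 : f + (F n - f) = F n := add_sub_cancel _ _
      have h3 := eLpNorm_lineSquare_add_le ψ hp.le hf hd
      rw [e2] at h3
      have h4 := hC' _ hd
      rw [eLpNorm_sub_comm] at h4
      exact h3.trans (mul_le_mul' le_rfl (add_le_add le_rfl h4))
    exact h1.trans (add_le_add ((hsmooth _ (hF n).1 (hF n).2).trans
      (mul_le_mul' le_rfl h2)) le_rfl)
  have hl : Tendsto (fun n => (C * (2 * (eLpNorm (lineSquare ψ f) p +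
      C' * eLpNorm (f - F n) p))) + eLpNorm (f - F n) p) atTop
      (𝓝 ((C * (2 * (eLpNorm (lineSquare ψ f) p + C' * 0))) + 0)) := by
    refine Tendsto.add ?_ hlim
    refine ENNReal.Tendsto.const_mul (ENNReal.Tendsto.const_mul ?_ (Or.inr (by simp)))
      (Or.inr ENNReal.coe_ne_top)
    exact (ENNReal.Tendsto.const_mul hlim (Or.inr ENNReal.coe_ne_top)).const_add _
  rw [mul_zero, add_zero, add_zero] at hl
  refine (ge_of_tendsto hl (Eventually.of_forall hn)).trans (le_of_eq ?_)
  push_cast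
  ring

lemma IsCutoff.hasCompactSupport {ψ₀ : ℝ → ℂ} (h : IsCutoff ψ₀) : HasCompactSupport ψ₀ :=
  HasCompactSupport.of_support_subset_isCompact (isCompact_Icc.union isCompact_Icc)
    h.support_subset

/-- A cut-off, as a Schwartz function. -/
def IsCutoff.toSchwartz {ψ₀ : ℝ → ℂ} (h : IsCutoff ψ₀) : 𝓢(ℝ, ℂ) :=
  h.hasCompactSupport.toSchwartzMap h.smooth

@[simp] lemma IsCutoff.toSchwartz_apply {ψ₀ : ℝ → ℂ} (h : IsCutoff ψ₀) (x : ℝ) :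
    h.toSchwartz x = ψ₀ x := rfl

lemma IsCutoff.abs_mem {ψ₀ : ℝ → ℂ} (h : IsCutoff ψ₀) {x : ℝ} (hx : ψ₀ x ≠ 0) :
    1 / 2 ≤ |x| ∧ |x| ≤ 5 / 2 := by
  rcases h.support_subset hx with ⟨h1, h2⟩ | ⟨h1, h2⟩
  · rw [abs_of_neg (by linarith)]; constructor <;> linarith
  · rw [abs_of_pos (by linarith)]; constructor <;> linarith

lemma IsCutoff.apply_zero {ψ₀ : ℝ → ℂ} (h : IsCutoff ψ₀) : ψ₀ 0 = 0 := by
  by_contra h0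
  have := (h.abs_mem h0).1
  norm_num at this

lemma fourierInv_dilate {ψ₀ : ℝ → ℂ} (h : IsCutoff ψ₀) (k : ℤ) (x : ℝ) :
    𝓕⁻ (dilate ψ₀ k) x = lpKer h.toSchwartz k x := by
  rw [lpKer, SchwartzMap.fourierInv_coe]
  have e : dilate ψ₀ k = dil h.toSchwartz k := by
    ext t
    rw [dil_apply]
    rfl
  rw [e]

/-- A multiplier that equals one on the support of the cut-off. -/
def IsCutoff.fat {ψ₀ : ℝ → ℂ} (h : IsCutoff ψ₀) : 𝓢(ℝ, ℂ) :=
  ∑ j ∈ Finset.Icc (-2 : ℤ) 2, dil h.toSchwartz j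

lemma IsCutoff.fat_apply {ψ₀ : ℝ → ℂ} (h : IsCutoff ψ₀) (x : ℝ) :
    h.fat x = ∑ j ∈ Finset.Icc (-2 : ℤ) 2, ψ₀ ((2 : ℝ) ^ (-j) * x) := by
  simp [fat, sum_apply, dil_apply]

lemma IsCutoff.fat_zero {ψ₀ : ℝ → ℂ} (h : IsCutoff ψ₀) : h.fat 0 = 0 := by
  rw [h.fat_apply]
  simp [h.apply_zero]

/-- If x and 2^(-k) x both have modulus in [1/2, 5/2], then 2^|k| ≤ 5, so |k| ≤ 2. On the support of
ψ₀ the five dilates thus already give the full sum 1. -/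
lemma IsCutoff.fat_mul {ψ₀ : ℝ → ℂ} (h : IsCutoff ψ₀) (x : ℝ) :
    h.fat x * h.toSchwartz x = h.toSchwartz x := by
  rw [h.toSchwartz_apply]
  by_cases hx : ψ₀ x = 0
  · rw [hx, mul_zero]
  obtain ⟨h1, h2⟩ := h.abs_mem hx
  have hx0 : x ≠ 0 := fun h0 => hx (h0 ▸ h.apply_zero)
  have hsum : HasSum (fun k : ℤ => ψ₀ ((2 : ℝ) ^ (-k) * x)) (h.fat x) := by
    rw [h.fat_apply]
    refine hasSum_sum_of_ne_finset_zero fun k hk => ?_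
    by_contra hne
    obtain ⟨h3, h4⟩ := h.abs_mem hne
    rw [abs_mul, abs_of_pos (by positivity : (0 : ℝ) < 2 ^ (-k))] at h3 h4
    apply hk
    rw [Finset.mem_Icc]
    constructor
    · by_contra! hlt
      have h5 : (2 : ℝ) ^ (3 : ℤ) ≤ 2 ^ (-k) := zpow_le_zpow_right₀ (by norm_num) (by omega)
      have h6 : (2 : ℝ) ^ (3 : ℤ) = 8 := by norm_num
      rw [h6] at h5
      nlinarith
    · by_contra! hlt
      have h5 : (2 : ℝ) ^ (-k) ≤ 2 ^ (-3 : ℤ) := zpow_le_zpow_right₀ (by norm_num) (by omega)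
      have h6 : (2 : ℝ) ^ (-3 : ℤ) = 1 / 8 := by norm_num
      rw [h6] at h5
      nlinarith
  rw [hsum.unique (h.hasSum_one x hx0), one_mul]

/-- The Littlewood-Paley theorem on the line. -/
theorem IsCutoff.exists_lineSquare {ψ₀ : ℝ → ℂ} (h : IsCutoff ψ₀) {p : ℝ≥0∞} (hp : 1 < p)
    (hp' : p < ⊤) : ∃ C : ℝ≥0, ∀ f : ℝ → ℂ, MemLp f p →
      eLpNorm (lineSquare h.toSchwartz f) p ≤ C * eLpNorm f p ∧
      eLpNorm f p ≤ C * eLpNorm (lineSquare h.toSchwartz f) p := by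
  obtain ⟨C₁, h1⟩ := exists_eLpNorm_lineSquare_le h.toSchwartz h.apply_zero hp hp'
  obtain ⟨C₂, h2⟩ := exists_le_eLpNorm_lineSquare h.toSchwartz h.fat h.apply_zero h.fat_zero
    h.hasSum_one h.fat_mul hp hp'
  refine ⟨C₁ + C₂, fun f hf => ⟨(h1 f hf).trans ?_, (h2 f hf).trans ?_⟩⟩ <;> gcongr <;> simp

end AdaptedLP

end

/-! ### Bi-Lipschitz maps and the level coordinates -/

noncomputable section

namespace AdaptedLP

/-- Almost every point of almost every parallel to `v` has a property that holds almost
everywhere. -/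
lemma ae_ae_add_smul {E : Type*} [NormedAddCommGroup E] [NormedSpace ℝ E] [MeasurableSpace E]
    [BorelSpace E] [SecondCountableTopology E] {μ : Measure E} [SFinite μ]
    [μ.IsAddRightInvariant] {P : E → Prop} (hP : ∀ᵐ x ∂μ, P x) (v : E) :
    ∀ᵐ x ∂μ, ∀ᵐ s : ℝ, P (x + s • v) := by
  set N := toMeasurable μ {x | ¬ P x}
  have hN : μ N = 0 := by rw [measure_toMeasurable]; exact hP
  have hmeas : MeasurableSet {q : E × ℝ | q.1 + q.2 • v ∉ N} := by
    have hc : Continuous fun q : E × ℝ => q.1 + q.2 • v := by fun_prop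
    exact ((measurableSet_toMeasurable _ _).preimage hc.measurable).compl
  have h : ∀ᵐ x ∂μ, ∀ᵐ s : ℝ, x + s • v ∉ N := by
    rw [Measure.ae_ae_comm hmeas]
    refine Eventually.of_forall fun s => ?_
    exact (measurePreserving_add_right μ (s • v)).quasiMeasurePreserving.ae
      (measure_eq_zero_iff_ae_notMem.1 hN)
  filter_upwards [h] with x hx
  filter_upwards [hx] with s hs
  by_contra hc
  exact hs (subset_toMeasurable _ _ hc)

/-- A given segment may lie inside the exceptional null set, but almost every translate of it meets
that set in a null set. There the fundamental theorem of calculus for absolutely continuous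
functions applies; continuity and density give all base points. -/
lemma abs_add_sub_le_of_ae_norm_fderiv_le {E : Type*} [NormedAddCommGroup E] [NormedSpace ℝ E]
    [FiniteDimensional ℝ E] [MeasurableSpace E] [BorelSpace E] (μ : Measure E)
    [μ.IsAddHaarMeasure] {g : E → ℝ} {K : ℝ≥0} (hg : LipschitzWith K g) {C : ℝ}
    (hC : ∀ᵐ x ∂μ, ‖fderiv ℝ g x‖ ≤ C) (x v : E) : |g (x + v) - g x| ≤ C * ‖v‖ := by
  have : ProperSpace E := FiniteDimensional.proper ℝ E
  have hgood : ∀ᵐ x ∂μ, |g (x + v) - g x| ≤ C * ‖v‖ := by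
    filter_upwards [ae_ae_add_smul (hC.and (hg.ae_differentiableAt (μ := μ))) v] with x hx
    set φ : ℝ → ℝ := fun s => g (x + s • v)
    have hφ : LipschitzWith (K * ‖v‖₊) φ := by
      refine LipschitzWith.of_dist_le_mul fun s s' => (hg.dist_le_mul _ _).trans (le_of_eq ?_)
      rw [dist_add_left, dist_eq_norm, ← sub_smul, norm_smul, dist_eq_norm]
      push_cast
      ring
    have h1 := (hφ.lipschitzOnWith (s := Set.uIcc 0 1)).absolutelyContinuousOnInterval
    have h2 := h1.integral_deriv_eq_sub
    have h3 : ‖∫ s in (0 : ℝ)..1, deriv φ s‖ ≤ C * ‖v‖ * |(1 : ℝ) - 0| := by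
      refine intervalIntegral.norm_integral_le_of_norm_le_const_ae ?_
      filter_upwards [hx] with s hs _
      have hd : HasDerivAt φ (fderiv ℝ g (x + s • v) v) s := by
        have hl : HasDerivAt (fun s : ℝ => x + s • v) v s := by
          simpa using ((hasDerivAt_id s).smul_const v).const_add x
        exact hs.2.hasFDerivAt.comp_hasDerivAt s hl
      rw [hd.deriv]
      exact (ContinuousLinearMap.le_opNorm _ _).trans
        (mul_le_mul_of_nonneg_right hs.1 (norm_nonneg _))
    rw [h2] at h3
    simpa [φ] using h3
  have hcl : IsClosed {x | |g (x + v) - g x| ≤ C * ‖v‖} := by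
    have := hg.continuous
    exact isClosed_le (by fun_prop) (by fun_prop)
  have := (Measure.dense_of_ae hgood).closure_eq
  rw [hcl.closure_eq] at this
  exact (Set.ext_iff.1 this x).2 trivial

/-- Increasing bi-Lipschitz functions on the line, with constant two. -/
def IsBilip (θ : ℝ → ℝ) : Prop :=
  ∀ a b, a ≤ b → (b - a) / 2 ≤ θ b - θ a ∧ θ b - θ a ≤ 2 * (b - a)

lemma IsBilip.abs_le {θ : ℝ → ℝ} (h : IsBilip θ) (a b : ℝ) : |θ a - θ b| ≤ 2 * |a - b| := by
  rcases le_total a b with hab | hab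
  · have := h a b hab
    rw [abs_sub_comm, abs_of_nonneg (by linarith), abs_sub_comm, abs_of_nonneg (by linarith)]
    exact this.2
  · have := h b a hab
    rw [abs_of_nonneg (by linarith), abs_of_nonneg (by linarith)]
    exact this.2

lemma IsBilip.le_abs {θ : ℝ → ℝ} (h : IsBilip θ) (a b : ℝ) : |a - b| ≤ 2 * |θ a - θ b| := by
  rcases le_total a b with hab | hab
  · have := h a b hab
    rw [abs_sub_comm, abs_of_nonneg (by linarith), abs_sub_comm, abs_of_nonneg (by linarith)]
    linarith
  · have := h b a hab
    rw [abs_of_nonneg (by linarith), abs_of_nonneg (by linarith)]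
    linarith

lemma IsBilip.lipschitzWith {θ : ℝ → ℝ} (h : IsBilip θ) : LipschitzWith 2 θ :=
  LipschitzWith.of_dist_le_mul fun a b => h.abs_le a b

lemma IsBilip.antilipschitzWith {θ : ℝ → ℝ} (h : IsBilip θ) : AntilipschitzWith 2 θ :=
  AntilipschitzWith.of_le_mul_dist fun a b => h.le_abs a b

lemma IsBilip.continuous {θ : ℝ → ℝ} (h : IsBilip θ) : Continuous θ := h.lipschitzWith.continuous

lemma IsBilip.bijective {θ : ℝ → ℝ} (h : IsBilip θ) : Function.Bijective θ := by
  refine ⟨h.antilipschitzWith.injective, h.continuous.surjective ?_ ?_⟩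
  · refine tendsto_atTop_mono' _ (f₁ := fun x => x / 2 + θ 0) ?_
      (tendsto_atTop_add_const_right _ _ (tendsto_id.atTop_div_const two_pos))
    filter_upwards [eventually_ge_atTop 0] with x hx
    have := (h 0 x hx).1
    linarith
  · refine tendsto_atBot_mono' _ (f₁ := fun x => x / 2 + θ 0) ?_
      (tendsto_atBot_add_const_right _ _ (tendsto_id.atBot_div_const two_pos))
    filter_upwards [eventually_le_atBot 0] with x hx
    have := (h x 0 hx).1
    linarith

/-- Lebesgue measure on the line is one-dimensional Hausdorff measure, which scales under
(anti)Lipschitz maps. -/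
lemma IsBilip.volume_preimage_le {θ : ℝ → ℝ} (h : IsBilip θ) (S : Set ℝ) :
    volume (θ ⁻¹' S) ≤ 2 * volume S := by
  have := h.antilipschitzWith.hausdorffMeasure_preimage_le zero_le_one S
  rw [hausdorffMeasure_real] at this
  simpa using this

lemma IsBilip.volume_le_preimage {θ : ℝ → ℝ} (h : IsBilip θ) (S : Set ℝ) :
    volume S ≤ 2 * volume (θ ⁻¹' S) := by
  have := h.lipschitzWith.hausdorffMeasure_image_le zero_le_one (θ ⁻¹' S)
  rw [hausdorffMeasure_real, Set.image_preimage_eq _ h.bijective.2] at this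
  simpa using this

/-- A map whose push-forward of Lebesgue measure is comparable to Lebesgue measure. -/
structure IsComparable {α β : Type*} [MeasureSpace α] [MeasureSpace β] (Φ : α → β) (K : ℝ≥0) :
    Prop where
  measurable : Measurable Φ
  preimage_le : ∀ S, MeasurableSet S → volume (Φ ⁻¹' S) ≤ K * volume S
  le_preimage : ∀ S, MeasurableSet S → volume S ≤ K * volume (Φ ⁻¹' S)

lemma IsComparable.comp {α β γ : Type*} [MeasureSpace α] [MeasureSpace β] [MeasureSpace γ]
    {Φ : α → β} {Ψ : β → γ} {K L : ℝ≥0} (hΨ : IsComparable Ψ L) (hΦ : IsComparable Φ K) :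
    IsComparable (Ψ ∘ Φ) (L * K) where
  measurable := hΨ.measurable.comp hΦ.measurable
  preimage_le S hS := by
    have h1 := hΨ.preimage_le S hS
    have h2 := hΦ.preimage_le _ (hΨ.measurable hS)
    rw [Set.preimage_comp]
    push_cast
    rw [mul_comm (L : ℝ≥0∞), mul_assoc]
    exact h2.trans (by gcongr)
  le_preimage S hS := by
    have h1 := hΨ.le_preimage S hS
    have h2 := hΦ.le_preimage _ (hΨ.measurable hS)
    rw [Set.preimage_comp]
    push_cast
    rw [mul_assoc]
    exact h1.trans (by gcongr)

lemma IsComparable.of_measurePreserving {α β : Type*} [MeasureSpace α] [MeasureSpace β]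
    {Φ : α → β} (h : MeasurePreserving Φ volume volume) : IsComparable Φ 1 where
  measurable := h.measurable
  preimage_le S hS := by simp [h.measure_preimage hS.nullMeasurableSet]
  le_preimage S hS := by simp [h.measure_preimage hS.nullMeasurableSet]

/-- Tonelli on the fibres. Nothing beyond joint measurability is asked in the base variable, which
is what tolerates a slope that is only measurable. -/
lemma isComparable_fibred {θ : ℝ → ℝ → ℝ} (hθ : ∀ a, IsBilip (θ a))
    (hm : Measurable fun q : ℝ × ℝ => θ q.1 q.2) :
    IsComparable (fun q : ℝ × ℝ => (q.1, θ q.1 q.2)) 2 := by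
  have hΦ : Measurable fun q : ℝ × ℝ => (q.1, θ q.1 q.2) := measurable_fst.prodMk hm
  refine ⟨hΦ, fun S hS => ?_, fun S hS => ?_⟩
  · rw [Measure.volume_eq_prod, Measure.prod_apply hS, Measure.prod_apply (hΦ hS),
      ENNReal.coe_ofNat, ← lintegral_const_mul' _ _ (by norm_num)]
    exact lintegral_mono fun a => (hθ a).volume_preimage_le (Prod.mk a ⁻¹' S)
  · rw [Measure.volume_eq_prod, Measure.prod_apply hS, Measure.prod_apply (hΦ hS),
      ENNReal.coe_ofNat, ← lintegral_const_mul' _ _ (by norm_num)]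
    exact lintegral_mono fun a => (hθ a).volume_le_preimage (Prod.mk a ⁻¹' S)

/-- Functions of two variables within `1 / 4` of the first coordinate, in the Lipschitz sense. -/
def IsTilted (H : ℝ → ℝ → ℝ) : Prop :=
  ∀ a b a' b', |H a b - a - (H a' b' - a')| ≤ (|a - a'| + |b - b'|) / 4

/-- The measurable equivalence given by a measurable bijection of standard Borel spaces. -/
def equivOfBijective {α β : Type*} [MeasurableSpace α] [MeasurableSpace β]
    [StandardBorelSpace α] [StandardBorelSpace β] (Φ : α → β) (hm : Measurable Φ)
    (hb : Function.Bijective Φ) : α ≃ᵐ β where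
  toEquiv := Equiv.ofBijective Φ hb
  measurable_toFun := hm
  measurable_invFun := fun s hs => by
    -- Lusin-Souslin: injective Borel maps send Borel sets to Borel sets.
    have h := (hm.measurableEmbedding hb.1).measurableSet_image.2 hs
    rw [← (Equiv.ofBijective Φ hb).image_eq_preimage_symm]
    exact h

lemma IsTilted.isBilip_left {H : ℝ → ℝ → ℝ} (h : IsTilted H) (b : ℝ) : IsBilip (H · b) := by
  intro a a' haa
  have := abs_le.1 (h a' b a b)
  rw [sub_self, abs_zero, abs_of_nonneg (by linarith : 0 ≤ a' - a)] at this
  constructor <;> linarith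

/-- Along a line of slope at most 1 the two coordinates together move by at most 2|Δa|, so the error
is at most |Δa| / 2. This is where the constant 1/4 is needed: it leaves exactly the lower bound
1/2. -/
lemma IsTilted.isBilip_slope {H : ℝ → ℝ → ℝ} (h : IsTilted H) {s : ℝ} (hs : |s| ≤ 1) (w : ℝ) :
    IsBilip (fun a => H a (w + s * a)) := by
  intro a a' haa
  have h1 := abs_le.1 (h a' (w + s * a') a (w + s * a))
  have h2 : |w + s * a' - (w + s * a)| ≤ a' - a := by
    rw [show w + s * a' - (w + s * a) = s * (a' - a) by ring, abs_mul,
      abs_of_nonneg (by linarith : 0 ≤ a' - a)]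
    nlinarith
  rw [abs_of_nonneg (by linarith : 0 ≤ a' - a)] at h1
  constructor <;> linarith

lemma IsTilted.continuous {H : ℝ → ℝ → ℝ} (h : IsTilted H) :
    Continuous fun q : ℝ × ℝ => H q.1 q.2 := by
  have : LipschitzWith 1 fun q : ℝ × ℝ => H q.1 q.2 - q.1 := by
    refine LipschitzWith.of_dist_le_mul fun q q' => (h _ _ _ _).trans ?_
    have h1 : |q.1 - q'.1| ≤ dist q q' := (le_max_left _ _ : dist q.1 q'.1 ≤ _)
    have h2 : |q.2 - q'.2| ≤ dist q q' := (le_max_right _ _ : dist q.2 q'.2 ≤ _)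
    have := dist_nonneg (x := q) (y := q')
    rw [NNReal.coe_one, one_mul]
    linarith
  exact (this.continuous.add continuous_fst).congr fun q => sub_add_cancel _ _

/-- The level and the coordinate along the level curve. -/
def levelCoord (H : ℝ → ℝ → ℝ) (s : ℝ → ℝ) (q : ℝ × ℝ) : ℝ × ℝ :=
  (H q.1 q.2, q.2 - s (H q.1 q.2) * q.1)

lemma IsTilted.measurable_levelCoord {H : ℝ → ℝ → ℝ} (h : IsTilted H) {s : ℝ → ℝ}
    (hs : Measurable s) : Measurable (levelCoord H s) := by
  have := h.continuous.measurable
  exact this.prodMk (measurable_snd.sub ((hs.comp this).mul measurable_fst))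

/-- Inverting at (t, w) means solving H(a, w + s(t) a) = t for a, that is, intersecting a line of
direction (1, s(t)) with the level curve; `IsTilted.isBilip_slope` gives exactly one solution. -/
lemma IsTilted.bijective_levelCoord {H : ℝ → ℝ → ℝ} (h : IsTilted H) {s : ℝ → ℝ}
    (hs : ∀ t, |s t| ≤ 1) : Function.Bijective (levelCoord H s) := by
  constructor
  · rintro ⟨a, b⟩ ⟨a', b'⟩ hq
    simp only [levelCoord, Prod.mk.injEq] at hq
    obtain ⟨h1, h2⟩ := hq
    rw [← h1] at h2
    have h3 : a = a' := by
      refine (h.isBilip_slope (hs (H a b)) (b - s (H a b) * a)).bijective.1 ?_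
      change H a (b - s (H a b) * a + s (H a b) * a) = H a' (b - s (H a b) * a + s (H a b) * a')
      rw [sub_add_cancel, h2, sub_add_cancel, h1]
    subst h3
    exact Prod.ext rfl (by linarith)
  · rintro ⟨t, w⟩
    obtain ⟨a, ha⟩ := (h.isBilip_slope (hs t) w).bijective.2 t
    replace ha : H a (w + s t * a) = t := ha
    exact ⟨(a, w + s t * a), by simp [levelCoord, ha]⟩

lemma IsTilted.isComparable_zero {H : ℝ → ℝ → ℝ} (h : IsTilted H) :
    IsComparable (levelCoord H 0) 2 := by
  have h1 := isComparable_fibred (θ := fun b a => H a b) h.isBilip_left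
    (h.continuous.measurable.comp measurable_swap)
  have hsw : IsComparable (Prod.swap : ℝ × ℝ → ℝ × ℝ) 1 :=
    IsComparable.of_measurePreserving Measure.measurePreserving_swap
  have h2 := hsw.comp (h1.comp hsw)
  rw [mul_one, one_mul] at h2
  convert h2 using 1
  ext q <;> simp [levelCoord]

/-- Factor through the case s = 0: first (a, b) ↦ (t, b), then (t, b) ↦ (t, b - s(t) X_t(b)), where
X_t(b) is the abscissa of the level curve at height b. Each factor is bi-Lipschitz in one variable
with constant 2. -/
lemma IsTilted.isComparable_levelCoord {H : ℝ → ℝ → ℝ} (h : IsTilted H) {s : ℝ → ℝ}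
    (hm : Measurable s) (hs : ∀ t, |s t| ≤ 1) : IsComparable (levelCoord H s) 4 := by
  have hb0 := h.bijective_levelCoord (s := 0) (by simp)
  set e := equivOfBijective (levelCoord H 0) (h.measurable_levelCoord measurable_const) hb0 with he
  have hee : ∀ q, e q = levelCoord H 0 q := fun q => rfl
  have hY : ∀ t b, H (e.symm (t, b)).1 b = t ∧ (e.symm (t, b)).2 = b := by
    intro t b
    have := e.apply_symm_apply (t, b)
    rw [hee] at this
    simp only [levelCoord, Pi.zero_apply, zero_mul, sub_zero, Prod.mk.injEq] at this
    obtain ⟨h1, h2⟩ := this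
    rw [h2] at h1
    exact ⟨h1, h2⟩
  have hθ : ∀ t, IsBilip (fun b => b - s t * (e.symm (t, b)).1) := by
    intro t b b' hbb
    have h1 := h (e.symm (t, b')).1 b' (e.symm (t, b)).1 b
    rw [(hY t b).1, (hY t b').1, abs_of_nonneg (by linarith : 0 ≤ b' - b)] at h1
    set y := (e.symm (t, b)).1
    set y' := (e.symm (t, b')).1
    have h2 : |t - y' - (t - y)| = |y' - y| := by
      rw [show t - y' - (t - y) = -(y' - y) by ring, abs_neg]
    -- On a single level the tilt inequality reads |Δy| ≤ (|Δy| + Δb) / 4, so the abscissa is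
    -- 1/3-Lipschitz in the height.
    have h3 : |s t * (y' - y)| ≤ (b' - b) / 3 := by
      rw [abs_mul]
      nlinarith [hs t, abs_nonneg (y' - y), abs_nonneg (s t)]
    have h4 := abs_le.1 h3
    constructor <;> linarith
  have hΦ := isComparable_fibred hθ (measurable_snd.sub ((hm.comp measurable_fst).mul
    (measurable_fst.comp (e.symm.measurable.comp (measurable_fst.prodMk measurable_snd)))))
  have hc := hΦ.comp h.isComparable_zero
  rw [show (2 * 2 : ℝ≥0) = 4 by norm_num] at hc
  convert hc using 1
  ext q
  · simp [levelCoord]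
  · have : e.symm (H q.1 q.2, q.2) = q := by
      rw [e.symm_apply_eq, hee]
      simp [levelCoord]
    simp [levelCoord, this]

end AdaptedLP

end

/-! ### The measure δ(h_t(y)) dy as an image of dw -/

noncomputable section

namespace AdaptedLP

/-- The two coordinates of a point of the plane. -/
def coordEquiv : Plane ≃ᵐ ℝ × ℝ :=
  (MeasurableEquiv.toLp 2 (Fin 2 → ℝ)).symm.trans MeasurableEquiv.finTwoArrow

lemma coordEquiv_symm_apply (q : ℝ × ℝ) : coordEquiv.symm q = !₂[q.1, q.2] := rfl

lemma measurePreserving_coordEquiv :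
    MeasurePreserving coordEquiv (volume : Measure Plane) volume :=
  (EuclideanSpace.volume_preserving_symm_measurableEquiv_toLp (Fin 2)).trans
    (volume_preserving_finTwoArrow ℝ)

lemma norm_plane_le (x : Plane) : ‖x‖ ≤ |x 0| + |x 1| := by
  rw [EuclideanSpace.norm_eq, Fin.sum_univ_two]
  refine Real.sqrt_le_left (by positivity) |>.2 ?_
  simp only [Real.norm_eq_abs]
  nlinarith [abs_nonneg (x 0), abs_nonneg (x 1)]

/-- Subtracting the first coordinate leaves a Lipschitz function with gradient at most 1/4 almost
everywhere; the mean value bound above makes this hold between any two points. -/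
lemma IsLevelFunction.isTilted {h : Plane → ℝ} (hh : IsLevelFunction (1 / 4) h) :
    IsTilted fun a b => h !₂[a, b] := by
  obtain ⟨⟨K, hK⟩, hgrad⟩ := hh
  set π : Plane →L[ℝ] ℝ := InnerProductSpace.toDual ℝ Plane !₂[1, 0]
  have hπ : ∀ x : Plane, π x = x 0 := fun x => by
    simp [π, PiLp.inner_apply, Fin.sum_univ_two]
  have hg : LipschitzWith (K + ‖π‖₊) fun x => h x - π x := hK.sub π.lipschitz
  have hfd : ∀ᵐ x : Plane, ‖fderiv ℝ (fun x => h x - π x) x‖ ≤ 1 / 4 := by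
    filter_upwards [hgrad, hK.ae_differentiableAt (μ := volume)] with x hx hd
    have h1 : HasFDerivAt h (InnerProductSpace.toDual ℝ Plane (gradient h x)) x :=
      hasGradientAt_iff_hasFDerivAt.1 hd.hasGradientAt
    have h2 := h1.sub π.hasFDerivAt
    have h3 : fderiv ℝ (fun x => h x - π x) x =
        InnerProductSpace.toDual ℝ Plane (gradient h x - !₂[1, 0]) := by
      rw [map_sub]
      exact h2.fderiv
    rw [h3, LinearIsometryEquiv.norm_map]
    exact hx
  intro a b a' b'
  have h4 := abs_add_sub_le_of_ae_norm_fderiv_le volume hg hfd !₂[a', b'] (!₂[a, b] - !₂[a', b'])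
  rw [add_sub_cancel, hπ, hπ] at h4
  have h5 := norm_plane_le (!₂[a, b] - !₂[a', b'])
  simp only [PiLp.sub_apply, Matrix.cons_val_zero, Matrix.cons_val_one] at h4 h5
  linarith

/-- The translates of the curve `w ↦ (X w, w + s X w)` in the direction `(1, s)`. -/
def sweep (X : ℝ → ℝ) (s : ℝ) (q : ℝ × ℝ) : Plane :=
  !₂[X q.1 + q.2, q.1 + s * (X q.1 + q.2)]

/-- Two shears with a swap between them. Translation on each fibre preserves measure, so the curve
need only be measurable. -/
lemma measurePreserving_sweep {X : ℝ → ℝ} (hX : Measurable X) (s : ℝ) :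
    MeasurePreserving (sweep X s) volume volume := by
  have hA : MeasurePreserving (fun q : ℝ × ℝ => (q.1, X q.1 + q.2)) volume volume :=
    (MeasurePreserving.id volume).skew_product (g := fun w d => X w + d)
      ((hX.comp measurable_fst).add measurable_snd)
      (Eventually.of_forall fun w => map_add_left_eq_self _ _)
  have hC : MeasurePreserving (fun q : ℝ × ℝ => (q.1, s * q.1 + q.2)) volume volume :=
    (MeasurePreserving.id volume).skew_product (g := fun a w => s * a + w)
      ((measurable_fst.const_mul s).add measurable_snd)
      (Eventually.of_forall fun w => map_add_left_eq_self _ _)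
  have h := (measurePreserving_coordEquiv.symm).comp
    (hC.comp ((Measure.measurePreserving_swap (μ := volume) (ν := volume)).comp hA))
  convert h using 1
  ext q
  simp [coordEquiv_symm_apply, sweep, add_comm]

lemma injective_sweep (X : ℝ → ℝ) (s : ℝ) : Function.Injective (sweep X s) := by
  rintro ⟨w, d⟩ ⟨w', d'⟩ hq
  have h0 := congr_arg (fun x : Plane => x 0) hq
  have h1 := congr_arg (fun x : Plane => x 1) hq
  simp only [sweep, Matrix.cons_val_zero, Matrix.cons_val_one] at h0 h1
  rw [h0] at h1
  have hw : w = w' := by linarith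
  subst hw
  exact Prod.ext rfl (by linarith)

lemma continuous_sweep_right (X : ℝ → ℝ) (s w : ℝ) : Continuous fun d => sweep X s (w, d) := by
  unfold sweep
  refine (PiLp.continuous_toLp 2 _).comp (continuous_pi fun i => ?_)
  fin_cases i
  · simp only [Fin.zero_eta, Matrix.cons_val_zero]; fun_prop
  · simp only [Fin.mk_one, Matrix.cons_val_one]; fun_prop

/-- The chosen distance is forced: the line through the point in direction v_t meets the level curve
only once. -/
lemma auxFun_sweep {h : Plane → ℝ} (hh : IsTilted fun a b => h !₂[a, b]) {u : ℝ → ℝ} {t : ℝ}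
    (hu : |u t| ≤ 1) {X : ℝ → ℝ} (hX : ∀ w, h !₂[X w, w + u t * X w] = t) (q : ℝ × ℝ) :
    auxFun h u t (sweep X (u t) q) = q.2 := by
  have H : ∃ d : ℝ, ∃ y ∈ levelCurve h t, sweep X (u t) q - y = d • dir u t := by
    refine ⟨q.2, _, hX q.1, ?_⟩
    ext i
    fin_cases i
    · simp [sweep, dir]
    · simp [sweep, dir]; ring
  rw [auxFun, dif_pos H]
  obtain ⟨y, hy, hd⟩ := H.choose_spec
  set d := H.choose
  have hy0 : y 0 = X q.1 + q.2 - d := by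
    have := congr_arg (fun x : Plane => x 0) hd
    simp only [sweep, dir, PiLp.sub_apply, PiLp.smul_apply, Matrix.cons_val_zero, smul_eq_mul,
      mul_one] at this
    linarith
  have hy1 : y 1 = q.1 + u t * (X q.1 + q.2 - d) := by
    have := congr_arg (fun x : Plane => x 1) hd
    simp only [sweep, dir, PiLp.sub_apply, PiLp.smul_apply, Matrix.cons_val_one,
      Matrix.cons_val_zero, smul_eq_mul] at this
    linarith
  have hy' : y = !₂[y 0, q.1 + u t * y 0] := by
    rw [hy0, ← hy1]
    ext i
    fin_cases i <;> simp [hy0]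
  have h1 : h !₂[y 0, q.1 + u t * y 0] = t := by rw [← hy']; exact hy
  have h2 := (hh.isBilip_slope hu q.1).bijective.1 (h1.trans (hX q.1).symm)
  linarith

/-- In sweep coordinates the sublevel set is the strip |d| < ε. The substitution d = εr fixes the
domain, so ε → 0 becomes a limit of integrands. -/
lemma integral_sublevel_eq {h : Plane → ℝ} (hh : IsTilted fun a b => h !₂[a, b]) {u : ℝ → ℝ}
    {t : ℝ} (hu : |u t| ≤ 1) {X : ℝ → ℝ} (hm : Measurable X)
    (hX : ∀ w, h !₂[X w, w + u t * X w] = t) {φ : Plane → ℝ} (hφ : Integrable φ) {ε : ℝ}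
    (hε : 0 < ε) :
    (2 * ε)⁻¹ * ∫ y in {y | |auxFun h u t y| < ε}, φ y =
      ∫ w, 2⁻¹ * ∫ r in (-1 : ℝ)..1, φ (sweep X (u t) (w, ε * r)) := by
  have hs := measurePreserving_sweep hm (u t)
  have he := hs.measurable.measurableEmbedding (injective_sweep X (u t))
  have h1 : sweep X (u t) ⁻¹' {y | |auxFun h u t y| < ε} = Set.univ ×ˢ Set.Ioo (-ε) ε := by
    ext q
    simp [auxFun_sweep hh hu hX, abs_lt]
  rw [← hs.setIntegral_preimage_emb he, h1, Measure.volume_eq_prod, setIntegral_prod,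
    setIntegral_univ, ← integral_const_mul]
  · refine integral_congr_ae (Eventually.of_forall fun w => ?_)
    have h2 := intervalIntegral.mul_integral_comp_mul_left (a := -1) (b := 1)
      (f := fun d => φ (sweep X (u t) (w, d))) ε
    rw [mul_one, mul_neg_one, intervalIntegral.integral_of_le (by linarith : -ε ≤ ε),
      integral_Ioc_eq_integral_Ioo] at h2
    beta_reduce
    rw [← h2, ← mul_assoc]
    congr 1
    field_simp
  · rw [← Measure.volume_eq_prod]
    exact ((hs.integrable_comp_emb he).2 hφ).integrableOn

lemma isDelta_map_sweep {h : Plane → ℝ} (hh : IsTilted fun a b => h !₂[a, b]) {u : ℝ → ℝ}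
    {t : ℝ} (hu : |u t| ≤ 1) {X : ℝ → ℝ} (hm : Measurable X)
    (hX : ∀ w, h !₂[X w, w + u t * X w] = t) :
    IsDelta (auxFun h u t) (Measure.map (fun w => sweep X (u t) (w, 0)) volume) := by
  have hγ : Measurable fun w => sweep X (u t) (w, 0) :=
    (measurePreserving_sweep hm (u t)).measurable.comp (measurable_id.prodMk measurable_const)
  -- The parameter w is a continuous linear function of the point, so a compact set in the plane
  -- confines it to a bounded interval, even though `X` is only measurable.
  have hw : ∀ w d, (sweep X (u t) (w, d)) 1 - u t * (sweep X (u t) (w, d)) 0 = w := by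
    intro w d
    simp [sweep]
  have hbd : ∀ K : Set Plane, IsCompact K →
      ∃ R : ℝ, ∀ w d, sweep X (u t) (w, d) ∈ K → w ∈ Set.Icc (-R) R := by
    intro K hK
    have hc : Continuous fun x : Plane => x 1 - u t * x 0 := by fun_prop
    obtain ⟨R, hR⟩ := (hK.image hc).isBounded.exists_norm_le
    refine ⟨R, fun w d hwd => abs_le.1 ?_⟩
    have := hR _ (Set.mem_image_of_mem _ hwd)
    rwa [hw] at this
  refine ⟨⟨fun {K} hK => ?_⟩, fun φ hφ hc => ?_⟩
  · obtain ⟨R, hR⟩ := hbd K hK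
    rw [Measure.map_apply hγ hK.measurableSet]
    refine (measure_mono (t := Set.Icc (-R) R) fun w hwK => hR w 0 hwK).trans_lt ?_
    simp
  · obtain ⟨R, hR⟩ := hbd _ hc
    obtain ⟨M, hM⟩ := hφ.bounded_above_of_compact_support hc
    have hM0 : 0 ≤ M := (norm_nonneg _).trans (hM 0)
    have hz : ∀ w d, w ∉ Set.Icc (-R) R → φ (sweep X (u t) (w, d)) = 0 := fun w d hw' =>
      image_eq_zero_of_notMem_tsupport fun hmem => hw' (hR w d hmem)
    have hlim : Tendsto (fun ε : ℝ => ∫ w, 2⁻¹ * ∫ r in (-1 : ℝ)..1,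
        φ (sweep X (u t) (w, ε * r))) (𝓝[>] 0) (𝓝 (∫ w, φ (sweep X (u t) (w, 0)))) := by
      refine tendsto_integral_filter_of_dominated_convergence
        ((Set.Icc (-R) R).indicator fun _ => M) ?_ ?_ ?_ ?_
      · refine Eventually.of_forall fun ε => ?_
        have h1 : StronglyMeasurable fun q : ℝ × ℝ => φ (sweep X (u t) (q.1, ε * q.2)) :=
          (hφ.measurable.comp ((measurePreserving_sweep hm (u t)).measurable.comp
            (measurable_fst.prodMk (measurable_snd.const_mul ε)))).stronglyMeasurable
        simp only [intervalIntegral.integral_of_le (by norm_num : (-1 : ℝ) ≤ 1)]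
        exact (h1.integral_prod_right'.const_mul _).aestronglyMeasurable
      · refine Eventually.of_forall fun ε => Eventually.of_forall fun w => ?_
        by_cases hw' : w ∈ Set.Icc (-R) R
        · rw [Set.indicator_of_mem hw', norm_mul]
          have := intervalIntegral.norm_integral_le_of_norm_le_const (a := -1) (b := 1)
            (f := fun r => φ (sweep X (u t) (w, ε * r))) (C := M) fun r _ => hM _
          norm_num at this ⊢
          linarith
        · simp [hz w _ hw', Set.indicator_of_notMem hw']
      · exact (integrable_indicator_iff measurableSet_Icc).2 (integrableOn_const (by simp))
      · refine Eventually.of_forall fun w => ?_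
        have hcont : Continuous fun ε : ℝ => ∫ r in (-1 : ℝ)..1, φ (sweep X (u t) (w, ε * r)) := by
          refine intervalIntegral.continuous_parametric_intervalIntegral_of_continuous' ?_ _ _
          exact hφ.comp ((continuous_sweep_right X (u t) w).comp continuous_mul)
        have h0 := ((hcont.tendsto 0).const_mul (2⁻¹ : ℝ)).mono_left
          (nhdsWithin_le_nhds (s := Set.Ioi 0))
        simp only [zero_mul, intervalIntegral.integral_const, smul_eq_mul] at h0
        convert h0 using 2
        ring
    rw [integral_map hγ.aemeasurable hφ.aestronglyMeasurable]
    refine hlim.congr' ?_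
    filter_upwards [self_mem_nhdsWithin] with ε hε
    exact (integral_sublevel_eq hh hu hm hX (hφ.integrable_of_hasCompactSupport hc) hε).symm

lemma IsDelta.unique {G : Plane → ℝ} {μ ν : Measure Plane} (hμ : IsDelta G μ)
    (hν : IsDelta G ν) : μ = ν := by
  have := hμ.1
  have := hν.1
  exact Measure.ext_of_integral_eq_on_compactlySupported fun f =>
    tendsto_nhds_unique (hμ.2 f f.continuous f.hasCompactSupport)
      (hν.2 f f.continuous f.hasCompactSupport)

lemma deltaMeasure_eq {h : Plane → ℝ} (hh : IsTilted fun a b => h !₂[a, b]) {u : ℝ → ℝ}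
    {t : ℝ} (hu : |u t| ≤ 1) {X : ℝ → ℝ} (hm : Measurable X)
    (hX : ∀ w, h !₂[X w, w + u t * X w] = t) :
    deltaMeasure (auxFun h u t) = Measure.map (fun w => sweep X (u t) (w, 0)) volume := by
  have H := isDelta_map_sweep hh hu hm hX
  have hex : ∃ μ, IsDelta (auxFun h u t) μ := ⟨_, H⟩
  rw [deltaMeasure, dif_pos hex]
  exact hex.choose_spec.unique H

end AdaptedLP

end

/-! ### Littlewood-Paley theory on the fibres -/

noncomputable section

namespace AdaptedLP

open scoped SchwartzMap

/-- Convolution in the second variable. -/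
def fibreConvol (K : ℝ → ℂ) (F : ℝ × ℝ → ℂ) (q : ℝ × ℝ) : ℂ :=
  convol K (fun w => F (q.1, w)) q.2

lemma fibreConvol_congr_ae (K : ℝ → ℂ) {F G : ℝ × ℝ → ℂ} (h : F =ᵐ[volume] G) :
    ∀ᵐ t : ℝ, ∀ w, fibreConvol K F (t, w) = fibreConvol K G (t, w) := by
  rw [Measure.volume_eq_prod] at h
  filter_upwards [Measure.ae_ae_of_ae_prod h] with t ht w
  refine integral_congr_ae ?_
  filter_upwards [ht] with y hy
  simp only [hy]

lemma ae_of_ae_fst {P : ℝ × ℝ → Prop} (h : ∀ᵐ t : ℝ, ∀ w, P (t, w)) : ∀ᵐ q : ℝ × ℝ, P q := by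
  rw [Measure.volume_eq_prod]
  filter_upwards [Measure.quasiMeasurePreserving_fst.ae h] with q hq
  exact hq q.2

lemma aestronglyMeasurable_fibreConvol {K : ℝ → ℂ} (hK : Continuous K) {F : ℝ × ℝ → ℂ}
    (hF : AEStronglyMeasurable F) : AEStronglyMeasurable (fibreConvol K F) := by
  have h1 : StronglyMeasurable (fibreConvol K (hF.mk F)) := by
    have h2 : StronglyMeasurable fun z : (ℝ × ℝ) × ℝ => hF.mk F (z.1.1, z.2) * K (z.1.2 - z.2) :=
      (hF.stronglyMeasurable_mk.comp_measurable
        ((measurable_fst.comp measurable_fst).prodMk measurable_snd)).mul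
        (hK.stronglyMeasurable.comp_measurable
          ((measurable_snd.comp measurable_fst).sub measurable_snd))
    exact h2.integral_prod_right'
  exact h1.aestronglyMeasurable.congr (ae_of_ae_fst (fibreConvol_congr_ae K hF.ae_eq_mk.symm))

/-- The square function in the second variable. -/
def fibreSquare (m : 𝓢(ℝ, ℂ)) (F : ℝ × ℝ → ℂ) (q : ℝ × ℝ) : ℝ≥0∞ :=
  (∑' k : ℤ, ‖fibreConvol (lpKer m k) F q‖ₑ ^ 2) ^ (1 / 2 : ℝ)

lemma aemeasurable_fibreSquare (m : 𝓢(ℝ, ℂ)) {F : ℝ × ℝ → ℂ} (hF : AEStronglyMeasurable F) :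
    AEMeasurable (fibreSquare m F) :=
  (AEMeasurable.tsum fun k => (aestronglyMeasurable_fibreConvol
    (lpKer m k).continuous hF).enorm.pow_const 2).pow_const _

lemma eLpNorm_rpow_eq_lintegral_fibres {p : ℝ≥0∞} (hp : p ≠ 0) (hp' : p ≠ ⊤) {ε : Type*}
    [ENorm ε] {F : ℝ × ℝ → ε} (hF : AEMeasurable fun q => ‖F q‖ₑ) :
    eLpNorm F p volume ^ p.toReal =
      ∫⁻ t : ℝ, eLpNorm (fun w => F (t, w)) p volume ^ p.toReal := by
  have hr : p.toReal ≠ 0 := (ENNReal.toReal_pos hp hp').ne'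
  simp only [eLpNorm_eq_lintegral_rpow_enorm_toReal hp hp', ← ENNReal.rpow_mul, one_div,
    inv_mul_cancel₀ hr, ENNReal.rpow_one]
  rw [Measure.volume_eq_prod] at hF ⊢
  exact lintegral_prod _ (hF.pow_const _)

/-- Two codomains are allowed because a complex function is compared with an extended nonnegative
square function, in both directions. -/
lemma eLpNorm_le_of_fibres {p : ℝ≥0∞} (hp : p ≠ 0) (hp' : p ≠ ⊤) {ε ε' : Type*}
    [ENorm ε] [ENorm ε'] {F : ℝ × ℝ → ε} {G : ℝ × ℝ → ε'} (hF : AEMeasurable fun q => ‖F q‖ₑ)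
    (hG : AEMeasurable fun q => ‖G q‖ₑ) {C : ℝ≥0}
    (h : ∀ᵐ t : ℝ, eLpNorm (fun w => F (t, w)) p volume ≤
      C * eLpNorm (fun w => G (t, w)) p volume) :
    eLpNorm F p volume ≤ C * eLpNorm G p volume := by
  have hr := ENNReal.toReal_pos hp hp'
  rw [← ENNReal.rpow_le_rpow_iff hr, ENNReal.mul_rpow_of_nonneg _ _ hr.le,
    eLpNorm_rpow_eq_lintegral_fibres hp hp' hF, eLpNorm_rpow_eq_lintegral_fibres hp hp' hG,
    ← lintegral_const_mul' _ _ (ENNReal.rpow_ne_top_of_nonneg hr.le ENNReal.coe_ne_top)]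
  refine lintegral_mono_ae ?_
  filter_upwards [h] with t ht
  rw [← ENNReal.mul_rpow_of_nonneg _ _ hr.le]
  exact ENNReal.rpow_le_rpow ht hr.le

lemma ae_memLp_fibre {p : ℝ≥0∞} (hp : p ≠ 0) (hp' : p ≠ ⊤) {F : ℝ × ℝ → ℂ} (hF : MemLp F p) :
    ∀ᵐ t : ℝ, MemLp (fun w => F (t, w)) p := by
  have hr := ENNReal.toReal_pos hp hp'
  have h1 := eLpNorm_rpow_eq_lintegral_fibres hp hp' hF.1.enorm
  have h2 : ∫⁻ t : ℝ, eLpNorm (fun w => F (t, w)) p volume ^ p.toReal ≠ ⊤ := by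
    rw [← h1]
    exact (ENNReal.rpow_lt_top_of_nonneg hr.le hF.2.ne).ne
  have hF1 := hF.1
  rw [Measure.volume_eq_prod] at hF1
  have h3 : AEMeasurable fun t : ℝ => eLpNorm (fun w => F (t, w)) p volume ^ p.toReal := by
    have h4 := (hF1.enorm.pow_const p.toReal).lintegral_prod_right'
    refine h4.congr (Eventually.of_forall fun t => ?_)
    have hr0 := hr.ne'
    simp only [eLpNorm_eq_lintegral_rpow_enorm_toReal hp hp', ← ENNReal.rpow_mul, one_div,
      inv_mul_cancel₀ hr0, ENNReal.rpow_one]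
  filter_upwards [hF1.prodMk_left, ae_lt_top' h3 h2] with t ht1 ht2
  exact ⟨ht1, (ENNReal.rpow_lt_top_iff_of_pos hr).1 ht2⟩

/-- The Littlewood-Paley inequalities in the second variable. -/
lemma IsCutoff.exists_fibreSquare {ψ₀ : ℝ → ℂ} (h : IsCutoff ψ₀) {p : ℝ≥0∞} (hp : 1 < p)
    (hp' : p < ⊤) : ∃ C : ℝ≥0, ∀ F : ℝ × ℝ → ℂ, MemLp F p →
      eLpNorm (fibreSquare h.toSchwartz F) p volume ≤ C * eLpNorm F p volume ∧
      eLpNorm F p volume ≤ C * eLpNorm (fibreSquare h.toSchwartz F) p volume := by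
  have hp0 : p ≠ 0 := (zero_lt_one.trans hp).ne'
  obtain ⟨C, hC⟩ := h.exists_lineSquare hp hp'
  refine ⟨C, fun F hF => ?_⟩
  have hm := aemeasurable_fibreSquare h.toSchwartz hF.1
  have hfib := ae_memLp_fibre hp0 hp'.ne hF
  constructor
  · refine eLpNorm_le_of_fibres hp0 hp'.ne hm hF.1.enorm ?_
    filter_upwards [hfib] with t ht
    exact (hC _ ht).1
  · refine eLpNorm_le_of_fibres hp0 hp'.ne hF.1.enorm hm ?_
    filter_upwards [hfib] with t ht
    exact (hC _ ht).2

lemma enorm_le_square (a : ℤ → ℂ) (k : ℤ) :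
    ‖a k‖ₑ ≤ (∑' k : ℤ, ‖a k‖ₑ ^ 2) ^ (1 / 2 : ℝ) := by
  have h := ENNReal.rpow_le_rpow (ENNReal.le_tsum (f := fun k => ‖a k‖ₑ ^ 2) k)
    (by norm_num : (0 : ℝ) ≤ 1 / 2)
  refine le_trans (le_of_eq ?_) h
  rw [← ENNReal.rpow_ofNat, ← ENNReal.rpow_mul]
  norm_num

lemma IsCutoff.memLp_fibreConvol {ψ₀ : ℝ → ℂ} (h : IsCutoff ψ₀) {p : ℝ≥0∞} (hp : 1 < p)
    (hp' : p < ⊤) {F : ℝ × ℝ → ℂ} (hF : MemLp F p) (k : ℤ) :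
    MemLp (fibreConvol (lpKer h.toSchwartz k) F) p := by
  obtain ⟨C, hC⟩ := h.exists_fibreSquare hp hp'
  refine ⟨aestronglyMeasurable_fibreConvol (lpKer _ k).continuous hF.1, ?_⟩
  refine lt_of_le_of_lt ?_ ((hC F hF).1.trans_lt (ENNReal.mul_lt_top ENNReal.coe_lt_top hF.2))
  refine eLpNorm_mono_enorm fun q => ?_
  rw [enorm_eq_self]
  exact enorm_le_square (fun k => fibreConvol (lpKer h.toSchwartz k) F q) k

/-- The transpose of a convolution in the second variable. -/
lemma integral_fibreConvol_mul (K : 𝓢(ℝ, ℂ)) {p q : ℝ≥0∞} (hp : 1 < p) (hp' : p < ⊤)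
    [p.HolderConjugate q] {F G : ℝ × ℝ → ℂ} (hF : MemLp F p) (hG : MemLp G q)
    (hKF : MemLp (fibreConvol K F) p) (hKG : MemLp (fibreConvol (reflect K) G) q) :
    ∫ z, fibreConvol K F z * G z = ∫ z, F z * fibreConvol (reflect K) G z := by
  have hp0 : p ≠ 0 := (zero_lt_one.trans hp).ne'
  have hq : q < ⊤ := (ENNReal.HolderConjugate.lt_top_iff_one_lt q p).2 hp
  have hq0 : q ≠ 0 := (zero_lt_one.trans_le (ENNReal.HolderConjugate.one_le q p)).ne'
  have h1 : Integrable (fun z => fibreConvol K F z * G z) := hKF.integrable_mul hG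
  have h2 : Integrable (fun z => F z * fibreConvol (reflect K) G z) := hF.integrable_mul hKG
  rw [Measure.volume_eq_prod] at h1 h2 ⊢
  rw [integral_prod _ h1, integral_prod _ h2]
  refine integral_congr_ae ?_
  filter_upwards [ae_memLp_fibre hp0 hp'.ne hF, ae_memLp_fibre hq0 hq.ne hG] with t ht1 ht2
  exact integral_convol_mul K hp hp' ht1 ht2

end AdaptedLP

end

/-! ### Transport through comparable maps, and the chart -/

noncomputable section

namespace AdaptedLP

open scoped SchwartzMap

section Comparable

variable {α β : Type*} [MeasureSpace α] [MeasureSpace β] {e : α ≃ᵐ β} {K : ℝ≥0}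

lemma IsComparable.map_le (h : IsComparable e K) :
    Measure.map e volume ≤ (K : ℝ≥0∞) • (volume : Measure β) := by
  refine Measure.le_iff.2 fun S hS => ?_
  rw [Measure.map_apply e.measurable hS]
  exact h.preimage_le S hS

lemma IsComparable.le_map (h : IsComparable e K) :
    (volume : Measure β) ≤ (K : ℝ≥0∞) • Measure.map e volume := by
  refine Measure.le_iff.2 fun S hS => ?_
  rw [Measure.smul_apply, Measure.map_apply e.measurable hS]
  exact h.le_preimage S hS

lemma IsComparable.quasiMeasurePreserving (h : IsComparable e K) :
    Measure.QuasiMeasurePreserving e volume volume :=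
  ⟨e.measurable, Measure.absolutelyContinuous_of_le_smul h.map_le⟩

lemma IsComparable.quasiMeasurePreserving_symm (h : IsComparable e K) :
    Measure.QuasiMeasurePreserving e.symm volume volume := by
  refine ⟨e.symm.measurable, Measure.AbsolutelyContinuous.mk fun S hS h0 => ?_⟩
  rw [Measure.map_apply e.symm.measurable hS]
  refine le_antisymm ((h.le_preimage _ (e.symm.measurable hS)).trans ?_) zero_le
  rw [← Set.preimage_comp, e.symm_comp_self, Set.preimage_id, h0, mul_zero]

/-- Keeps the cost of a change of variables independent of p. -/
lemma coe_rpow_inv_le {K : ℝ≥0} (hK : 1 ≤ K) {p : ℝ≥0∞} (hp : 1 ≤ p) :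
    (K : ℝ≥0∞) ^ (1 / p).toReal ≤ K := by
  have h1 : (1 / p).toReal ≤ 1 := by
    refine ENNReal.toReal_le_of_le_ofReal zero_le_one ?_
    simpa using hp
  exact (ENNReal.rpow_le_rpow_of_exponent_le (by exact_mod_cast hK) h1).trans_eq
    (ENNReal.rpow_one _)

variable {ε : Type*} [TopologicalSpace ε] [ContinuousENorm ε]

lemma IsComparable.eLpNorm_comp_le (h : IsComparable e K) (hK : 1 ≤ K) {p : ℝ≥0∞} (hp : 1 ≤ p)
    (hp' : p ≠ ⊤) (G : β → ε) : eLpNorm (G ∘ e) p volume ≤ K * eLpNorm G p volume := by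
  rw [← e.measurableEmbedding.eLpNorm_map_measure]
  refine (eLpNorm_mono_measure G h.map_le).trans ?_
  rw [eLpNorm_smul_measure_of_ne_top hp', smul_eq_mul]
  exact mul_le_mul' (coe_rpow_inv_le hK hp) le_rfl

lemma IsComparable.le_eLpNorm_comp (h : IsComparable e K) (hK : 1 ≤ K) {p : ℝ≥0∞} (hp : 1 ≤ p)
    (hp' : p ≠ ⊤) (G : β → ε) : eLpNorm G p volume ≤ K * eLpNorm (G ∘ e) p volume := by
  rw [← e.measurableEmbedding.eLpNorm_map_measure]
  refine (eLpNorm_mono_measure G h.le_map).trans ?_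
  rw [eLpNorm_smul_measure_of_ne_top hp', smul_eq_mul]
  exact mul_le_mul' (coe_rpow_inv_le hK hp) le_rfl

lemma IsComparable.memLp_comp (h : IsComparable e K) (hK : 1 ≤ K) {p : ℝ≥0∞} (hp : 1 ≤ p)
    (hp' : p ≠ ⊤) {G : β → ℂ} (hG : MemLp G p) : MemLp (G ∘ e) p :=
  ⟨hG.1.comp_quasiMeasurePreserving h.quasiMeasurePreserving,
    (h.eLpNorm_comp_le hK hp hp' G).trans_lt (ENNReal.mul_lt_top ENNReal.coe_lt_top hG.2)⟩

lemma IsComparable.memLp_comp_symm (h : IsComparable e K) (hK : 1 ≤ K) {p : ℝ≥0∞} (hp : 1 ≤ p)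
    (hp' : p ≠ ⊤) {f : α → ℂ} (hf : MemLp f p) : MemLp (f ∘ e.symm) p := by
  refine ⟨hf.1.comp_quasiMeasurePreserving h.quasiMeasurePreserving_symm, ?_⟩
  refine (h.le_eLpNorm_comp hK hp hp' _).trans_lt (ENNReal.mul_lt_top ENNReal.coe_lt_top ?_)
  rw [Function.comp_assoc, e.symm_comp_self]
  exact hf.2

/-- The density of the push-forward of Lebesgue measure. -/
lemma IsComparable.exists_density [SigmaFinite (volume : Measure α)]
    [SigmaFinite (volume : Measure β)] (h : IsComparable e K) (hK : 1 ≤ K) :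
    ∃ J : β → ℝ≥0, Measurable J ∧ (∀ q, J q ≤ K ∧ 1 ≤ K * J q) ∧
      Measure.map e volume = (volume : Measure β).withDensity fun q => J q := by
  have hσ : SigmaFinite (Measure.map e (volume : Measure α)) := e.sigmaFinite_map
  set D := (Measure.map e volume).rnDeriv (volume : Measure β)
  have hD : Measurable D := Measure.measurable_rnDeriv _ _
  have hmap : (volume : Measure β).withDensity D = Measure.map e volume :=
    Measure.withDensity_rnDeriv_eq _ _ h.quasiMeasurePreserving.absolutelyContinuous
  have hset : ∀ S, MeasurableSet S → ∫⁻ q in S, D q = volume (e ⁻¹' S) := fun S hS => by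
    rw [← withDensity_apply _ hS, hmap, Measure.map_apply e.measurable hS]
  have h1 : D ≤ᵐ[volume] fun _ => (K : ℝ≥0∞) := by
    refine ae_le_of_forall_setLIntegral_le_of_sigmaFinite hD fun S hS _ => ?_
    rw [hset S hS, setLIntegral_const]
    exact h.preimage_le S hS
  have h2 : (fun _ => (1 : ℝ≥0∞)) ≤ᵐ[volume] fun q => K * D q := by
    refine ae_le_of_forall_setLIntegral_le_of_sigmaFinite measurable_const fun S hS _ => ?_
    rw [lintegral_const_mul _ hD, hset S hS, setLIntegral_const, one_mul]
    exact h.le_preimage S hS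
  have hK0 : K ≠ 0 := (zero_lt_one.trans_le hK).ne'
  -- Truncation changes the density only on a null set and makes its two bounds hold everywhere.
  refine ⟨fun q => max K⁻¹ (min K (D q).toNNReal),
    measurable_const.max (measurable_const.min hD.ennreal_toNNReal), fun q => ⟨?_, ?_⟩, ?_⟩
  · refine max_le ?_ (min_le_left _ _)
    exact (inv_le_one_of_one_le₀ hK).trans hK
  · calc (1 : ℝ≥0) = K * K⁻¹ := (mul_inv_cancel₀ hK0).symm
      _ ≤ _ := by gcongr; exact le_max_left _ _
  · rw [← hmap]
    refine withDensity_congr_ae ?_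
    filter_upwards [h1, h2] with q hq1 hq2
    lift D q to ℝ≥0 using ne_top_of_le_ne_top ENNReal.coe_ne_top hq1 with d
    have hd1 : d ≤ K := by exact_mod_cast hq1
    have hd2 : 1 ≤ K * d := by exact_mod_cast hq2
    rw [ENNReal.toNNReal_coe, min_eq_right hd1, max_eq_right]
    rw [inv_le_iff_one_le_mul₀ (zero_lt_one.trans_le hK), mul_comm]
    exact hd2

end Comparable

/-- A chart of the plane straightens the level curves and turns the adapted operators into
convolutions in the second variable. -/
structure IsChart (h : Plane → ℝ) (u : ℝ → ℝ) (e : Plane ≃ᵐ ℝ × ℝ) : Prop where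
  isComparable : IsComparable e 4
  inner_eq : ∀ᵐ x : Plane, ∀ w, inner ℝ (x - e.symm ((e x).1, w)) (dirPerp u (h x)) =
    (e x).2 - w
  deltaMeasure_eq : ∀ᵐ x : Plane, deltaMeasure (auxFun h u (h x)) =
    Measure.map (fun w => e.symm ((e x).1, w)) volume

lemma IsSlope.exists_measurable {u : ℝ → ℝ} (hu : IsSlope u) :
    ∃ s : ℝ → ℝ, Measurable s ∧ (∀ t, |s t| ≤ 1) ∧ u =ᵐ[volume] s := by
  obtain ⟨hm, hb⟩ := hu
  refine ⟨fun t => max (-1) (min 1 (hm.mk u t)),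
    measurable_const.max (measurable_const.min hm.measurable_mk), fun t => ?_, ?_⟩
  · exact abs_le.2 ⟨le_max_left _ _, max_le (by norm_num) (min_le_left _ _)⟩
  · filter_upwards [hm.ae_eq_mk, hb] with t h1 h2
    have := abs_le.1 h2
    rw [← h1, min_eq_right this.2, max_eq_right this.1]

/-- The chart is x ↦ (h(x), x · v^⊥), built from a Borel representative s of u that is bounded by 1
everywhere. -/
lemma exists_isChart {h : Plane → ℝ} {u : ℝ → ℝ} (hh : IsLevelFunction (1 / 4) h)
    (hu : IsSlope u) : ∃ e, IsChart h u e := by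
  obtain ⟨s, hsm, hsb, hus⟩ := hu.exists_measurable
  have hH := hh.isTilted
  set H : ℝ → ℝ → ℝ := fun a b => h !₂[a, b]
  set e₀ := equivOfBijective (levelCoord H s) (hH.measurable_levelCoord hsm)
    (hH.bijective_levelCoord hsb)
  set e := coordEquiv.trans e₀ with he
  have hHx : ∀ x : Plane, H (x 0) (x 1) = h x := fun x => by
    have : !₂[x 0, x 1] = x := by ext i; fin_cases i <;> rfl
    simp only [H, this]
  have hex : ∀ x : Plane, e x = (h x, x 1 - s (h x) * x 0) := fun x => by
    rw [← hHx x]; rfl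
  have hcomp : IsComparable e 4 := by
    have := (hH.isComparable_levelCoord hsm hsb).comp (.of_measurePreserving measurePreserving_coordEquiv)
    rw [mul_one] at this
    exact this
  -- The levels where u and s differ form a null set; its preimage under h is null because the chart
  -- pulls null sets back to null sets.
  have hgood : ∀ᵐ x : Plane, u (h x) = s (h x) := by
    have h1 : ∀ᵐ q : ℝ × ℝ, u q.1 = s q.1 :=
      ae_of_ae_fst (by filter_upwards [hus] with t ht w using ht)
    filter_upwards [hcomp.quasiMeasurePreserving.ae h1] with x hx
    rwa [hex] at hx
  have hsymm : ∀ t w, h (e.symm (t, w)) = t ∧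
      (e.symm (t, w)) 1 = w + s t * (e.symm (t, w)) 0 := fun t w => by
    have h1 := e.apply_symm_apply (t, w)
    rw [hex, Prod.mk.injEq] at h1
    obtain ⟨h2, h3⟩ := h1
    rw [h2] at h3
    exact ⟨h2, by linarith⟩
  refine ⟨e, hcomp, ?_, ?_⟩
  · filter_upwards [hgood] with x hx w
    have h1 := (hsymm (h x) w).2
    simp only [hex, dirPerp, PiLp.inner_apply, Fin.sum_univ_two, hx, PiLp.sub_apply, h1,
      Matrix.cons_val_zero, Matrix.cons_val_one, RCLike.inner_apply, conj_trivial]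
    ring
  · filter_upwards [hgood] with x hx
    set t := h x
    have hpt : ∀ w, !₂[(e.symm (t, w)) 0, w + u t * (e.symm (t, w)) 0] = e.symm (t, w) := by
      intro w
      rw [hx, ← (hsymm t w).2]
      ext i; fin_cases i <;> rfl
    have hm : Measurable fun w => (e.symm (t, w)) 0 := by
      have h1 : Measurable fun w => (coordEquiv (e.symm (t, w))).1 :=
        measurable_fst.comp (coordEquiv.measurable.comp
          (e.symm.measurable.comp (measurable_const.prodMk measurable_id)))
      exact h1
    rw [deltaMeasure_eq hH (by rw [hx]; exact hsb t) hm
      (fun w => by rw [hpt w]; exact (hsymm t w).1)]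
    congr 1
    funext w
    rw [hex]
    simp only [sweep, add_zero]
    exact hpt w

end AdaptedLP

end

/-! ### The adapted operators and their adjoints in the chart -/

noncomputable section

namespace AdaptedLP

open scoped SchwartzMap

lemma IsCutoff.conj {ψ₀ : ℝ → ℂ} (h : IsCutoff ψ₀) : IsCutoff fun t => conj (ψ₀ t) where
  smooth := Complex.conjCLE.contDiff.comp h.smooth
  support_subset := fun t ht => h.support_subset fun h0 => ht (by simp [h0])
  hasSum_one := fun t ht => by simpa using h.hasSum_one t ht

lemma IsCutoff.lpKer_conj {ψ₀ : ℝ → ℂ} (h : IsCutoff ψ₀) (k : ℤ) (x : ℝ) :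
    lpKer h.conj.toSchwartz k x = conj (lpKer h.toSchwartz k (-x)) := by
  rw [← fourierInv_dilate, ← fourierInv_dilate, Real.fourierInv_eq', Real.fourierInv_eq',
    ← integral_conj]
  refine integral_congr_ae (Eventually.of_forall fun v => ?_)
  simp only [smul_eq_mul, map_mul, dilate, ← Complex.exp_conj, Complex.conj_ofReal,
    Complex.conj_I, inner_neg_right, mul_neg, map_neg, Complex.ofReal_neg, neg_mul, neg_neg]

/-- Turns the bilinear transpose into the sesquilinear adjoint: the adjoint multiplier is the
conjugate cut-off. -/
lemma IsCutoff.fibreConvol_reflect {ψ₀ : ℝ → ℂ} (h : IsCutoff ψ₀) (k : ℤ) (B : ℝ × ℝ → ℂ)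
    (q : ℝ × ℝ) : fibreConvol (reflect (lpKer h.toSchwartz k)) (fun z => conj (B z)) q =
      conj (fibreConvol (lpKer h.conj.toSchwartz k) B q) := by
  simp only [fibreConvol, convol]
  rw [← integral_conj]
  refine integral_congr_ae (Eventually.of_forall fun v => ?_)
  simp only [map_mul, h.lpKer_conj, Complex.conj_conj, reflect_apply]

section Chart

variable {h : Plane → ℝ} {u : ℝ → ℝ} {e : Plane ≃ᵐ ℝ × ℝ} {ψ₀ : ℝ → ℂ}

lemma measurableEmbedding_fibre (e : Plane ≃ᵐ ℝ × ℝ) (t : ℝ) :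
    MeasurableEmbedding fun w => e.symm (t, w) :=
  e.symm.measurableEmbedding.comp (measurableEmbedding_prodMk_left t)

/-- The measure on the level curve becomes dw and the kernel argument a difference of second
coordinates. The exceptional set depends on neither k nor f. -/
lemma IsChart.adaptedLP_eq (he : IsChart h u e) (hψ : IsCutoff ψ₀) : ∀ᵐ x : Plane, ∀ k f,
    adaptedLP h u ψ₀ k f x = fibreConvol (lpKer hψ.toSchwartz k) (f ∘ e.symm) (e x) := by
  filter_upwards [he.inner_eq, he.deltaMeasure_eq] with x h1 h2 k f
  rw [adaptedLP, h2, (measurableEmbedding_fibre e _).integral_map]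
  simp only [integrand, h1, fourierInv_dilate hψ]
  rfl

lemma IsChart.integrable_integrand (he : IsChart h u e) (hψ : IsCutoff ψ₀) {p : ℝ≥0∞}
    (hp : 1 < p) (hp' : p < ⊤) {f : Plane → ℂ} (hf : MemLp f p) (k : ℤ) :
    ∀ᵐ x : Plane, Integrable (integrand h u ψ₀ k f x) (deltaMeasure (auxFun h u (h x))) := by
  have hF := he.isComparable.memLp_comp_symm (by norm_num) hp.le hp'.ne hf
  have hfib : ∀ᵐ q : ℝ × ℝ, MemLp (fun w => f (e.symm (q.1, w))) p :=
    ae_of_ae_fst ((ae_memLp_fibre (zero_lt_one.trans hp).ne' hp'.ne hF).mono fun t ht w => ht)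
  filter_upwards [he.inner_eq, he.deltaMeasure_eq,
    he.isComparable.quasiMeasurePreserving.ae hfib] with x h1 h2 h3
  rw [h2, (measurableEmbedding_fibre e _).integrable_map_iff]
  refine (integrable_mul_comp_sub (lpKer hψ.toSchwartz k) hp.le h3 (e x).2).congr
    (Eventually.of_forall fun w => ?_)
  simp only [Function.comp_apply, integrand, h1, fourierInv_dilate hψ]

lemma IsChart.memLp_adaptedLP (he : IsChart h u e) (hψ : IsCutoff ψ₀) {p : ℝ≥0∞}
    (hp : 1 < p) (hp' : p < ⊤) {f : Plane → ℂ} (hf : MemLp f p) (k : ℤ) :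
    MemLp (adaptedLP h u ψ₀ k f) p := by
  have hF := he.isComparable.memLp_comp_symm (by norm_num) hp.le hp'.ne hf
  refine (memLp_congr_ae ?_).2 (he.isComparable.memLp_comp (by norm_num) hp.le hp'.ne
    (hψ.memLp_fibreConvol hp hp' hF k))
  filter_upwards [he.adaptedLP_eq hψ] with x hx using hx k f

lemma IsChart.squareFun_adaptedLP (he : IsChart h u e) (hψ : IsCutoff ψ₀) (f : Plane → ℂ) :
    squareFun (fun k => adaptedLP h u ψ₀ k f) =ᵐ[volume]
      fibreSquare hψ.toSchwartz (f ∘ e.symm) ∘ e := by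
  filter_upwards [he.adaptedLP_eq hψ] with x hx
  simp only [squareFun, hx, Function.comp_apply, fibreSquare]

/-- The values of the adjoint in a chart. -/
def chartAdjoint (e : Plane ≃ᵐ ℝ × ℝ) (J : ℝ × ℝ → ℝ≥0) (m : 𝓢(ℝ, ℂ)) (k : ℤ) (g : Plane → ℂ)
    (q : ℝ × ℝ) : ℂ :=
  (J q)⁻¹ • fibreConvol (lpKer m k) (fun z => J z • g (e.symm z)) q

lemma memLp_nnreal_smul {α : Type*} [MeasureSpace α] {J : α → ℝ≥0} (hJ : Measurable J) {K : ℝ≥0}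
    (hK : ∀ q, J q ≤ K) {p : ℝ≥0∞} {F : α → ℂ} (hF : MemLp F p) :
    MemLp (fun q => J q • F q) p := by
  refine hF.of_le_mul (c := K) (hJ.aestronglyMeasurable.smul hF.1)
    (Eventually.of_forall fun q => ?_)
  rw [NNReal.smul_def, norm_smul, Real.norm_of_nonneg (NNReal.coe_nonneg _)]
  exact mul_le_mul_of_nonneg_right (hK q) (norm_nonneg _)

lemma integral_comp_eq_integral_density {J : ℝ × ℝ → ℝ≥0} (hJ : Measurable J)
    (hJe : Measure.map e volume = (volume : Measure (ℝ × ℝ)).withDensity fun q => J q)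
    (A : ℝ × ℝ → ℂ) : ∫ x : Plane, A (e x) = ∫ q, J q • A q := by
  rw [← e.measurableEmbedding.integral_map, hJe, integral_withDensity_eq_integral_smul hJ]

/-- Passing to the chart puts the density J on g; the convolution is then moved across by
transposition, and J⁻¹ restores the measure dx. Both weights are bounded, since 1/4 ≤ J ≤ 4. -/
lemma IsChart.isAdjointValue (he : IsChart h u e) (hψ : IsCutoff ψ₀) {J : ℝ × ℝ → ℝ≥0}
    (hJ : Measurable J) (hJK : ∀ q, J q ≤ 4 ∧ 1 ≤ 4 * J q)
    (hJe : Measure.map e volume = (volume : Measure (ℝ × ℝ)).withDensity fun q => J q)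
    {p : ℝ≥0∞} (hp : 1 < p) (hp' : p < ⊤) {g : Plane → ℂ} (hg : MemLp g p) (k : ℤ) :
    IsAdjointValue (adaptedLP h u ψ₀ k) p g (chartAdjoint e J hψ.conj.toSchwartz k g ∘ e) := by
  have hpq : p.HolderConjugate p.conjExponent := ENNReal.HolderConjugate.conjExponent hp.le
  set q := p.conjExponent
  have hq1 : 1 < q := (ENNReal.HolderConjugate.lt_top_iff_one_lt p q).1 hp'
  have hq : q < ⊤ := (ENNReal.HolderConjugate.lt_top_iff_one_lt q p).2 hp
  have hJ0 : ∀ z, J z ≠ 0 := fun z h0 => by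
    have := (hJK z).2
    rw [h0, mul_zero] at this
    exact absurd this (by norm_num)
  have hJi : ∀ z, (J z)⁻¹ ≤ 4 := fun z => by
    rw [inv_le_iff_one_le_mul₀ (pos_of_ne_zero (hJ0 z))]
    exact (hJK z).2
  have hB := memLp_nnreal_smul hJ (fun z => (hJK z).1)
    (he.isComparable.memLp_comp_symm (by norm_num) hp.le hp'.ne hg)
  simp only [Function.comp_apply] at hB
  set B : ℝ × ℝ → ℂ := fun z => J z • g (e.symm z)
  have hD := hψ.conj.memLp_fibreConvol hp hp' hB k
  refine ⟨he.isComparable.memLp_comp (by norm_num) hp.le hp'.ne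
    (memLp_nnreal_smul hJ.inv hJi hD), fun f hf => ?_⟩
  have hF := he.isComparable.memLp_comp_symm (by norm_num) hq1.le hq.ne hf
  have h1 : ∫ x, adaptedLP h u ψ₀ k f x * conj (g x) =
      ∫ z, fibreConvol (lpKer hψ.toSchwartz k) (f ∘ e.symm) z * conj (B z) := by
    have h2 := integral_comp_eq_integral_density hJ hJe (fun z =>
      fibreConvol (lpKer hψ.toSchwartz k) (f ∘ e.symm) z * conj (g (e.symm z)))
    refine (integral_congr_ae ?_).trans (h2.trans (integral_congr_ae ?_))
    · filter_upwards [he.adaptedLP_eq hψ] with x hx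
      rw [hx, e.symm_apply_apply]
    · refine Eventually.of_forall fun z => ?_
      simp only [B, NNReal.smul_def, Complex.real_smul, map_mul, Complex.conj_ofReal]
      ring
  have h3 : ∫ x, f x * conj ((chartAdjoint e J hψ.conj.toSchwartz k g ∘ e) x) =
      ∫ z, (f ∘ e.symm) z * conj (fibreConvol (lpKer hψ.conj.toSchwartz k) B z) := by
    have h2 := integral_comp_eq_integral_density hJ hJe (fun z =>
      f (e.symm z) * conj (chartAdjoint e J hψ.conj.toSchwartz k g z))
    refine (integral_congr_ae ?_).trans (h2.trans (integral_congr_ae ?_))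
    · refine Eventually.of_forall fun x => ?_
      simp only [e.symm_apply_apply, Function.comp_apply]
    · refine Eventually.of_forall fun z => ?_
      have hJz : ((J z : ℝ) : ℂ) ≠ 0 := by exact_mod_cast hJ0 z
      simp only [chartAdjoint, NNReal.smul_def, Complex.real_smul, map_mul, Complex.conj_ofReal,
        Function.comp_apply, NNReal.coe_inv, Complex.ofReal_inv, map_inv₀]
      rw [mul_left_comm, ← mul_assoc _ _ (conj _)]
      rw [mul_inv_cancel₀ hJz, one_mul]
      simp only [B, NNReal.smul_def, Complex.real_smul]
  have hcB : MemLp (fun z => conj (B z)) p := hB.star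
  have hcD : MemLp (fibreConvol (reflect (lpKer hψ.toSchwartz k)) fun z => conj (B z)) p := by
    refine (memLp_congr_ae (Eventually.of_forall fun z => ?_)).2 hD.star
    exact hψ.fibreConvol_reflect k B z
  have hqp : q.HolderConjugate p := hpq.symm
  rw [h1, h3, integral_fibreConvol_mul _ hq1 hq hF hcB (hψ.memLp_fibreConvol hq1 hq hF k) hcD]
  simp only [hψ.fibreConvol_reflect]

/-- Testing against indicators of sets of finite measure determines the function. Thus the chosen
adjoint agrees almost everywhere with the explicit one. -/
lemma IsAdjointValue.unique {T : (Plane → ℂ) → (Plane → ℂ)} {p : ℝ≥0∞} (hp : 1 ≤ p)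
    {g G G' : Plane → ℂ} (hG : IsAdjointValue T p g G) (hG' : IsAdjointValue T p g G') :
    G =ᵐ[volume] G' := by
  have hint : ∀ F : Plane → ℂ, MemLp F p → ∀ S : Set Plane, MeasurableSet S → volume S < ⊤ →
      IntegrableOn F S := fun F hF S _ hS => by
    have : IsFiniteMeasure ((volume : Measure Plane).restrict S) := ⟨by simpa using hS⟩
    exact (hF.restrict S).integrable hp
  refine ae_eq_of_forall_setIntegral_eq_of_sigmaFinite (hint G hG.1) (hint G' hG'.1)
    fun S hS hSf => ?_
  have hind : MemLp (S.indicator fun _ => (1 : ℂ)) p.conjExponent :=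
    memLp_indicator_const _ hS _ (Or.inr hSf.ne)
  have hconj : ∀ F : Plane → ℂ, ∫ x, S.indicator (fun _ => (1 : ℂ)) x * conj (F x) =
      conj (∫ x in S, F x) := fun F => by
    rw [← integral_conj, ← integral_indicator hS]
    refine integral_congr_ae (Eventually.of_forall fun x => ?_)
    by_cases hx : x ∈ S <;> simp [hx]
  have h1 := (hG.2 _ hind).symm.trans (hG'.2 _ hind)
  rw [hconj, hconj] at h1
  exact (starRingEnd ℂ).injective h1

lemma isAdjointValue_adaptedLPAdjoint {p : ℝ≥0∞} {k : ℤ} {g G : Plane → ℂ}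
    (hG : IsAdjointValue (adaptedLP h u ψ₀ k) p g G) :
    IsAdjointValue (adaptedLP h u ψ₀ k) p g (adaptedLPAdjoint h u ψ₀ p k g) := by
  have H : ∃ G, IsAdjointValue (adaptedLP h u ψ₀ k) p g G := ⟨G, hG⟩
  rw [adaptedLPAdjoint, dif_pos H]
  exact H.choose_spec

lemma square_chartAdjoint (e : Plane ≃ᵐ ℝ × ℝ) (J : ℝ × ℝ → ℝ≥0) (m : 𝓢(ℝ, ℂ)) (g : Plane → ℂ)
    (z : ℝ × ℝ) : (∑' k : ℤ, ‖chartAdjoint e J m k g z‖ₑ ^ 2) ^ (1 / 2 : ℝ) =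
      ((J z)⁻¹ : ℝ≥0) * fibreSquare m (fun z => J z • g (e.symm z)) z := by
  have h1 : ∀ k, ‖chartAdjoint e J m k g z‖ₑ ^ 2 = (((J z)⁻¹ : ℝ≥0) : ℝ≥0∞) ^ 2 *
      ‖fibreConvol (lpKer m k) (fun z => J z • g (e.symm z)) z‖ₑ ^ 2 := fun k => by
    rw [chartAdjoint, NNReal.smul_def, enorm_smul, mul_pow]
    congr 2
    exact Real.enorm_of_nonneg (NNReal.coe_nonneg _) |>.trans (ENNReal.ofReal_coe_nnreal)
  simp only [h1]
  rw [ENNReal.tsum_mul_left, ENNReal.mul_rpow_of_nonneg _ _ (by norm_num), fibreSquare]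
  congr 1
  rw [← ENNReal.rpow_ofNat, ← ENNReal.rpow_mul]
  norm_num

/-- Entering and leaving the chart costs a factor 4 each, hence 16. -/
lemma IsChart.eLpNorm_squareFun_adaptedLP (he : IsChart h u e) (hψ : IsCutoff ψ₀) {p : ℝ≥0∞}
    (hp : 1 < p) (hp' : p < ⊤) {C : ℝ≥0}
    (hC : ∀ F : ℝ × ℝ → ℂ, MemLp F p →
      eLpNorm (fibreSquare hψ.toSchwartz F) p volume ≤ C * eLpNorm F p volume ∧
      eLpNorm F p volume ≤ C * eLpNorm (fibreSquare hψ.toSchwartz F) p volume)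
    {f : Plane → ℂ} (hf : MemLp f p) :
    eLpNorm (squareFun fun k => adaptedLP h u ψ₀ k f) p volume ≤
        (16 * C : ℝ≥0) * eLpNorm f p volume ∧
      eLpNorm f p volume ≤
        (16 * C : ℝ≥0) * eLpNorm (squareFun fun k => adaptedLP h u ψ₀ k f) p volume := by
  have h4 : (1 : ℝ≥0) ≤ 4 := by norm_num
  obtain ⟨h1, h2⟩ := hC _ (he.isComparable.memLp_comp_symm h4 hp.le hp'.ne hf)
  have hfe : (f ∘ e.symm) ∘ e = f := by rw [Function.comp_assoc, e.symm_comp_self]; rfl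
  have h3 := he.isComparable.eLpNorm_comp_le h4 hp.le hp'.ne (f ∘ e.symm)
  have h5 := he.isComparable.le_eLpNorm_comp h4 hp.le hp'.ne (f ∘ e.symm)
  have h6 := he.isComparable.eLpNorm_comp_le h4 hp.le hp'.ne
    (fibreSquare hψ.toSchwartz (f ∘ e.symm))
  have h7 := he.isComparable.le_eLpNorm_comp h4 hp.le hp'.ne
    (fibreSquare hψ.toSchwartz (f ∘ e.symm))
  rw [hfe] at h3 h5
  rw [eLpNorm_congr_ae (he.squareFun_adaptedLP hψ f),
    show ((16 * C : ℝ≥0) : ℝ≥0∞) = (4 : ℝ≥0) * (C * (4 : ℝ≥0)) by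
      rw [← ENNReal.coe_mul, ← ENNReal.coe_mul]; congr 1; ring, mul_assoc, mul_assoc, mul_assoc,
    mul_assoc]
  constructor
  · refine h6.trans (mul_le_mul' le_rfl (h1.trans (mul_le_mul' le_rfl h5)))
  · refine h3.trans (mul_le_mul' le_rfl (h2.trans (mul_le_mul' le_rfl h7)))

lemma IsChart.squareFun_adaptedLPAdjoint (he : IsChart h u e) (hψ : IsCutoff ψ₀)
    {J : ℝ × ℝ → ℝ≥0} (hJ : Measurable J) (hJK : ∀ q, J q ≤ 4 ∧ 1 ≤ 4 * J q)
    (hJe : Measure.map e volume = (volume : Measure (ℝ × ℝ)).withDensity fun q => J q)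
    {p : ℝ≥0∞} (hp : 1 < p) (hp' : p < ⊤) {g : Plane → ℂ} (hg : MemLp g p) :
    squareFun (fun k => adaptedLPAdjoint h u ψ₀ p k g) =ᵐ[volume]
      (fun z => ((J z)⁻¹ : ℝ≥0) *
        fibreSquare hψ.conj.toSchwartz (fun z => J z • g (e.symm z)) z) ∘ e := by
  have h1 : ∀ k, adaptedLPAdjoint h u ψ₀ p k g =ᵐ[volume]
      chartAdjoint e J hψ.conj.toSchwartz k g ∘ e := fun k =>
    have h2 := he.isAdjointValue hψ hJ hJK hJe hp hp' hg k
    (isAdjointValue_adaptedLPAdjoint h2).unique hp.le h2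
  filter_upwards [ae_all_iff.2 h1] with x hx
  simp only [squareFun, hx, Function.comp_apply, square_chartAdjoint]

lemma eLpNorm_le_of_enorm_le {α ε ε' : Type*} [MeasureSpace α] [TopologicalSpace ε]
    [ContinuousENorm ε] [TopologicalSpace ε'] [ContinuousENorm ε'] {F : α → ε} {G : α → ε'}
    {K : ℝ≥0} (h : ∀ x, ‖F x‖ₑ ≤ K * ‖G x‖ₑ) (p : ℝ≥0∞) :
    eLpNorm F p volume ≤ K * eLpNorm G p volume :=
  (eLpNorm_le_nnreal_smul_eLpNorm_of_ae_le_mul' (Eventually.of_forall h) p).trans_eq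
    (ENNReal.smul_def _ _)

/-- Besides the two changes of variables, the weights J and J⁻¹ cost a factor 4 each, hence 256. -/
lemma IsChart.eLpNorm_squareFun_adjoint (he : IsChart h u e) (hψ : IsCutoff ψ₀) {p : ℝ≥0∞}
    (hp : 1 < p) (hp' : p < ⊤) {C : ℝ≥0}
    (hC : ∀ F : ℝ × ℝ → ℂ, MemLp F p →
      eLpNorm (fibreSquare hψ.conj.toSchwartz F) p volume ≤ C * eLpNorm F p volume ∧
      eLpNorm F p volume ≤ C * eLpNorm (fibreSquare hψ.conj.toSchwartz F) p volume)
    {g : Plane → ℂ} (hg : MemLp g p) :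
    (∀ k, IsAdjointValue (adaptedLP h u ψ₀ k) p g (adaptedLPAdjoint h u ψ₀ p k g)) ∧
    eLpNorm (squareFun fun k => adaptedLPAdjoint h u ψ₀ p k g) p volume ≤
        (256 * C : ℝ≥0) * eLpNorm g p volume ∧
      eLpNorm g p volume ≤
        (256 * C : ℝ≥0) * eLpNorm (squareFun fun k => adaptedLPAdjoint h u ψ₀ p k g) p volume := by
  have h4 : (1 : ℝ≥0) ≤ 4 := by norm_num
  obtain ⟨J, hJ, hJK, hJe⟩ := he.isComparable.exists_density h4
  refine ⟨fun k => isAdjointValue_adaptedLPAdjoint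
    (he.isAdjointValue hψ hJ hJK hJe hp hp' hg k), ?_⟩
  have hF := he.isComparable.memLp_comp_symm h4 hp.le hp'.ne hg
  have hB := memLp_nnreal_smul hJ (fun z => (hJK z).1) hF
  set F := g ∘ e.symm with hFdef
  set B : ℝ × ℝ → ℂ := fun z => J z • F z
  set S := fibreSquare hψ.conj.toSchwartz B
  set S' : ℝ × ℝ → ℝ≥0∞ := fun z => ((J z)⁻¹ : ℝ≥0) * S z
  obtain ⟨h1, h2⟩ := hC _ hB
  have hge : F ∘ e = g := by rw [hFdef, Function.comp_assoc, e.symm_comp_self]; rfl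
  have h3 := he.isComparable.eLpNorm_comp_le h4 hp.le hp'.ne F
  have h5 := he.isComparable.le_eLpNorm_comp h4 hp.le hp'.ne F
  have h6 := he.isComparable.eLpNorm_comp_le h4 hp.le hp'.ne S'
  have h7 := he.isComparable.le_eLpNorm_comp h4 hp.le hp'.ne S'
  rw [hge] at h3 h5
  have hJ0 : ∀ z, 0 < J z := fun z => by
    by_contra! h0
    have := (hJK z).2
    rw [nonpos_iff_eq_zero.1 h0, mul_zero] at this
    exact absurd this (by norm_num)
  have hJi : ∀ z, (J z)⁻¹ ≤ 4 ∧ 1 ≤ 4 * (J z)⁻¹ := fun z => by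
    constructor
    · rw [inv_le_iff_one_le_mul₀ (hJ0 z)]
      exact (hJK z).2
    · rw [← div_eq_mul_inv, one_le_div (hJ0 z)]
      exact (hJK z).1
  have hBn : ∀ z, ‖B z‖ₑ = J z * ‖F z‖ₑ := fun z => by
    simp only [B]
    rw [NNReal.smul_def, enorm_smul]
    congr 1
    exact (Real.enorm_of_nonneg (NNReal.coe_nonneg _)).trans ENNReal.ofReal_coe_nnreal
  have a1 : eLpNorm B p volume ≤ (4 : ℝ≥0) * eLpNorm F p volume :=
    eLpNorm_le_of_enorm_le (fun z => by
      rw [hBn]; exact mul_le_mul' (by exact_mod_cast (hJK z).1) le_rfl) p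
  have a2 : eLpNorm F p volume ≤ (4 : ℝ≥0) * eLpNorm B p volume :=
    eLpNorm_le_of_enorm_le (fun z => by
      rw [hBn, ← mul_assoc]
      exact le_mul_of_one_le_left' (by exact_mod_cast (hJK z).2)) p
  have a3 : eLpNorm S' p volume ≤ (4 : ℝ≥0) * eLpNorm S p volume :=
    eLpNorm_le_of_enorm_le (fun z => by
      rw [enorm_eq_self, enorm_eq_self]
      exact mul_le_mul' (by exact_mod_cast (hJi z).1) le_rfl) p
  have a4 : eLpNorm S p volume ≤ (4 : ℝ≥0) * eLpNorm S' p volume :=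
    eLpNorm_le_of_enorm_le (fun z => by
      rw [enorm_eq_self, enorm_eq_self, ← mul_assoc]
      exact le_mul_of_one_le_left' (by exact_mod_cast (hJi z).2)) p
  rw [eLpNorm_congr_ae (he.squareFun_adaptedLPAdjoint hψ hJ hJK hJe hp hp' hg)]
  have h256 : ∀ X : ℝ≥0∞, ((256 * C : ℝ≥0) : ℝ≥0∞) * X =
      (4 : ℝ≥0) * ((4 : ℝ≥0) * (C * ((4 : ℝ≥0) * ((4 : ℝ≥0) * X)))) := fun X => by
    simp only [← mul_assoc, ← ENNReal.coe_mul]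
    congr 2
    ring
  rw [h256, h256]
  constructor
  · exact h6.trans (mul_le_mul' le_rfl (a3.trans (mul_le_mul' le_rfl (h1.trans
      (mul_le_mul' le_rfl (a1.trans (mul_le_mul' le_rfl h5)))))))
  · exact h3.trans (mul_le_mul' le_rfl (a2.trans (mul_le_mul' le_rfl (h2.trans
      (mul_le_mul' le_rfl (a4.trans (mul_le_mul' le_rfl h7)))))))

end Chart

end AdaptedLP

end

/-! ### Assembly of both halves -/

theorem mainTheorem6 :
    ∃ ε₀ : ℝ, 0 < ε₀ ∧
      ∀ p : ℝ≥0∞, 1 < p → p < ⊤ →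
      ∀ ψ₀ : ℝ → ℂ, AdaptedLP.IsCutoff ψ₀ →
      ∃ C : ℝ≥0,
        ∀ (h : AdaptedLP.Plane → ℝ) (u : ℝ → ℝ),
          AdaptedLP.IsLevelFunction ε₀ h → AdaptedLP.IsSlope u →
          (∀ f : AdaptedLP.Plane → ℂ, MemLp f p →
            (∀ k : ℤ,
              (∀ᵐ x : AdaptedLP.Plane, Integrable (AdaptedLP.integrand h u ψ₀ k f x)
                (AdaptedLP.deltaMeasure (AdaptedLP.auxFun h u (h x)))) ∧
              MemLp (AdaptedLP.adaptedLP h u ψ₀ k f) p) ∧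
            eLpNorm (AdaptedLP.squareFun fun k => AdaptedLP.adaptedLP h u ψ₀ k f) p volume
              ≤ C * eLpNorm f p volume ∧
            eLpNorm f p volume ≤
              C * eLpNorm (AdaptedLP.squareFun fun k => AdaptedLP.adaptedLP h u ψ₀ k f)
                p volume) ∧
          (∀ g : AdaptedLP.Plane → ℂ, MemLp g p →
            (∀ k : ℤ, AdaptedLP.IsAdjointValue (AdaptedLP.adaptedLP h u ψ₀ k) p g
              (AdaptedLP.adaptedLPAdjoint h u ψ₀ p k g)) ∧
            eLpNorm (AdaptedLP.squareFun fun k => AdaptedLP.adaptedLPAdjoint h u ψ₀ p k g)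
                p volume ≤ C * eLpNorm g p volume ∧
            eLpNorm g p volume ≤
              C * eLpNorm (AdaptedLP.squareFun fun k =>
                AdaptedLP.adaptedLPAdjoint h u ψ₀ p k g) p volume) := by
  -- The threshold required by `IsTilted`. It depends on neither p nor ψ₀.
  refine ⟨1 / 4, by norm_num, fun p hp hp' ψ₀ hψ => ?_⟩
  obtain ⟨C₁, hC₁⟩ := hψ.exists_fibreSquare hp hp'
  obtain ⟨C₂, hC₂⟩ := hψ.conj.exists_fibreSquare hp hp'
  have hle₁ : ((16 * C₁ : ℝ≥0) : ℝ≥0∞) ≤ ((16 * C₁ + 256 * C₂ : ℝ≥0) : ℝ≥0∞) :=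
    ENNReal.coe_le_coe.2 le_self_add
  have hle₂ : ((256 * C₂ : ℝ≥0) : ℝ≥0∞) ≤ ((16 * C₁ + 256 * C₂ : ℝ≥0) : ℝ≥0∞) :=
    ENNReal.coe_le_coe.2 le_add_self
  refine ⟨16 * C₁ + 256 * C₂, fun h u hh hu => ?_⟩
  obtain ⟨e, he⟩ := AdaptedLP.exists_isChart hh hu
  refine ⟨fun f hf => ⟨fun k => ⟨he.integrable_integrand hψ hp hp' hf k,
    he.memLp_adaptedLP hψ hp hp' hf k⟩, ?_⟩, fun g hg => ?_⟩
  · obtain ⟨h1, h2⟩ := he.eLpNorm_squareFun_adaptedLP hψ hp hp' hC₁ hf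
    exact ⟨h1.trans (mul_le_mul' hle₁ le_rfl), h2.trans (mul_le_mul' hle₁ le_rfl)⟩
  · obtain ⟨h0, h1, h2⟩ := he.eLpNorm_squareFun_adjoint hψ hp hp' hC₂ hg
    exact ⟨h0, h1.trans (mul_le_mul' hle₂ le_rfl), h2.trans (mul_le_mul' hle₂ le_rfl)⟩
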